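/- **Setting.** For every $n\ge 2$ let $p=p_n\ge 1$ be an integer and let $\sigma=\sigma_n>0$, $\Delta=\Delta_n>0$ be real numbers. For $\theta\in\mathbb R^p$ and $\eta\in\{-1,1\}^n$ let $\mathbf P_{(\theta,\eta)}$ (with expectation $\mathbf E_{(\theta,\eta)}$) be the law of the $p\times n$ matrix $Y$ with columns $Y_i=\eta_i\theta+\sigma\xi_i$, $i=1,\dots,n$, where $\xi_1,\dots,\xi_n$ are independent standard Gaussian vectors in $\mathbb R^p$. Put $\Omega_\Delta=\{\theta\in\mathbb R^p:\|\theta\|\ge\Delta\}\times\{-1,1\}^n$ ($\|\cdot\|$ the Euclidean norm). An estimator $\hat\eta$ is, for each $n$, a measurable function of $Y$ with values in $\{-1,1\}^n$, and its loss is $r(\hat\eta,\eta)=\min_{\nu\in\{-1,1\}}\sum_{j=1}^n|\hat\eta_j-\nu\eta_j|$. An estimator $\hat\eta$ *achieves almost full recovery* if $\lim_{n\to\infty}\sup_{(\theta,\eta)\in\Omega_{\Delta_n}}\frac1n\mathbf E_{(\theta,\eta)}r(\hat\eta,\eta)=0$, and *achieves exact recovery* if $\lim_{n\to\infty}\sup_{(\theta,\eta)\in\Omega_{\Delta_n}}\mathbf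 E_{(\theta,\eta)}r(\hat\eta,\eta)=0$; almost full (exact) recovery is *possible* if some estimator achieves it. Exact recovery is *impossible* if $\liminf_{n\to\infty}\inf_{\tilde\eta}\sup_{(\theta,\eta)\in\Omega_{\Delta_n}}\mathbf E_{(\theta,\eta)}r(\tilde\eta,\eta)>0$, the infimum being over all estimators. Let $\Phi^{\mathsf c}(t)=\mathbf P(z>t)$ for a standard Gaussian $z$, and $$\mathbf r_n=\frac{\Delta_n^2/\sigma_n^2}{\sqrt{\Delta_n^2/\sigma_n^2+p_n/n}}.$$ For a square matrix $M$ let $\mathbf H(M)=M-\mathrm{diag}(M)$ be $M$ with its diagonal replaced by zeros, and let $\mathrm{sign}$ act entrywise with $\mathrm{sign}(0)=1$. Let $\eta^0=\mathrm{sign}(\hat v)$, where $\hat v=\hat v(Y)\neq0$ is an eigenvector for the largest eigenvalue of $\mathbf H(Y^\top Y)$, and $\eta^{k+1}=\mathrm{sign}(\mathbf H(Y^\top Y)\eta^k)$ for $k\ge0$. Here $\hat v$ may be chosen in any way for which $\eta^0$ is a measurable function of $Y$; the statements below about $\eta^k$ hold for every such choice, and such a choice exists. **Theorem.** (i) Almost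 full recovery is possible if and only if $\Phi^{\mathsf c}(\mathbf r_n)\to0$ as $n\to\infty$. In this case the estimator $\eta^k$ with $k=\lfloor 3\log n\rfloor$ achieves almost full recovery. (ii) Exact recovery is impossible if $\liminf_{n\to\infty}n\,\Phi^{\mathsf c}(\mathbf r_n(1+\epsilon))>0$ for some $\epsilon>0$, and it is possible if $n\,\Phi^{\mathsf c}(\mathbf r_n(1-\epsilon))\to0$ as $n\to\infty$ for some $\epsilon>0$. In the latter case the estimator $\eta^k$ with $k=\lfloor 3\log n\rfloor$ achieves exact recovery. -/

import Mathlib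

open Filter Topology MeasureTheory ProbabilityTheory
open scoped ENNReal Matrix

noncomputable section

namespace GaussMix

/-- Label vectors, i.e. elements of `{-1, 1}^n`. -/
abbrev Labels (n : ℕ) : Type := Fin n → ℤˣ

/-- The data `(Y_1, …, Y_n)`, `n` vectors in `ℝ^p`: `Y i a` is the `a`-th coordinate of `Y_i`.
These vectors are the columns of the `p × n` matrix `Y`. -/
abbrev Data (p n : ℕ) : Type := Fin n → Fin p → ℝ

/-- The `±1` vector `η`, as a vector of real numbers. -/
def Labels.toReal {n : ℕ} (η : Labels n) : Fin n → ℝ := fun i => ((η i : ℤ) : ℝ)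

/-- The law of `n` independent standard Gaussian vectors `ξ_1, …, ξ_n` of `ℝ^p`
(`ξ i a` is the `a`-th coordinate of `ξ_i`). -/
def noise (p n : ℕ) : Measure (Data p n) :=
  Measure.pi fun _ => Measure.pi fun _ => gaussianReal 0 1

/-- The law `P_(θ, η)` of the observations `Y_i = η_i θ + σ ξ_i`. -/
def law {p n : ℕ} (σ : ℝ) (θ : EuclideanSpace ℝ (Fin p)) (η : Labels n) :
    Measure (Data p n) :=
  (noise p n).map fun ξ i a => η.toReal i * θ a + σ * ξ i a

/-- The parameter set `Ω_Δ = {θ : ‖θ‖ ≥ Δ} × {-1, 1}^n`. -/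
def paramSet (p n : ℕ) (Δ : ℝ) : Set (EuclideanSpace ℝ (Fin p) × Labels n) :=
  {ω | Δ ≤ ‖ω.1‖}

/-- `|x - y| = ∑ j, |x_j - y_j|`, which is twice the number of coordinates that differ. -/
def hammingLoss {n : ℕ} (x y : Labels n) : ℕ :=
  ∑ j, ((x j : ℤ) - (y j : ℤ)).natAbs

/-- The loss `min_{ν ∈ {-1, 1}} |x - ν y|`. -/
def loss {n : ℕ} (x y : Labels n) : ℕ := min (hammingLoss x y) (hammingLoss x (-y))

/-- `sup_{(θ, η) ∈ Ω_Δ} E_(θ, η) r(f(Y), η)`. -/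
def maxRisk {p n : ℕ} (σ Δ : ℝ) (f : Data p n → Labels n) : ℝ≥0∞ :=
  ⨆ ω ∈ paramSet p n Δ, ∫⁻ Y, (loss (f Y) ω.2 : ℝ≥0∞) ∂(law σ ω.1 ω.2)

/-- `inf_f sup_{(θ, η) ∈ Ω_Δ} E_(θ, η) r(f(Y), η)`, the infimum being over all estimators, that is,
over all measurable functions of the data with values in `{-1, 1}^n`. -/
def minimaxRisk (p n : ℕ) (σ Δ : ℝ) : ℝ≥0∞ :=
  ⨅ (f : Data p n → Labels n) (_ : Measurable f), maxRisk σ Δ f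

/-- The sequence of estimators `f` achieves almost full recovery. -/
def AchievesAlmostFull (p : ℕ → ℕ) (σ Δ : ℕ → ℝ) (f : ∀ n, Data (p n) n → Labels n) : Prop :=
  (∀ n ≥ 2, Measurable (f n)) ∧
    Tendsto (fun n : ℕ => (n : ℝ≥0∞)⁻¹ * maxRisk (σ n) (Δ n) (f n)) atTop (𝓝 0)

/-- Almost full recovery is possible. -/
def AlmostFullPossible (p : ℕ → ℕ) (σ Δ : ℕ → ℝ) : Prop :=
  ∃ f : ∀ n, Data (p n) n → Labels n, AchievesAlmostFull p σ Δ f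

/-- The sequence of estimators `f` achieves exact recovery. -/
def AchievesExact (p : ℕ → ℕ) (σ Δ : ℕ → ℝ) (f : ∀ n, Data (p n) n → Labels n) : Prop :=
  (∀ n ≥ 2, Measurable (f n)) ∧
    Tendsto (fun n : ℕ => maxRisk (σ n) (Δ n) (f n)) atTop (𝓝 0)

/-- Exact recovery is possible. -/
def ExactPossible (p : ℕ → ℕ) (σ Δ : ℕ → ℝ) : Prop :=
  ∃ f : ∀ n, Data (p n) n → Labels n, AchievesExact p σ Δ f

/-- Exact recovery is impossible. -/
def ExactImpossible (p : ℕ → ℕ) (σ Δ : ℕ → ℝ) : Prop :=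
  0 < liminf (fun n : ℕ => minimaxRisk (p n) n (σ n) (Δ n)) atTop

/-- The signal-to-noise ratio `r_n = (Δ² / σ²) / √(Δ² / σ² + p / n)`. -/
def snr (p n : ℕ) (σ Δ : ℝ) : ℝ :=
  (Δ ^ 2 / σ ^ 2) / Real.sqrt (Δ ^ 2 / σ ^ 2 + (p : ℝ) / (n : ℝ))

/-- The Gaussian tail `Φᶜ(t) = P(z > t)`, `z` standard Gaussian. -/
def gaussianTail (t : ℝ) : ℝ≥0∞ := gaussianReal 0 1 (Set.Ioi t)

/-- The Gram matrix `Yᵀ Y`, with entries `⟨Y_i, Y_j⟩`. -/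
def gram {p n : ℕ} (Y : Data p n) : Matrix (Fin n) (Fin n) ℝ :=
  Matrix.of fun i j => Y i ⬝ᵥ Y j

/-- `H(M) = M - diag(M)`. -/
def hollow {n : ℕ} (M : Matrix (Fin n) (Fin n) ℝ) : Matrix (Fin n) (Fin n) ℝ :=
  M - Matrix.diagonal M.diag

/-- The vector of signs of the coordinates of `x`, with `sign 0 = 1`. -/
def signVec {n : ℕ} (x : Fin n → ℝ) : Labels n := fun i => if 0 ≤ x i then 1 else -1

/-- `v` is an eigenvector of `M` for the largest eigenvalue of `M`. -/
def IsTopEigenvector {n : ℕ} (M : Matrix (Fin n) (Fin n) ℝ) (v : Fin n → ℝ) : Prop :=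
  ∃ lam : ℝ, Module.End.HasEigenvector (Matrix.toLin' M) lam v ∧
    ∀ μ : ℝ, Module.End.HasEigenvalue (Matrix.toLin' M) μ → μ ≤ lam

/-- `f` is a spectral estimator `η⁰ = sign(v̂)`, where `v̂` is an eigenvector corresponding to the
top eigenvalue of `H(Yᵀ Y)`. Such an eigenvector is not unique (it can be multiplied by any nonzero
scalar, in particular by `-1`), so this is a property of `f` and not a definition of `f`. -/
def IsSpectralEstimator {p n : ℕ} (f : Data p n → Labels n) : Prop :=
  Measurable f ∧
    ∀ Y : Data p n, ∃ v : Fin n → ℝ, IsTopEigenvector (hollow (gram Y)) v ∧ f Y = signVec v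

/-- The iterations `η^{k+1} = sign(H(Yᵀ Y) η^k)` started from `η⁰`. -/
def lloyd {p n : ℕ} (η₀ : Data p n → Labels n) : ℕ → Data p n → Labels n
  | 0 => η₀
  | k + 1 => fun Y => signVec (hollow (gram Y) *ᵥ (lloyd η₀ k Y).toReal)

end GaussMix

end

/-!
# Recovery of labels in a two-component Gaussian mixture

Dividing the data by `σ` reduces everything to `σ = 1` (`maxRisk_eq_maxRisk_one`). Put `s = ‖θ‖²` and
`r = s / √(s + p / n)`, which is the signal-to-noise ratio at separation `‖θ‖`.

**Upper bound.** With `M = H(Yᵀ Y)`, the matrix `M - s (η ηᵀ - 1)` has operator norm at most a constant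
times `n √(s + p / n)`, that is `n s / r`, outside of an event of probability of order `e⁻ⁿ`
(`noise_hollow_gram_norm`, by a net argument). Hence, for large `r`, the signs of a top eigenvector
are wrong, up to a global sign, at a small fraction of the places (`hammingDist_signVec_top_le`). Call
a place *weak* if the signal that it would receive from the true labels, `η_i (M η)_i`, is below
`δ (n - 1) s`. At a place that is not weak, an iteration can err only if the errors of the preceding
step contribute much through the noise matrix, so that each iteration divides the number of errors
by at least `4`, up to a multiple of the number of weak places (`hammingDist_step_le`,
`loss_lloyd_le`). A Chernoff bound shows that a place is weak with probability at most about
`exp (-(1 - δ)² r² / 2)` (`noise_vote_le`). Since `3 log n` iterations make the geometric term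
`n 4⁻ᵏ` negligible, the risk is at most of the order of `n exp (-(1 - δ)² r² / 2)`
(`maxRisk_lloyd_le`), and this exponent is that of the Gaussian tail.

**Lower bound.** The products `η_i η_j` are not affected by a global sign and their errors are
controlled by the loss (`sum_pairs_le_loss`), so averaging over `η` bounds the risk from below by `n`
times the least error of a test of one label when all the others are known
(`mul_testError_le_of_risk_le`). For a known centre `θ` that error is the Gaussian tail at `‖θ‖`,
which is comparable with `r` when `p` is small compared with `n s`. Otherwise the centre is given a
Gaussian law concentrated just outside of the ball of radius `Δ`. Given the other observations,
`Y_i` is then Gaussian with mean `±` the regression of the centre on them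
(`randomCentreObs_map_eq`), whose norm is at most `(1 + δ)² r` times the standard deviation with
positive probability (`testError_randomCentre_ge`). The outcome is
`mul_gaussianTail_max_le_maxRisk`.

The arbitrarily small factors `1 ± δ` that are lost in the two bounds are absorbed by the factors
`1 ± ε` of the exact recovery thresholds; for almost full recovery they do not matter, because there
the condition is only that `r` tends to infinity.
-/

noncomputable section

namespace GaussMix

/-! ### Centred Gaussian laws and their linear images -/

/-- The standard Gaussian law on `ℝ^p`. -/
abbrev gaussVec (p : ℕ) : Measure (Fin p → ℝ) := Measure.pi fun _ => gaussianReal 0 1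

/-- `μ` is the centred Gaussian law under which a linear functional `L` has variance `q L`. It is
phrased through the characteristic function, so that identities between laws of linear images
become identities between quadratic forms. -/
def IsCentredGaussian {E : Type*} [NormedAddCommGroup E] [NormedSpace ℝ E] [MeasurableSpace E]
    (μ : Measure E) (q : StrongDual ℝ E → ℝ) : Prop :=
  ∀ L, charFunDual μ L = Complex.exp ((-(q L) / 2 : ℝ) : ℂ)

lemma isCentredGaussian_gaussianReal :
    IsCentredGaussian (gaussianReal 0 1) fun L => L 1 ^ 2 := by
  intro L
  rw [IsGaussian.charFunDual_eq, integral_complex_ofReal,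
    integral_continuousLinearMap_gaussianReal, variance_continuousLinearMap_gaussianReal]
  simp [neg_div, max_eq_left (sq_nonneg (L 1))]

lemma IsCentredGaussian.pi {ι : Type*} [Fintype ι] [DecidableEq ι] {E : Type*}
    [NormedAddCommGroup E] [NormedSpace ℝ E] [MeasurableSpace E] {μ : Measure E} [SigmaFinite μ]
    {q : StrongDual ℝ E → ℝ} (h : IsCentredGaussian μ q) :
    IsCentredGaussian (Measure.pi fun _ : ι => μ)
      fun L => ∑ i, q (L.comp (.single ℝ (fun _ => E) i)) := by
  intro L
  rw [charFunDual_pi]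
  simp only [h _, ← Complex.exp_sum]
  congr 1
  push_cast
  rw [← Finset.sum_neg_distrib, Finset.sum_div]

lemma IsCentredGaussian.prod {E F : Type*}
    [NormedAddCommGroup E] [NormedSpace ℝ E] [MeasurableSpace E] {μ : Measure E} [SFinite μ]
    [NormedAddCommGroup F] [NormedSpace ℝ F] [MeasurableSpace F] {ν : Measure F} [SFinite ν]
    {q : StrongDual ℝ E → ℝ} {r : StrongDual ℝ F → ℝ}
    (h : IsCentredGaussian μ q) (h' : IsCentredGaussian ν r) :
    IsCentredGaussian (μ.prod ν) fun L => q (L.comp (.inl ℝ E F)) + r (L.comp (.inr ℝ E F)) := by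
  intro L
  rw [charFunDual_prod, h, h', ← Complex.exp_add]
  congr 1
  push_cast
  ring

lemma isCentredGaussian_gaussVec (p : ℕ) :
    IsCentredGaussian (gaussVec p) fun L => ∑ a, L (Pi.single a 1) ^ 2 :=
  isCentredGaussian_gaussianReal.pi

instance (p n : ℕ) : IsProbabilityMeasure (noise p n) := by unfold noise; infer_instance

lemma isCentredGaussian_noise (p n : ℕ) :
    IsCentredGaussian (noise p n) fun L => ∑ i, ∑ a, L (Pi.single i (Pi.single a 1)) ^ 2 :=
  (isCentredGaussian_gaussVec p).pi

/-- Linear images of centred Gaussian laws agree as soon as their quadratic forms do. -/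
lemma IsCentredGaussian.map_eq_map {E F G : Type*}
    [NormedAddCommGroup E] [NormedSpace ℝ E] [MeasurableSpace E] [BorelSpace E]
    [FiniteDimensional ℝ E] {μ : Measure E} [IsFiniteMeasure μ]
    [NormedAddCommGroup F] [NormedSpace ℝ F] [MeasurableSpace F] [BorelSpace F]
    [FiniteDimensional ℝ F] {ν : Measure F} [IsFiniteMeasure ν]
    [NormedAddCommGroup G] [NormedSpace ℝ G] [MeasurableSpace G] [BorelSpace G]
    [SecondCountableTopology G] [CompleteSpace G]
    {q : StrongDual ℝ E → ℝ} {r : StrongDual ℝ F → ℝ}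
    (hμ : IsCentredGaussian μ q) (hν : IsCentredGaussian ν r)
    {f : E → G} {g : F → G} (hf : IsLinearMap ℝ f) (hg : IsLinearMap ℝ g)
    (h : ∀ L : StrongDual ℝ G, q (L.comp (LinearMap.toContinuousLinearMap (hf.mk' f)))
      = r (L.comp (LinearMap.toContinuousLinearMap (hg.mk' g)))) :
    μ.map f = ν.map g := by
  change μ.map (LinearMap.toContinuousLinearMap (hf.mk' f))
    = ν.map (LinearMap.toContinuousLinearMap (hg.mk' g))
  refine Measure.ext_of_charFunDual (funext fun L => ?_)
  rw [charFunDual_map, charFunDual_map, hμ, hν, h]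

/-- `∑ i, x i • ξ i` is distributed as `‖x‖` times a standard Gaussian vector. -/
lemma noise_map_sum_smul (p : ℕ) {n : ℕ} (x : Fin n → ℝ) {t : ℝ} (ht : t ^ 2 = ∑ i, x i ^ 2) :
    (noise p n).map (fun ξ => ∑ i, x i • ξ i) = (gaussVec p).map (fun g => t • g) := by
  refine (isCentredGaussian_noise p n).map_eq_map (isCentredGaussian_gaussVec p) ?_ ?_ ?_
  · constructor
    · intro ξ ζ; simp [Finset.sum_add_distrib]
    · intro c ξ; simp [Finset.smul_sum, smul_comm c]
  · constructor
    · intro ξ ζ; simp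
    · intro c ξ; simp [smul_comm c]
  · intro L
    have key : ∀ (i : Fin n) (a : Fin p),
        (∑ j, x j • (Pi.single i (Pi.single a 1) : Data p n) j) = x i • Pi.single a 1 := by
      intro i a
      rw [Finset.sum_eq_single i]
      · simp
      · intro j _ hj; simp [hj]
      · simp
    simp only [ContinuousLinearMap.comp_apply, LinearMap.coe_toContinuousLinearMap',
      IsLinearMap.mk'_apply, key, map_smul, smul_eq_mul, mul_pow, ht, ← Finset.mul_sum]
    rw [Finset.sum_mul]

/-- The inner products of the noise vectors with `θ` are distributed as `‖θ‖` times a standard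
Gaussian vector. -/
lemma noise_map_dotProduct {p : ℕ} (n : ℕ) (θ : Fin p → ℝ) {t : ℝ} (ht : t ^ 2 = ∑ a, θ a ^ 2) :
    (noise p n).map (fun ξ i => ξ i ⬝ᵥ θ) = (gaussVec n).map (fun g => t • g) := by
  refine (isCentredGaussian_noise p n).map_eq_map (isCentredGaussian_gaussVec n) ?_ ?_ ?_
  · constructor
    · intro ξ ζ; ext i; simp [add_dotProduct]
    · intro c ξ; ext i; simp [smul_dotProduct]
  · constructor
    · intro ξ ζ; simp
    · intro c ξ; simp [smul_comm c]
  · intro L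
    have key : ∀ (i : Fin n) (a : Fin p),
        (fun j => (Pi.single i (Pi.single a 1) : Data p n) j ⬝ᵥ θ) = θ a • Pi.single i 1 := by
      intro i a
      ext j
      by_cases hj : j = i
      · subst hj; simp
      · simp [hj]
    simp only [ContinuousLinearMap.comp_apply, LinearMap.coe_toContinuousLinearMap',
      IsLinearMap.mk'_apply, key, map_smul, smul_eq_mul, mul_pow, ht, ← Finset.sum_mul,
      ← Finset.mul_sum]

/-- For signs `x`, the noise at one place `i` and the sum over the other places are independent,
and their laws are those of a standard Gaussian vector and of `√(n - 1)` times such a vector. -/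
lemma noise_map_pair (p : ℕ) {n : ℕ} (x : Fin n → ℝ) (hx : ∀ i, x i ^ 2 = 1) (i : Fin n) {t : ℝ}
    (ht : t ^ 2 = (n : ℝ) - 1) :
    (noise p n).map (fun ξ => (x i • ξ i, ∑ j ∈ Finset.univ.erase i, x j • ξ j))
      = ((gaussVec p).prod (gaussVec p)).map (fun g => (g.1, t • g.2)) := by
  refine (isCentredGaussian_noise p n).map_eq_map
    ((isCentredGaussian_gaussVec p).prod (isCentredGaussian_gaussVec p)) ?_ ?_ ?_
  · constructor
    · intro ξ ζ; simp [Finset.sum_add_distrib]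
    · intro c ξ
      simp only [Pi.smul_apply, Prod.smul_mk, Finset.smul_sum, smul_comm c]
  · constructor
    · intro ξ ζ; simp
    · intro c ξ; simp [smul_comm c]
  · intro L
    have key : ∀ (k : Fin n) (a : Fin p),
        (x i • (Pi.single k (Pi.single a 1) : Data p n) i,
          ∑ j ∈ Finset.univ.erase i, x j • (Pi.single k (Pi.single a 1) : Data p n) j)
          = if k = i then ((x k • Pi.single a 1, 0) : (Fin p → ℝ) × (Fin p → ℝ))
            else (0, x k • Pi.single a 1) := by
      intro k a
      split_ifs with h
      · subst h
        ext1
        · simp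
        · change ∑ j ∈ Finset.univ.erase k, _ = (0 : Fin p → ℝ)
          refine Finset.sum_eq_zero fun j hj => ?_
          simp [Finset.ne_of_mem_erase hj]
      · ext1
        · simp [Ne.symm h]
        · change ∑ j ∈ Finset.univ.erase i, _ = _
          rw [Finset.sum_eq_single k]
          · simp
          · intro j _ hj; simp [hj]
          · simp [h]
    have e1 : ∀ (c : ℝ) (a : Fin p), L (c • Pi.single a 1, 0) = c * L (Pi.single a 1, 0) := by
      intro c a
      rw [← smul_eq_mul, ← map_smul]; simp
    have e2 : ∀ (c : ℝ) (a : Fin p), L (0, c • Pi.single a 1) = c * L (0, Pi.single a 1) := by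
      intro c a
      rw [← smul_eq_mul, ← map_smul]; simp
    simp only [ContinuousLinearMap.comp_apply, LinearMap.coe_toContinuousLinearMap',
      IsLinearMap.mk'_apply, key, ContinuousLinearMap.inl_apply, ContinuousLinearMap.inr_apply,
      smul_zero, e2, mul_pow, ht, ← Finset.mul_sum]
    rw [← Finset.add_sum_erase _ _ (Finset.mem_univ i)]
    congr 1
    · simp only [if_true, e1, mul_pow, hx, one_mul]
    · rw [Finset.sum_congr rfl (g := fun _ => ∑ a, L (0, Pi.single a 1) ^ 2)]
      · rw [Finset.sum_const, nsmul_eq_mul, Finset.card_erase_of_mem (Finset.mem_univ i)]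
        have : 1 ≤ n := i.pos
        simp [this]
      · intro k hk
        simp only [if_neg (Finset.ne_of_mem_erase hk), e2, mul_pow, hx, one_mul]

/-! ### Exponential integrals -/

lemma lintegral_exp_quadratic (c : ℝ) {q : ℝ} (hq : q < 1) :
    ∫⁻ w, ENNReal.ofReal (Real.exp (c * w + q / 2 * w ^ 2)) ∂gaussianReal 0 1
      = ENNReal.ofReal ((√(1 - q))⁻¹ * Real.exp (c ^ 2 / (2 * (1 - q)))) := by
  have h1 : 0 < 1 - q := by linarith
  set v : NNReal := ⟨(1 - q)⁻¹, by positivity⟩ with hv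
  have hv0 : v ≠ 0 := by
    intro h
    have h0 : (v : ℝ) = 0 := by rw [h]; rfl
    exact (inv_pos.2 h1).ne' h0
  rw [gaussianReal_of_var_ne_zero _ one_ne_zero,
    lintegral_withDensity_eq_lintegral_mul _ (measurable_gaussianPDF 0 1) (by fun_prop)]
  have : ∀ w : ℝ, (gaussianPDF 0 1 * fun w => ENNReal.ofReal (Real.exp (c * w + q / 2 * w ^ 2))) w
      = ENNReal.ofReal ((√(1 - q))⁻¹ * Real.exp (c ^ 2 / (2 * (1 - q))))
        * gaussianPDF (c / (1 - q)) v w := by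
    intro w
    simp only [Pi.mul_apply, gaussianPDF]
    rw [← ENNReal.ofReal_mul (gaussianPDFReal_nonneg _ _ _), ← ENNReal.ofReal_mul (by positivity)]
    congr 1
    unfold gaussianPDFReal
    have hvr : (v : ℝ) = (1 - q)⁻¹ := rfl
    rw [hvr]
    have e1 : √(2 * Real.pi * (1 - q)⁻¹) = √(2 * Real.pi) * (√(1 - q))⁻¹ := by
      rw [Real.sqrt_mul (by positivity), Real.sqrt_inv]
    rw [e1]
    have hs : √(1 - q) ≠ 0 := (Real.sqrt_pos.2 h1).ne'
    have e2 : Real.exp (-(w - 0) ^ 2 / (2 * (1 : NNReal))) * Real.exp (c * w + q / 2 * w ^ 2)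
        = Real.exp (c ^ 2 / (2 * (1 - q)))
          * Real.exp (-(w - c / (1 - q)) ^ 2 / (2 * (1 - q)⁻¹)) := by
      rw [← Real.exp_add, ← Real.exp_add]
      congr 1
      push_cast
      field_simp
      ring
    simp only [NNReal.coe_one, mul_one] at e2 ⊢
    rw [mul_assoc, e2]
    field_simp
  simp_rw [this]
  rw [lintegral_const_mul _ (measurable_gaussianPDF _ _), lintegral_gaussianPDF_eq_one _ hv0,
    mul_one]

lemma inv_sqrt_one_sub_le {q : ℝ} (hq : q ≤ 1 / 2) :
    (√(1 - q))⁻¹ ≤ Real.exp (q / 2 + q ^ 2) := by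
  have h1 : 0 < 1 - q := by linarith
  have h2 : Real.exp (-(q + 2 * q ^ 2)) ≤ 1 - q := by
    have h3 : (1 - q)⁻¹ ≤ Real.exp (q + 2 * q ^ 2) := by
      refine le_trans ?_ (Real.add_one_le_exp _)
      rw [inv_le_iff_one_le_mul₀ h1]
      nlinarith [sq_nonneg q, mul_nonneg (sq_nonneg q) (by linarith : (0:ℝ) ≤ 1 - 2 * q)]
    rw [Real.exp_neg]
    exact inv_le_of_inv_le₀ h1 h3
  have h4 : Real.exp (-(q / 2 + q ^ 2)) ≤ √(1 - q) := by
    apply Real.le_sqrt_of_sq_le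
    rw [← Real.exp_nat_mul]
    convert h2 using 2
    push_cast; ring
  rw [Real.exp_neg] at h4
  exact inv_le_of_inv_le₀ (Real.exp_pos _) h4

lemma lintegral_exp_quadratic_le (c : ℝ) {q : ℝ} (hq : q ≤ 1 / 2) :
    ∫⁻ w, ENNReal.ofReal (Real.exp (c * w + q / 2 * w ^ 2)) ∂gaussianReal 0 1
      ≤ ENNReal.ofReal (Real.exp (c ^ 2 / (2 * (1 - q)) + q / 2 + q ^ 2)) := by
  rw [lintegral_exp_quadratic c (by linarith)]
  apply ENNReal.ofReal_le_ofReal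
  rw [add_assoc, Real.exp_add, mul_comm]
  exact mul_le_mul_of_nonneg_left (inv_sqrt_one_sub_le hq) (Real.exp_pos _).le

lemma lintegral_gaussVec_prod {p : ℕ} (f : Fin p → ℝ → ℝ≥0∞) (hf : ∀ a, Measurable (f a)) :
    ∫⁻ g, ∏ a, f a (g a) ∂gaussVec p = ∏ a, ∫⁻ w, f a w ∂gaussianReal 0 1 := by
  have h := lintegral_prod_eq_prod_lintegral_of_indepFun (μ := gaussVec p) Finset.univ
    (fun a g => f a (g a)) (iIndepFun_pi (μ := fun _ => gaussianReal 0 1) (X := f)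
      fun a => (hf a).aemeasurable) (fun a => (hf a).comp (measurable_pi_apply a))
  rw [h]
  refine Finset.prod_congr rfl fun a _ => ?_
  exact (measurePreserving_eval (fun _ : Fin p => gaussianReal 0 1) a).lintegral_comp (hf a)

lemma lintegral_gaussVec_exp_le {p : ℕ} (c : Fin p → ℝ) {q : ℝ} (hq : q ≤ 1 / 2) :
    ∫⁻ g, ENNReal.ofReal (Real.exp (c ⬝ᵥ g + q / 2 * ∑ a, g a ^ 2)) ∂gaussVec p
      ≤ ENNReal.ofReal
        (Real.exp ((∑ a, c a ^ 2) / (2 * (1 - q)) + p * (q / 2 + q ^ 2))) := by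
  have h : ∀ g : Fin p → ℝ, ENNReal.ofReal (Real.exp (c ⬝ᵥ g + q / 2 * ∑ a, g a ^ 2))
      = ∏ a, ENNReal.ofReal (Real.exp (c a * g a + q / 2 * g a ^ 2)) := by
    intro g
    rw [← ENNReal.ofReal_prod_of_nonneg (fun _ _ => (Real.exp_pos _).le), ← Real.exp_sum,
      Finset.sum_add_distrib, ← Finset.mul_sum]
    rfl
  simp_rw [h]
  rw [lintegral_gaussVec_prod (fun a w => ENNReal.ofReal (Real.exp (c a * w + q / 2 * w ^ 2)))
    (fun a => by fun_prop)]
  refine (Finset.prod_le_prod' fun a _ => lintegral_exp_quadratic_le (c a) hq).trans ?_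
  rw [← ENNReal.ofReal_prod_of_nonneg (fun _ _ => (Real.exp_pos _).le), ← Real.exp_sum]
  apply le_of_eq
  congr 2
  simp only [add_assoc, Finset.sum_add_distrib, ← Finset.sum_div]
  simp
  ring

/-! ### Testing two opposite shifts -/

lemma gaussianTail_eq_Ici (t : ℝ) :
    gaussianTail t = gaussianReal 0 1 (Set.Ici t) := by
  have : NullSingletonClass (gaussianReal 0 1) := nullSingletonClass_gaussianReal one_ne_zero
  unfold gaussianTail
  exact measure_congr Ioi_ae_eq_Ici

/-- One-dimensional case of `gaussianTail_le_testError`. -/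
lemma gaussianTail_le_testError_real {s : ℝ} (hs : 0 ≤ s) {A : Set ℝ} (hA : MeasurableSet A) :
    gaussianTail s ≤ gaussianReal 0 1 {t | s + t ∈ A} + gaussianReal 0 1 {t | -s + t ∈ Aᶜ} := by
  have e1 : ∀ (x : ℝ) {B : Set ℝ}, MeasurableSet B →
      gaussianReal 0 1 {t | x + t ∈ B} = gaussianReal x 1 B := by
    intro x B hB
    have := gaussianReal_map_const_add (μ := 0) (v := 1) x
    rw [zero_add] at this
    rw [← this, Measure.map_apply (by fun_prop) hB]
    rfl
  have hH : MeasurableSet (Set.Ici (0 : ℝ)) := measurableSet_Ici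
  have h1 : gaussianReal (-s) 1 (A ∩ Set.Ici 0) ≤ gaussianReal s 1 (A ∩ Set.Ici 0) := by
    rw [gaussianReal_apply _ one_ne_zero, gaussianReal_apply _ one_ne_zero]
    refine setLIntegral_mono (measurable_gaussianPDF _ _) fun x hx => ?_
    refine ENNReal.ofReal_le_ofReal ?_
    simp only [gaussianPDFReal]
    refine mul_le_mul_of_nonneg_left (Real.exp_le_exp.2 ?_) (by positivity)
    have hx0 : 0 ≤ x := hx.2
    have : (0 : ℝ) ≤ s * x := mul_nonneg hs hx0
    simp only [NNReal.coe_one]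
    linarith [this, show (x - -s) ^ 2 - (x - s) ^ 2 = 4 * (s * x) by ring]
  calc gaussianTail s = gaussianReal (-s) 1 (Set.Ici 0) := by
        rw [gaussianTail_eq_Ici, ← e1 _ hH]
        congr 1
        ext t
        simp only [Set.mem_Ici, Set.mem_ofPred_eq]
        constructor <;> intro h <;> linarith
    _ ≤ gaussianReal (-s) 1 (A ∩ Set.Ici 0) + gaussianReal (-s) 1 Aᶜ := by
        refine (measure_mono fun x hx => ?_).trans (measure_union_le _ _)
        by_cases h : x ∈ A
        · exact Or.inl ⟨h, hx⟩
        · exact Or.inr h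
    _ ≤ gaussianReal s 1 A + gaussianReal (-s) 1 Aᶜ :=
        add_le_add_left (h1.trans (measure_mono Set.inter_subset_left)) _
    _ = _ := by rw [e1 _ hA, e1 _ hA.compl]

/-- A standard Gaussian vector has an independent standard Gaussian component along any unit
vector `u`. -/
lemma gaussVec_map_resample {p : ℕ} (u : Fin p → ℝ) (hu : u ⬝ᵥ u = 1) :
    ((gaussVec p).prod (gaussianReal 0 1)).map (fun z => z.1 - (u ⬝ᵥ z.1) • u + z.2 • u)
      = gaussVec p := by
  conv_rhs => rw [← Measure.map_id (μ := gaussVec p)]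
  refine ((isCentredGaussian_gaussVec p).prod isCentredGaussian_gaussianReal).map_eq_map
    (isCentredGaussian_gaussVec p) ?_ ⟨fun _ _ => rfl, fun _ _ => rfl⟩ ?_
  · constructor
    · intro x y; simp only [Prod.fst_add, Prod.snd_add, dotProduct_add, add_smul]; abel
    · intro c x
      simp only [Prod.smul_fst, Prod.smul_snd, dotProduct_smul, smul_assoc, smul_add, smul_sub]
  · intro L
    have hL : L u = ∑ a, u a * L (Pi.single a 1) := by
      conv_lhs => rw [← Finset.univ_sum_single u]
      rw [map_sum]
      refine Finset.sum_congr rfl fun a _ => ?_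
      rw [← smul_eq_mul, ← map_smul, ← Pi.single_smul]
      simp
    simp only [ContinuousLinearMap.comp_apply, LinearMap.coe_toContinuousLinearMap',
      IsLinearMap.mk'_apply, ContinuousLinearMap.inl_apply, ContinuousLinearMap.inr_apply,
      map_add, map_sub, map_smul, smul_eq_mul, dotProduct_single, dotProduct_zero, map_zero,
      zero_mul, mul_one, one_mul, add_zero, sub_zero, zero_add, id]
    have hu' : ∑ a, u a * u a = 1 := hu
    have : ∀ a, (L (Pi.single a 1) - u a * L u) ^ 2
        = L (Pi.single a 1) ^ 2 - 2 * L u * (u a * L (Pi.single a 1)) + L u ^ 2 * (u a * u a) := by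
      intro a; ring
    simp only [this, Finset.sum_add_distrib, Finset.sum_sub_distrib, ← Finset.mul_sum, hu', ← hL]
    ring

/-- No test between the means `x` and `-x` of a Gaussian vector has total error below
`Φᶜ(‖x‖)`. -/
lemma gaussianTail_le_testError {p : ℕ} (x : Fin p → ℝ) {s : ℝ} (hs : 0 ≤ s)
    (hsx : s ^ 2 = x ⬝ᵥ x) {A : Set (Fin p → ℝ)} (hA : MeasurableSet A) :
    gaussianTail s ≤ gaussVec p {g | x + g ∈ A} + gaussVec p {g | -x + g ∈ Aᶜ} := by
  rcases hs.eq_or_lt with rfl | hs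
  · have hx : x = 0 := by
      rw [← dotProduct_self_eq_zero, ← hsx]; simp
    subst hx
    have h1 : gaussVec p A + gaussVec p Aᶜ = 1 := prob_add_prob_compl hA
    simp only [zero_add, neg_zero]
    change _ ≤ gaussVec p A + gaussVec p Aᶜ
    rw [h1]
    exact prob_le_one
  · set u : Fin p → ℝ := s⁻¹ • x with hu
    have huu : u ⬝ᵥ u = 1 := by
      rw [hu, smul_dotProduct, dotProduct_smul, ← hsx, smul_eq_mul, smul_eq_mul]
      field_simp
    have hxu : x = s • u := by rw [hu, smul_smul, mul_inv_cancel₀ hs.ne', one_smul]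
    set T : (Fin p → ℝ) × ℝ → (Fin p → ℝ) := fun z => z.1 - (u ⬝ᵥ z.1) • u + z.2 • u with hT
    have hTm : Measurable T := by
      have : Continuous T := by
        rw [hT]
        unfold dotProduct
        fun_prop
      exact this.measurable
    have key : ∀ (y : Fin p → ℝ) {B : Set (Fin p → ℝ)}, MeasurableSet B →
        gaussVec p {g | y + g ∈ B}
          = ∫⁻ g, gaussianReal 0 1 {t | y + T (g, t) ∈ B} ∂gaussVec p := by
      intro y B hB
      have hm : MeasurableSet {g : Fin p → ℝ | y + g ∈ B} :=
        (measurable_const.add measurable_id) hB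
      conv_lhs => rw [← gaussVec_map_resample u huu]
      rw [Measure.map_apply hTm hm, Measure.prod_apply (hTm hm)]
      rfl
    rw [key _ hA, key _ hA.compl, ← lintegral_add_left]
    · have : ∀ g : Fin p → ℝ, gaussianTail s ≤ gaussianReal 0 1 {t | x + T (g, t) ∈ A}
          + gaussianReal 0 1 {t | -x + T (g, t) ∈ Aᶜ} := by
        intro g
        have hB : MeasurableSet {t : ℝ | g - (u ⬝ᵥ g) • u + t • u ∈ A} := by
          have : Continuous fun t : ℝ => g - (u ⬝ᵥ g) • u + t • u := by fun_prop
          exact this.measurable hA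
        convert gaussianTail_le_testError_real hs.le hB using 3
        · ext t
          simp only [Set.mem_ofPred_eq, hT, hxu]
          rw [show s • u + (g - (u ⬝ᵥ g) • u + t • u) = g - (u ⬝ᵥ g) • u + (s + t) • u by
            rw [add_smul]; abel]
        · ext t
          simp only [Set.mem_ofPred_eq, hT, Set.mem_compl_iff]
          conv_lhs => rw [hxu]
          rw [show -(s • u) + (g - (u ⬝ᵥ g) • u + t • u) = g - (u ⬝ᵥ g) • u + (-s + t) • u by
            rw [add_smul, neg_smul]; abel]
      calc gaussianTail s = ∫⁻ _, gaussianTail s ∂gaussVec p := by simp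
        _ ≤ _ := lintegral_mono this
    · exact measurable_measure_prodMk_left
        ((show Measurable fun z => x + T z from measurable_const.add hTm) hA)

section

open scoped Matrix.Norms.L2Operator

/-! ### Chi-square tails -/

lemma measure_le_exp_mul_lintegral_exp {Ω : Type*} [MeasurableSpace Ω] (μ : Measure Ω)
    {X : Ω → ℝ} (hX : Measurable X) (b : ℝ) :
    μ {ω | b ≤ X ω} ≤ ENNReal.ofReal (Real.exp (-b)) * ∫⁻ ω, ENNReal.ofReal (Real.exp (X ω)) ∂μ := by
  have h := mul_meas_ge_le_lintegral₀ (μ := μ) (f := fun ω => ENNReal.ofReal (Real.exp (X ω)))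
    (by fun_prop) (ENNReal.ofReal (Real.exp b))
  calc μ {ω | b ≤ X ω} = ENNReal.ofReal (Real.exp (-b)) * (ENNReal.ofReal (Real.exp b)
        * μ {ω | b ≤ X ω}) := by
        rw [← mul_assoc, ← ENNReal.ofReal_mul (Real.exp_pos _).le, ← Real.exp_add]
        simp
    _ ≤ _ := by
        gcongr
        refine le_trans ?_ h
        gcongr with ω
        intro hb
        exact ENNReal.ofReal_le_ofReal (Real.exp_le_exp.2 hb)

/-- Both tails of the chi-square law, according to the sign of `l`. -/
lemma gaussVec_chiSq_tail (p : ℕ) {l : ℝ} (hl : l ≤ 1 / 4) (b : ℝ) :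
    gaussVec p {g | b ≤ l * (∑ a, g a ^ 2 - p)} ≤ ENNReal.ofReal (Real.exp (4 * p * l ^ 2 - b)) := by
  have h := measure_le_exp_mul_lintegral_exp (gaussVec p)
    (X := fun g => (0 : Fin p → ℝ) ⬝ᵥ g + 2 * l / 2 * ∑ a, g a ^ 2) (by
      simp only [zero_dotProduct]; fun_prop) (b + l * p)
  have h2 := lintegral_gaussVec_exp_le (0 : Fin p → ℝ) (q := 2 * l) (by linarith)
  calc _ = gaussVec p {g | b + l * p ≤ (0 : Fin p → ℝ) ⬝ᵥ g + 2 * l / 2 * ∑ a, g a ^ 2} := by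
        congr 1
        ext g
        simp only [Set.mem_ofPred_eq, zero_dotProduct]
        constructor <;> intro h <;> linarith
    _ ≤ _ := h
    _ ≤ _ := mul_le_mul_right h2 _
    _ = _ := by
        rw [← ENNReal.ofReal_mul (Real.exp_pos _).le, ← Real.exp_add]
        congr 2
        simp
        ring

/-- The deviation `21 (n + √(n p))` of a chi-square variable with `p` degrees of freedom has
probability at most `2 e^{-5n}`: small enough for a union bound over `2 · 25^n` vectors. -/
lemma gaussVec_chiSq_deviation (p : ℕ) {n : ℕ} (hn : 1 ≤ n) :
    gaussVec p {g | 21 * (n + √(n * p)) ≤ |∑ a, g a ^ 2 - p|}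
      ≤ ENNReal.ofReal (2 * Real.exp (-(5 * n))) := by
  have hn' : (1 : ℝ) ≤ n := by exact_mod_cast hn
  set D : ℝ := n + √(n * p) with hD
  have hs0 : 0 ≤ √((n : ℝ) * p) := Real.sqrt_nonneg _
  have hDn : (n : ℝ) ≤ D := by linarith
  have hD0 : 0 < D := by linarith
  set l : ℝ := n / (4 * D) with hl
  have hl0 : 0 < l := by positivity
  have hl4 : l ≤ 1 / 4 := by
    rw [hl, div_le_iff₀ (by positivity)]; linarith
  have hlD : l * (21 * D) = 21 * n / 4 := by rw [hl]; field_simp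
  have hpl : 4 * p * l ^ 2 ≤ n / 4 := by
    have h1 : (n : ℝ) * p ≤ D ^ 2 := by
      have : √((n : ℝ) * p) ^ 2 = n * p := Real.sq_sqrt (by positivity)
      nlinarith
    rw [hl, div_pow, mul_div_assoc', div_le_iff₀ (by positivity)]
    nlinarith
  have h1 := gaussVec_chiSq_tail p hl4 (21 * n / 4)
  have h2 := gaussVec_chiSq_tail p (l := -l) (by linarith) (21 * n / 4)
  have hb : ENNReal.ofReal (Real.exp (4 * p * l ^ 2 - 21 * n / 4))
      ≤ ENNReal.ofReal (Real.exp (-(5 * n))) :=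
    ENNReal.ofReal_le_ofReal (Real.exp_le_exp.2 (by linarith))
  calc _ ≤ gaussVec p ({g | 21 * n / 4 ≤ l * (∑ a, g a ^ 2 - p)}
        ∪ {g | 21 * n / 4 ≤ -l * (∑ a, g a ^ 2 - p)}) := by
        refine measure_mono fun g hg => ?_
        simp only [Set.mem_ofPred_eq, Set.mem_union, le_abs] at hg ⊢
        rw [← hlD]
        rcases hg with hg | hg
        · exact Or.inl (mul_le_mul_of_nonneg_left hg hl0.le)
        · refine Or.inr ?_
          rw [neg_mul_comm]
          exact mul_le_mul_of_nonneg_left hg hl0.le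
    _ ≤ _ := measure_union_le _ _
    _ ≤ ENNReal.ofReal (Real.exp (-(5 * n))) + ENNReal.ofReal (Real.exp (-(5 * n))) := by
        refine add_le_add (h1.trans hb) (h2.trans ?_)
        rwa [neg_sq]
    _ = _ := by
        rw [← ENNReal.ofReal_add (Real.exp_pos _).le (Real.exp_pos _).le, ← two_mul]

lemma noise_quadratic_deviation (p : ℕ) {n : ℕ} (hn : 1 ≤ n) (x : Fin n → ℝ) :
    noise p n {ξ | 21 * (n + √(n * p)) * ∑ i, x i ^ 2
        < |∑ a, (∑ i, x i • ξ i) a ^ 2 - p * ∑ i, x i ^ 2|}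
      ≤ ENNReal.ofReal (2 * Real.exp (-(5 * n))) := by
  set S : ℝ := ∑ i, x i ^ 2 with hS
  have hS0 : 0 ≤ S := Finset.sum_nonneg fun _ _ => sq_nonneg _
  have ht : √S ^ 2 = S := Real.sq_sqrt hS0
  have hmap := noise_map_sum_smul p x (t := √S) ht
  have hB : MeasurableSet {v : Fin p → ℝ | 21 * (n + √(n * p)) * S < |∑ a, v a ^ 2 - p * S|} :=
    measurableSet_lt measurable_const (by fun_prop)
  calc _ = (noise p n).map (fun ξ => ∑ i, x i • ξ i)
        {v : Fin p → ℝ | 21 * (n + √(n * p)) * S < |∑ a, v a ^ 2 - p * S|} := by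
        rw [Measure.map_apply ?_ hB]
        · rfl
        · fun_prop
    _ = gaussVec p {g | 21 * (n + √(n * p)) * S < |∑ a, (√S • g) a ^ 2 - p * S|} := by
        rw [hmap, Measure.map_apply (by fun_prop) hB]
        rfl
    _ ≤ gaussVec p {g | 21 * (n + √(n * p)) ≤ |∑ a, g a ^ 2 - p|} := by
        refine measure_mono fun g hg => ?_
        simp only [Set.mem_ofPred_eq, Pi.smul_apply, smul_eq_mul, mul_pow, ht, ← Finset.mul_sum]
          at hg ⊢
        rw [mul_comm (p : ℝ), ← mul_sub, abs_mul, abs_of_nonneg hS0, mul_comm] at hg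
        exact (lt_of_mul_lt_mul_left hg hS0).le
    _ ≤ _ := gaussVec_chiSq_deviation p hn

/-! ### Operator norms through nets -/

/-- A `1/2`-net of at most `5^n` points of the Euclidean unit ball. -/
lemma exists_half_net (n : ℕ) : ∃ N : Finset (EuclideanSpace ℝ (Fin n)),
    N.card ≤ 5 ^ n ∧ (∀ y ∈ N, ‖y‖ ≤ 1) ∧ ∀ x : EuclideanSpace ℝ (Fin n), ‖x‖ ≤ 1 →
      ∃ y ∈ N, ‖x - y‖ ≤ 1 / 2 := by
  classical
  -- Twice the net is a maximal `1`-separated subset of the ball of radius `2`.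
  set P : Finset (EuclideanSpace ℝ (Fin n)) → Prop := fun s =>
    (∀ c ∈ s, ‖c‖ ≤ 2) ∧ ∀ c ∈ s, ∀ d ∈ s, c ≠ d → 1 ≤ ‖c - d‖ with hP
  set K : Set ℕ := {k | ∃ s, P s ∧ s.card = k} with hK
  have hcard : ∀ s, P s → s.card ≤ 5 ^ n := fun s hs => by
    simpa using Besicovitch.card_le_of_separated s hs.1 hs.2
  have hbdd : BddAbove K := ⟨5 ^ n, by rintro k ⟨s, hs, rfl⟩; exact hcard s hs⟩
  have hne : K.Nonempty := ⟨0, ∅, by simp [hP], rfl⟩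
  obtain ⟨s, hs, hsK⟩ := Nat.sSup_mem hne hbdd
  refine ⟨s.image fun c => (1 / 2 : ℝ) • c, Finset.card_image_le.trans (hcard s hs), ?_, ?_⟩
  · intro y hy
    obtain ⟨c, hc, rfl⟩ := Finset.mem_image.1 hy
    rw [norm_smul]
    have := hs.1 c hc
    norm_num
    linarith
  · intro x hx
    by_contra! hcon
    have hfar : ∀ c ∈ s, 1 ≤ ‖(2 : ℝ) • x - c‖ := by
      intro c hc
      have h1 := hcon _ (Finset.mem_image_of_mem _ hc)
      have h2 : (2 : ℝ) • x - c = (2 : ℝ) • (x - (1 / 2 : ℝ) • c) := by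
        rw [smul_sub, smul_smul]; norm_num
      rw [h2, norm_smul]
      norm_num at h1 ⊢
      linarith
    have hnot : (2 : ℝ) • x ∉ s := fun h => by
      have := hfar _ h
      simp at this
      linarith
    have hins : P (insert ((2 : ℝ) • x) s) := by
      refine ⟨?_, ?_⟩
      · intro c hc
        rcases Finset.mem_insert.1 hc with rfl | hc
        · rw [norm_smul]; norm_num; linarith
        · exact hs.1 c hc
      · intro c hc d hd hcd
        rcases Finset.mem_insert.1 hc with rfl | hc' <;> rcases Finset.mem_insert.1 hd with rfl | hd'
        · exact absurd rfl hcd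
        · exact hfar d hd'
        · rw [norm_sub_rev]; exact hfar c hc'
        · exact hs.2 c hc' d hd' hcd
    have h1 := le_csSup hbdd ⟨_, hins, rfl⟩
    rw [Finset.card_insert_of_notMem hnot, hsK] at h1
    omega

/-- The norm of an operator is controlled by its bilinear form on a `1/2`-net. -/
lemma opNorm_le_of_net {E : Type*} [NormedAddCommGroup E] [InnerProductSpace ℝ E]
    (A : E →L[ℝ] E) {N : Set E}
    (hN : ∀ x : E, ‖x‖ ≤ 1 → ∃ y ∈ N, ‖x - y‖ ≤ 1 / 2) {T : ℝ} (hT : 0 ≤ T)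
    (hA : ∀ x ∈ N, ∀ y ∈ N, |inner ℝ x (A y)| ≤ T) : ‖A‖ ≤ 4 * T := by
  have h1 : ∀ y ∈ N, ‖A y‖ ≤ 2 * T := by
    intro y hy
    rcases eq_or_ne (A y) 0 with h0 | h0
    · rw [h0, norm_zero]; positivity
    set w := A y with hw
    have hw0 : 0 < ‖w‖ := norm_pos_iff.2 h0
    obtain ⟨x, hx, hxw⟩ := hN (‖w‖⁻¹ • w) (by rw [norm_smul]; simp [hw0.ne'])
    have e1 : inner ℝ (‖w‖⁻¹ • w) w = ‖w‖ := by
      rw [real_inner_smul_left, real_inner_self_eq_norm_sq]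
      field_simp
    have e2 : inner ℝ (‖w‖⁻¹ • w) w = inner ℝ x w + inner ℝ (‖w‖⁻¹ • w - x) w := by
      rw [← inner_add_left]; congr 1; abel
    have e3 := (le_abs_self _).trans (abs_real_inner_le_norm (‖w‖⁻¹ • w - x) w)
    have e4 := (le_abs_self _).trans (hA x hx y hy)
    have e5 : ‖‖w‖⁻¹ • w - x‖ * ‖w‖ ≤ 1 / 2 * ‖w‖ := mul_le_mul_of_nonneg_right hxw hw0.le
    linarith
  have h2 : ‖A‖ ≤ 2 * T + ‖A‖ / 2 := by
    refine A.opNorm_le_of_unit_norm (by positivity) fun x hx => ?_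
    obtain ⟨y, hy, hxy⟩ := hN x hx.le
    have e1 : A x = A y + A (x - y) := by rw [← map_add]; congr 1; abel
    have e2 := A.le_opNorm (x - y)
    have e3 : ‖A‖ * ‖x - y‖ ≤ ‖A‖ * (1 / 2) := mul_le_mul_of_nonneg_left hxy (norm_nonneg _)
    calc ‖A x‖ ≤ ‖A y‖ + ‖A (x - y)‖ := by rw [e1]; exact norm_add_le _ _
      _ ≤ _ := by linarith [h1 y hy]
  linarith

lemma dotProduct_gram_mulVec {p n : ℕ} (ξ : Data p n) (x y : Fin n → ℝ) :
    x ⬝ᵥ (gram ξ *ᵥ y) = (∑ i, x i • ξ i) ⬝ᵥ (∑ i, y i • ξ i) := by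
  simp only [sum_dotProduct, dotProduct_sum, smul_dotProduct, dotProduct_smul, smul_eq_mul]
  simp only [dotProduct, Matrix.mulVec, gram, Matrix.of_apply, Finset.mul_sum, Finset.sum_mul]
  rw [Finset.sum_comm]
  refine Finset.sum_congr rfl fun i _ => Finset.sum_congr rfl fun j _ =>
    Finset.sum_congr rfl fun a _ => ?_
  ring

/-- The Gram matrix of the noise is within `84 (n + √(n p))` of `p` times the identity, with
probability `1 - 4 e^{-n}`. -/
lemma noise_gram_norm (p : ℕ) {n : ℕ} (hn : 1 ≤ n) :
    noise p n {ξ | 84 * (n + √(n * p)) < ‖gram ξ - (p : ℝ) • (1 : Matrix (Fin n) (Fin n) ℝ)‖}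
      ≤ ENNReal.ofReal (4 * Real.exp (-n)) := by
  classical
  obtain ⟨N, hNc, hN1, hN⟩ := exists_half_net n
  set T : ℝ := 21 * (n + √(n * p)) with hT
  have hT0 : 0 ≤ T := by positivity
  set bad : (Fin n → ℝ) → Set (Data p n) := fun x =>
    {ξ | T * ∑ i, x i ^ 2 < |∑ a, (∑ i, x i • ξ i) a ^ 2 - p * ∑ i, x i ^ 2|} with hbad
  have hsub : {ξ : Data p n | 84 * (n + √(n * p))
      < ‖gram ξ - (p : ℝ) • (1 : Matrix (Fin n) (Fin n) ℝ)‖}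
      ⊆ ⋃ z ∈ N ×ˢ N, (bad (z.1 + z.2).ofLp ∪ bad (z.1 - z.2).ofLp) := by
    intro ξ hξ
    by_contra hcon
    simp only [Set.mem_iUnion, Set.mem_union, not_exists, not_or, Finset.mem_product, hbad,
      Set.mem_ofPred_eq, not_lt] at hcon
    refine absurd hξ (Set.notMem_ofPred_iff.2 (not_lt.2 ?_))
    rw [show 84 * (n + √(n * p)) = 4 * T by rw [hT]; ring, Matrix.l2_opNorm_def]
    refine opNorm_le_of_net _ (N := (N : Set (EuclideanSpace ℝ (Fin n)))) hN hT0 ?_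
    intro x hx y hy
    have h := hcon (x, y) ⟨hx, hy⟩
    have hin : inner ℝ x ((Matrix.toEuclideanLin (𝕜 := ℝ)).trans LinearMap.toContinuousLinearMap
        (gram ξ - (p : ℝ) • 1) y)
        = x.ofLp ⬝ᵥ ((gram ξ - (p : ℝ) • (1 : Matrix (Fin n) (Fin n) ℝ)) *ᵥ y.ofLp) := by
      rw [EuclideanSpace.inner_eq_star_dotProduct, dotProduct_comm]
      simp [Matrix.sub_mulVec, Matrix.smul_mulVec]
    have hq : ∀ z : Fin n → ℝ, ∑ a, (∑ i, z i • ξ i) a ^ 2 - p * ∑ i, z i ^ 2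
        = z ⬝ᵥ ((gram ξ - (p : ℝ) • (1 : Matrix (Fin n) (Fin n) ℝ)) *ᵥ z) := by
      intro z
      rw [Matrix.sub_mulVec, dotProduct_sub, dotProduct_gram_mulVec, Matrix.smul_mulVec,
        Matrix.one_mulVec, dotProduct_smul, smul_eq_mul]
      simp only [dotProduct, sq]
    set A := gram ξ - (p : ℝ) • (1 : Matrix (Fin n) (Fin n) ℝ) with hA
    have hsymm : y.ofLp ⬝ᵥ (A *ᵥ x.ofLp) = x.ofLp ⬝ᵥ (A *ᵥ y.ofLp) := by
      rw [hA, Matrix.sub_mulVec, Matrix.sub_mulVec, dotProduct_sub, dotProduct_sub,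
        dotProduct_gram_mulVec, dotProduct_gram_mulVec, Matrix.smul_mulVec, Matrix.smul_mulVec,
        Matrix.one_mulVec, Matrix.one_mulVec, dotProduct_smul, dotProduct_smul,
        dotProduct_comm y.ofLp x.ofLp, dotProduct_comm (∑ i, y.ofLp i • ξ i)]
    have hpol : x.ofLp ⬝ᵥ (A *ᵥ y.ofLp) = ((x + y).ofLp ⬝ᵥ (A *ᵥ (x + y).ofLp)
        - (x - y).ofLp ⬝ᵥ (A *ᵥ (x - y).ofLp)) / 4 := by
      simp only [WithLp.ofLp_add, WithLp.ofLp_sub, Matrix.mulVec_add, Matrix.mulVec_sub,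
        dotProduct_add, dotProduct_sub, add_dotProduct, sub_dotProduct, hsymm]
      ring
    have hnorm : ∀ z : EuclideanSpace ℝ (Fin n), ∑ i, z.ofLp i ^ 2 = ‖z‖ ^ 2 := by
      intro z
      rw [EuclideanSpace.norm_sq_eq]
      simp
    rw [hq, hq, hnorm, hnorm] at h
    have hpar := parallelogram_law_with_norm ℝ x y
    have hx1 : ‖x‖ ^ 2 ≤ 1 := by nlinarith [hN1 x hx, norm_nonneg x]
    have hy1 : ‖y‖ ^ 2 ≤ 1 := by nlinarith [hN1 y hy, norm_nonneg y]
    rw [hin, hpol]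
    have ha := abs_le.1 h.1
    have hb := abs_le.1 h.2
    have hsum : T * ‖x + y‖ ^ 2 + T * ‖x - y‖ ^ 2 ≤ 4 * T := by
      rw [← mul_add, hpar]
      nlinarith
    rw [abs_le]
    constructor <;> linarith [ha.1, ha.2, hb.1, hb.2]
  have hexp : Real.exp (-(5 * n)) * 25 ^ n ≤ Real.exp (-n) := by
    have h25 : (25 : ℝ) ≤ Real.exp 4 := by
      have := Real.exp_one_gt_d9
      have h4 : Real.exp 4 = Real.exp 1 ^ 4 := by rw [← Real.exp_nat_mul]; norm_num
      rw [h4]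
      calc (25 : ℝ) ≤ 2.7 ^ 4 := by norm_num
        _ ≤ _ := by gcongr; linarith
    have : Real.exp (-n) = Real.exp (-(5 * n)) * Real.exp 4 ^ n := by
      rw [← Real.exp_nat_mul, ← Real.exp_add]; congr 1; ring
    rw [this]
    gcongr
  calc _ ≤ noise p n (⋃ z ∈ N ×ˢ N, (bad (z.1 + z.2).ofLp ∪ bad (z.1 - z.2).ofLp)) :=
        measure_mono hsub
    _ ≤ ∑ z ∈ N ×ˢ N, noise p n (bad (z.1 + z.2).ofLp ∪ bad (z.1 - z.2).ofLp) :=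
        measure_biUnion_finset_le _ _
    _ ≤ ∑ z ∈ N ×ˢ N, ENNReal.ofReal (4 * Real.exp (-(5 * n))) := by
        refine Finset.sum_le_sum fun z _ => (measure_union_le _ _).trans ?_
        refine (add_le_add (noise_quadratic_deviation p hn _)
          (noise_quadratic_deviation p hn _)).trans (le_of_eq ?_)
        rw [← ENNReal.ofReal_add (by positivity) (by positivity)]
        congr 1; ring
    _ = ENNReal.ofReal (4 * Real.exp (-(5 * n)) * (N.card * N.card : ℕ)) := by
        rw [Finset.sum_const, Finset.card_product, nsmul_eq_mul, mul_comm,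
          ENNReal.ofReal_mul (q := ((N.card * N.card : ℕ) : ℝ)) (by positivity),
          ENNReal.ofReal_natCast]
    _ ≤ _ := by
        refine ENNReal.ofReal_le_ofReal ?_
        have hc : ((N.card * N.card : ℕ) : ℝ) ≤ 25 ^ n := by
          have : N.card * N.card ≤ 5 ^ n * 5 ^ n := Nat.mul_le_mul hNc hNc
          rw [← mul_pow] at this
          exact_mod_cast this
        calc _ ≤ 4 * Real.exp (-(5 * n)) * 25 ^ n := by gcongr
          _ ≤ _ := by rw [mul_assoc]; gcongr

/-! ### The noise part of the hollowed Gram matrix -/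

lemma Labels.toReal_sq {n : ℕ} (η : Labels n) (i : Fin n) : η.toReal i ^ 2 = 1 := by
  rcases Int.units_eq_one_or (η i) with h | h <;> simp [Labels.toReal, h]

lemma l2_opNorm_le {n : ℕ} (A : Matrix (Fin n) (Fin n) ℝ) {K : ℝ} (hK : 0 ≤ K)
    (h : ∀ x : Fin n → ℝ, ‖WithLp.toLp 2 (A *ᵥ x)‖ ≤ K * ‖WithLp.toLp 2 x‖) : ‖A‖ ≤ K := by
  rw [Matrix.l2_opNorm_def]
  exact ContinuousLinearMap.opNorm_le_bound _ hK fun x => h x.ofLp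

lemma l2_norm_mulVec_le {n : ℕ} (A : Matrix (Fin n) (Fin n) ℝ) (x : Fin n → ℝ) :
    ‖WithLp.toLp 2 (A *ᵥ x)‖ ≤ ‖A‖ * ‖WithLp.toLp 2 x‖ :=
  Matrix.l2_opNorm_mulVec A (WithLp.toLp 2 x)

lemma norm_toLp_sq {n : ℕ} (x : Fin n → ℝ) : ‖WithLp.toLp 2 x‖ ^ 2 = x ⬝ᵥ x := by
  rw [EuclideanSpace.norm_sq_eq]
  simp [dotProduct, sq]

lemma abs_dotProduct_le {n : ℕ} (x y : Fin n → ℝ) :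
    |x ⬝ᵥ y| ≤ ‖WithLp.toLp 2 x‖ * ‖WithLp.toLp 2 y‖ := by
  have h := abs_real_inner_le_norm (WithLp.toLp 2 y) (WithLp.toLp 2 x)
  rw [EuclideanSpace.inner_eq_star_dotProduct] at h
  rw [mul_comm]
  simpa using h

lemma abs_apply_le_norm_toLp {n : ℕ} (x : Fin n → ℝ) (i : Fin n) : |x i| ≤ ‖WithLp.toLp 2 x‖ := by
  simpa using PiLp.norm_apply_le (WithLp.toLp 2 x) i

lemma l2_opNorm_vecMulVec_le {n : ℕ} (x y : Fin n → ℝ) :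
    ‖Matrix.vecMulVec x y‖ ≤ ‖WithLp.toLp 2 x‖ * ‖WithLp.toLp 2 y‖ := by
  refine l2_opNorm_le _ (by positivity) fun z => ?_
  have : Matrix.vecMulVec x y *ᵥ z = (y ⬝ᵥ z) • x := by
    ext i
    simp [Matrix.mulVec, Matrix.vecMulVec_apply, dotProduct, Finset.sum_mul]
    exact Finset.sum_congr rfl fun j _ => by ring
  rw [this, WithLp.toLp_smul, norm_smul, Real.norm_eq_abs]
  have := mul_le_mul_of_nonneg_right (abs_dotProduct_le y z) (norm_nonneg (WithLp.toLp 2 x))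
  linarith

lemma abs_diag_le_l2_opNorm {n : ℕ} (A : Matrix (Fin n) (Fin n) ℝ) (i : Fin n) : |A i i| ≤ ‖A‖ := by
  have h := l2_norm_mulVec_le A (Pi.single i 1)
  have h1 : ‖WithLp.toLp 2 (Pi.single i 1 : Fin n → ℝ)‖ = 1 := by simp
  rw [h1, mul_one] at h
  refine le_trans ?_ h
  have := abs_apply_le_norm_toLp (A *ᵥ Pi.single i 1) i
  simpa using this

lemma l2_opNorm_diagonal_le {n : ℕ} (d : Fin n → ℝ) {K : ℝ} (hK : 0 ≤ K) (h : ∀ i, |d i| ≤ K) :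
    ‖Matrix.diagonal d‖ ≤ K := by
  rw [Matrix.l2_opNorm_diagonal]
  exact (pi_norm_le_iff_of_nonneg hK).2 h

lemma norm_toLp_toReal {n : ℕ} (η : Labels n) : ‖WithLp.toLp 2 η.toReal‖ = √n := by
  have h : η.toReal ⬝ᵥ η.toReal = n := by
    simp [dotProduct, ← sq, Labels.toReal_sq]
  rw [← h, ← norm_toLp_sq, Real.sqrt_sq (norm_nonneg _)]

/-- The mean of the hollowed Gram matrix when the centre has squared norm `1`. -/
def signalMatrix {n : ℕ} (η : Labels n) : Matrix (Fin n) (Fin n) ℝ :=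
  Matrix.vecMulVec η.toReal η.toReal - 1

/-- Deterministic bound on the deviation of the hollowed Gram matrix from its mean. -/
lemma norm_hollow_gram_sub_le {p n : ℕ} (hn : 1 ≤ n) (θ : Fin p → ℝ) (η : Labels n) (ξ : Data p n) :
    ‖hollow (gram fun i a => η.toReal i * θ a + ξ i a) - (θ ⬝ᵥ θ) • signalMatrix η‖
      ≤ 4 * √n * ‖WithLp.toLp 2 fun i => ξ i ⬝ᵥ θ‖
        + 2 * ‖gram ξ - (p : ℝ) • (1 : Matrix (Fin n) (Fin n) ℝ)‖ := by
  set b : Fin n → ℝ := fun i => ξ i ⬝ᵥ θ with hb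
  set A := gram ξ - (p : ℝ) • (1 : Matrix (Fin n) (Fin n) ℝ) with hA
  have hdec : hollow (gram fun i a => η.toReal i * θ a + ξ i a) - (θ ⬝ᵥ θ) • signalMatrix η
      = Matrix.vecMulVec η.toReal b + Matrix.vecMulVec b η.toReal
        - Matrix.diagonal (fun i => 2 * η.toReal i * b i) + A - Matrix.diagonal A.diag := by
    ext i j
    have hg : ∀ i j, gram (fun i a => η.toReal i * θ a + ξ i a) i j
        = η.toReal i * η.toReal j * (θ ⬝ᵥ θ) + η.toReal i * b j + b i * η.toReal j
          + ξ i ⬝ᵥ ξ j := by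
      intro i j
      simp only [gram, Matrix.of_apply, hb, dotProduct, Finset.mul_sum, Finset.sum_mul,
        ← Finset.sum_add_distrib]
      exact Finset.sum_congr rfl fun a _ => by ring
    by_cases hij : i = j
    · subst hij
      have := Labels.toReal_sq η i
      simp [hollow, signalMatrix, Matrix.vecMulVec_apply, ← sq, this]
      ring
    · simp only [hollow, signalMatrix, Matrix.sub_apply, Matrix.add_apply, Matrix.smul_apply,
        Matrix.vecMulVec_apply, Matrix.diagonal_apply_ne _ hij, Matrix.one_apply_ne hij, hg, hA,
        smul_eq_mul, sub_zero, mul_zero]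
      simp only [gram, Matrix.of_apply]
      ring
  have h1 : (1 : ℝ) ≤ √n := by
    rw [Real.one_le_sqrt]; exact_mod_cast hn
  have hb0 := norm_nonneg (WithLp.toLp 2 b)
  have e1 := l2_opNorm_vecMulVec_le η.toReal b
  have e2 := l2_opNorm_vecMulVec_le b η.toReal
  rw [norm_toLp_toReal] at e1 e2
  have e3 : ‖Matrix.diagonal (fun i => 2 * η.toReal i * b i)‖ ≤ 2 * (√n * ‖WithLp.toLp 2 b‖) := by
    refine l2_opNorm_diagonal_le _ (by positivity) fun i => ?_
    have hη : |η.toReal i| = 1 := by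
      rw [← sq_eq_sq₀ (abs_nonneg _) zero_le_one, sq_abs, Labels.toReal_sq]; norm_num
    rw [abs_mul, abs_mul, hη]
    have := abs_apply_le_norm_toLp b i
    norm_num
    nlinarith
  have e4 : ‖Matrix.diagonal A.diag‖ ≤ ‖A‖ :=
    l2_opNorm_diagonal_le _ (norm_nonneg _) fun i => abs_diag_le_l2_opNorm A i
  rw [hdec]
  calc _ ≤ ‖Matrix.vecMulVec η.toReal b‖ + ‖Matrix.vecMulVec b η.toReal‖
        + ‖Matrix.diagonal (fun i => 2 * η.toReal i * b i)‖ + ‖A‖ + ‖Matrix.diagonal A.diag‖ := by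
        refine (norm_sub_le _ _).trans (add_le_add_left ?_ _)
        refine (norm_add_le _ _).trans (add_le_add_left ?_ _)
        refine (norm_sub_le _ _).trans (add_le_add_left ?_ _)
        exact norm_add_le _ _
    _ ≤ _ := by linarith

lemma noise_dotProduct_norm {p n : ℕ} (θ : Fin p → ℝ) :
    noise p n {ξ | 3 * √n * √(θ ⬝ᵥ θ) < ‖WithLp.toLp 2 fun i => ξ i ⬝ᵥ θ‖}
      ≤ ENNReal.ofReal (Real.exp (-n)) := by
  have hs0 : 0 ≤ θ ⬝ᵥ θ := by
    rw [← norm_toLp_sq]; positivity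
  have ht : √(θ ⬝ᵥ θ) ^ 2 = ∑ a, θ a ^ 2 := by
    rw [Real.sq_sqrt hs0]; simp [dotProduct, sq]
  set t := √(θ ⬝ᵥ θ) with htdef
  have ht0 : 0 ≤ t := Real.sqrt_nonneg _
  have hmap := noise_map_dotProduct n θ ht
  have hB : MeasurableSet {v : Fin n → ℝ | 3 * √n * t < ‖WithLp.toLp 2 v‖} :=
    measurableSet_lt measurable_const (by fun_prop)
  have hf : Measurable fun (ξ : Data p n) (i : Fin n) => ξ i ⬝ᵥ θ := by
    unfold dotProduct; fun_prop
  calc _ = (noise p n).map (fun ξ i => ξ i ⬝ᵥ θ) {v : Fin n → ℝ | 3 * √n * t < ‖WithLp.toLp 2 v‖} := by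
        rw [Measure.map_apply hf hB]; rfl
    _ = gaussVec n {g | 3 * √n * t < ‖WithLp.toLp 2 (t • g)‖} := by
        rw [hmap, Measure.map_apply (by fun_prop) hB]; rfl
    _ ≤ gaussVec n {g | 5 / 4 * n ≤ 1 / 4 * (∑ a, g a ^ 2 - n)} := by
        refine measure_mono fun g hg => ?_
        simp only [Set.mem_ofPred_eq] at hg ⊢
        rw [WithLp.toLp_smul, norm_smul, Real.norm_eq_abs, abs_of_nonneg ht0, mul_comm] at hg
        have h1 := lt_of_mul_lt_mul_left hg ht0
        have h2 : (3 * √n) ^ 2 < ‖WithLp.toLp 2 g‖ ^ 2 := by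
          gcongr
        rw [norm_toLp_sq, mul_pow, Real.sq_sqrt (by positivity)] at h2
        simp only [dotProduct, ← sq] at h2
        have : (0 : ℝ) ≤ n := by positivity
        linarith
    _ ≤ _ := gaussVec_chiSq_tail n le_rfl _
    _ ≤ _ := by
        refine ENNReal.ofReal_le_ofReal (Real.exp_le_exp.2 ?_)
        linarith

/-- The hollowed Gram matrix is within `348 n √(s + p/n)` of its mean, with probability
`1 - 5 e^{-n}`. In units of the signal strength `n s` this is `348` over the signal-to-noise
ratio. -/
lemma noise_hollow_gram_norm {p n : ℕ} (hn : 1 ≤ n) (θ : Fin p → ℝ) (hθ : 1 ≤ θ ⬝ᵥ θ)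
    (η : Labels n) :
    noise p n {ξ | 348 * n * √(θ ⬝ᵥ θ + p / n)
        < ‖hollow (gram fun i a => η.toReal i * θ a + ξ i a) - (θ ⬝ᵥ θ) • signalMatrix η‖}
      ≤ ENNReal.ofReal (5 * Real.exp (-n)) := by
  have hn0 : (0 : ℝ) < n := by exact_mod_cast hn
  set s := θ ⬝ᵥ θ with hs
  set h := √(s + p / n) with hh
  have hp : (0 : ℝ) ≤ p / n := by positivity
  have h1 : 1 ≤ h := by rw [hh, Real.one_le_sqrt]; linarith
  have h2 : √s ≤ h := Real.sqrt_le_sqrt (by linarith)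
  have h3 : √((n : ℝ) * p) ≤ n * h := by
    have : (n : ℝ) * h = √(n ^ 2 * (s + p / n)) := by
      rw [Real.sqrt_mul (by positivity), Real.sqrt_sq hn0.le]
    rw [this]
    refine Real.sqrt_le_sqrt ?_
    have : (n : ℝ) ^ 2 * (s + p / n) = n ^ 2 * s + n * p := by field_simp
    rw [this]
    nlinarith
  calc _ ≤ noise p n ({ξ | 3 * √n * √s < ‖WithLp.toLp 2 fun i => ξ i ⬝ᵥ θ‖}
        ∪ {ξ | 84 * (n + √(n * p)) < ‖gram ξ - (p : ℝ) • (1 : Matrix (Fin n) (Fin n) ℝ)‖}) := by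
        refine measure_mono fun ξ hξ => ?_
        by_contra hcon
        simp only [Set.mem_union, Set.mem_ofPred_eq, not_or, not_lt] at hcon hξ
        have hb := norm_hollow_gram_sub_le hn θ η ξ
        have hnn : √(n : ℝ) * √n = n := Real.mul_self_sqrt hn0.le
        have e1 : 4 * √n * ‖WithLp.toLp 2 fun i => ξ i ⬝ᵥ θ‖ ≤ 12 * n * h := by
          calc _ ≤ 4 * √n * (3 * √n * √s) := by gcongr; exact hcon.1
            _ = 12 * (√n * √n) * √s := by ring
            _ = 12 * n * √s := by rw [hnn]
            _ ≤ _ := by gcongr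
        have e2 : (n : ℝ) ≤ n * h := le_mul_of_one_le_right hn0.le h1
        linarith [hcon.2]
    _ ≤ _ := measure_union_le _ _
    _ ≤ _ := add_le_add (noise_dotProduct_norm θ) (noise_gram_norm p hn)
    _ = _ := by
        rw [← ENNReal.ofReal_add (by positivity) (by positivity)]
        congr 1; ring

/-! ### Top eigenvectors and their measurable selection -/

lemma isSymm_hollow_gram {p n : ℕ} (Y : Data p n) : (hollow (gram Y)).IsSymm := by
  ext i j
  by_cases h : i = j
  · subst h; rfl
  · simp [hollow, gram, Matrix.diagonal_apply_ne _ h, Matrix.diagonal_apply_ne _ (Ne.symm h),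
      dotProduct_comm]

/-- A maximizer of the Rayleigh quotient is a top eigenvector. -/
lemma isTopEigenvector_of_rayleigh {n : ℕ} {M : Matrix (Fin n) (Fin n) ℝ} (hM : M.IsSymm)
    {v : Fin n → ℝ} (hv : v ≠ 0)
    (h : ∀ x, (x ⬝ᵥ M *ᵥ x) * (v ⬝ᵥ v) ≤ (v ⬝ᵥ M *ᵥ v) * (x ⬝ᵥ x)) : IsTopEigenvector M v := by
  have hpos : ∀ x : Fin n → ℝ, x ≠ 0 → 0 < x ⬝ᵥ x := fun x hx => by
    rw [← norm_toLp_sq]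
    have : WithLp.toLp 2 x ≠ 0 := by simpa using hx
    positivity
  set lam := (v ⬝ᵥ M *ᵥ v) / (v ⬝ᵥ v) with hlam
  have hmax : ∀ x, x ⬝ᵥ M *ᵥ x ≤ lam * (x ⬝ᵥ x) := fun x => by
    rw [hlam, div_mul_eq_mul_div, le_div_iff₀ (hpos v hv)]
    exact h x
  have hquad : ∀ x : Fin n → ℝ, x ⬝ᵥ ((lam • (1 : Matrix (Fin n) (Fin n) ℝ) - M) *ᵥ x)
      = lam * (x ⬝ᵥ x) - x ⬝ᵥ M *ᵥ x := fun x => by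
    simp [Matrix.sub_mulVec, Matrix.smul_mulVec, dotProduct_sub]
  have hpsd : (lam • (1 : Matrix (Fin n) (Fin n) ℝ) - M).PosSemidef := by
    refine Matrix.PosSemidef.of_dotProduct_mulVec_nonneg ?_ fun x => ?_
    · rw [Matrix.IsHermitian, Matrix.conjTranspose_eq_transpose_of_trivial, Matrix.transpose_sub,
        Matrix.transpose_smul, Matrix.transpose_one, hM.eq]
    · rw [star_trivial, hquad]
      linarith [hmax x]
  have hker : (lam • (1 : Matrix (Fin n) (Fin n) ℝ) - M) *ᵥ v = 0 := by
    rw [← hpsd.dotProduct_mulVec_zero_iff, star_trivial, hquad, hlam,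
      div_mul_cancel₀ _ (hpos v hv).ne', sub_self]
  refine ⟨lam, ⟨?_, hv⟩, fun μ hμ => ?_⟩
  · rw [Module.End.mem_eigenspace_iff, Matrix.toLin'_apply]
    rw [Matrix.sub_mulVec, Matrix.smul_mulVec, Matrix.one_mulVec, sub_eq_zero] at hker
    exact hker.symm
  · obtain ⟨x, hx⟩ := hμ.exists_hasEigenvector
    have h1 : M *ᵥ x = μ • x := by simpa using hx.apply_eq_smul
    have h2 := hmax x
    rw [h1, dotProduct_smul, smul_eq_mul] at h2
    exact le_of_mul_le_mul_right h2 (hpos x hx.2)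

lemma isCompact_unitSphere (n : ℕ) : IsCompact {v : Fin n → ℝ | v ⬝ᵥ v = 1} := by
  refine Metric.isCompact_of_isClosed_isBounded ?_ ?_
  · refine isClosed_eq ?_ continuous_const
    unfold dotProduct; fun_prop
  · refine (Metric.isBounded_closedBall (x := (0 : Fin n → ℝ)) (r := 1)).subset fun v hv => ?_
    rw [mem_closedBall_zero_iff, pi_norm_le_iff_of_nonneg zero_le_one]
    intro i
    refine (abs_apply_le_norm_toLp v i).trans ?_
    have hv' : v ⬝ᵥ v = 1 := hv
    rw [← one_pow 2, ← norm_toLp_sq] at hv'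
    exact ((sq_eq_sq₀ (norm_nonneg _) zero_le_one).1 hv').le

lemma exists_rayleigh_max {n : ℕ} (hn : 1 ≤ n) (M : Matrix (Fin n) (Fin n) ℝ) :
    ∃ v : Fin n → ℝ, v ⬝ᵥ v = 1 ∧ ∀ x, (x ⬝ᵥ M *ᵥ x) * (v ⬝ᵥ v) ≤ (v ⬝ᵥ M *ᵥ v) * (x ⬝ᵥ x) := by
  obtain ⟨v, hv, hmax⟩ := (isCompact_unitSphere n).exists_isMaxOn
    (f := fun v => v ⬝ᵥ M *ᵥ v) ⟨Pi.single ⟨0, hn⟩ 1, by simp⟩ (by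
      apply Continuous.continuousOn
      unfold Matrix.mulVec dotProduct; fun_prop)
  refine ⟨v, hv, fun x => ?_⟩
  have hv' : v ⬝ᵥ v = 1 := hv
  rw [hv', mul_one]
  rcases eq_or_ne x 0 with rfl | hx
  · simp
  have hx0 : 0 < ‖WithLp.toLp 2 x‖ := norm_pos_iff.2 (by simpa using hx)
  set t := ‖WithLp.toLp 2 x‖ with ht
  have hxx : x ⬝ᵥ x = t ^ 2 := (norm_toLp_sq x).symm
  have h1 : (t⁻¹ • x) ⬝ᵥ (t⁻¹ • x) = 1 := by
    rw [smul_dotProduct, dotProduct_smul, hxx, smul_eq_mul, smul_eq_mul]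
    field_simp
  have h2 : (t⁻¹ • x) ⬝ᵥ M *ᵥ (t⁻¹ • x) ≤ v ⬝ᵥ M *ᵥ v := hmax h1
  rw [Matrix.mulVec_smul, smul_dotProduct, dotProduct_smul, smul_eq_mul, smul_eq_mul] at h2
  rw [hxx]
  have h3 : x ⬝ᵥ M *ᵥ x = (t⁻¹ * (t⁻¹ * (x ⬝ᵥ M *ᵥ x))) * t ^ 2 := by field_simp
  rw [h3]
  exact mul_le_mul_of_nonneg_right h2 (by positivity)

lemma IsTopEigenvector.exists_eigenvalue {n : ℕ} {M : Matrix (Fin n) (Fin n) ℝ} (hM : M.IsSymm)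
    {v : Fin n → ℝ} (h : IsTopEigenvector M v) :
    v ≠ 0 ∧ ∃ lam : ℝ, M *ᵥ v = lam • v ∧ ∀ x, x ⬝ᵥ M *ᵥ x ≤ lam * (x ⬝ᵥ x) := by
  obtain ⟨lam, hv, hmax⟩ := h
  refine ⟨hv.2, lam, by simpa using hv.apply_eq_smul, fun x => ?_⟩
  have hn : 1 ≤ n := by
    rcases Nat.eq_zero_or_pos n with rfl | hn
    · exact absurd (Subsingleton.elim v 0) hv.2
    · exact hn
  obtain ⟨w, hw1, hw⟩ := exists_rayleigh_max hn M
  have hw0 : w ≠ 0 := by rintro rfl; simp at hw1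
  obtain ⟨μ, hμ, -⟩ := isTopEigenvector_of_rayleigh hM hw0 hw
  have h1 : M *ᵥ w = μ • w := by simpa using hμ.apply_eq_smul
  have h2 := hw x
  rw [h1, dotProduct_smul, hw1, smul_eq_mul, mul_one, mul_one] at h2
  refine h2.trans (mul_le_mul_of_nonneg_right
    (hmax μ (Module.End.hasEigenvalue_of_hasEigenvector hμ)) ?_)
  rw [← norm_toLp_sq]; positivity

lemma isTopEigenvector_iff_rayleigh {n : ℕ} {M : Matrix (Fin n) (Fin n) ℝ} (hM : M.IsSymm)
    {v : Fin n → ℝ} : IsTopEigenvector M v ↔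
      v ≠ 0 ∧ ∀ x, (x ⬝ᵥ M *ᵥ x) * (v ⬝ᵥ v) ≤ (v ⬝ᵥ M *ᵥ v) * (x ⬝ᵥ x) := by
  refine ⟨fun h => ?_, fun h => isTopEigenvector_of_rayleigh hM h.1 h.2⟩
  obtain ⟨hv, lam, h1, h2⟩ := h.exists_eigenvalue hM
  refine ⟨hv, fun x => ?_⟩
  rw [h1, dotProduct_smul, smul_eq_mul]
  have : 0 ≤ v ⬝ᵥ v := by rw [← norm_toLp_sq]; positivity
  nlinarith [h2 x]

lemma signVec_smul {n : ℕ} {t : ℝ} (ht : 0 < t) (v : Fin n → ℝ) :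
    signVec (t • v) = signVec v := by
  ext i
  simp only [signVec, Pi.smul_apply, smul_eq_mul, mul_nonneg_iff_of_pos_left ht]

lemma continuous_hollow_gram (p n : ℕ) : Continuous fun Y : Data p n => hollow (gram Y) := by
  unfold hollow gram dotProduct
  have h : Continuous fun Y : Data p n => (Matrix.of fun i j => ∑ a, Y i a * Y j a :
      Matrix (Fin n) (Fin n) ℝ) := by
    refine continuous_matrix fun i j => ?_
    simp only [Matrix.of_apply]
    fun_prop
  exact h.sub h.matrix_diag.matrix_diagonal

/-- The data for which some top eigenvector has a given sign vector form a countable union of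
projections of closed sets along the compact unit sphere. -/
lemma measurableSet_exists_topEigenvector (p n : ℕ) (l : Labels n) :
    MeasurableSet {Y : Data p n | ∃ v, IsTopEigenvector (hollow (gram Y)) v ∧ signVec v = l} := by
  set K : Set (Fin n → ℝ) := {v | v ⬝ᵥ v = 1} with hK
  have : CompactSpace K := isCompact_iff_compactSpace.1 (isCompact_unitSphere n)
  set C : ℕ → Set (Data p n × K) := fun k =>
    {z | (∀ i, if l i = 1 then 0 ≤ z.2.1 i else z.2.1 i ≤ -(1 / ((k : ℝ) + 1)))
      ∧ ∀ x, (x ⬝ᵥ hollow (gram z.1) *ᵥ x) * (z.2.1 ⬝ᵥ z.2.1)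
        ≤ (z.2.1 ⬝ᵥ hollow (gram z.1) *ᵥ z.2.1) * (x ⬝ᵥ x)} with hC
  have hclosed : ∀ k, IsClosed (C k) := by
    intro k
    have hc : Continuous fun z : Data p n × K => hollow (gram z.1) :=
      (continuous_hollow_gram p n).comp continuous_fst
    have hv : Continuous fun z : Data p n × K => z.2.1 :=
      continuous_subtype_val.comp continuous_snd
    simp only [hC]
    rw [Set.ofPred_and, Set.ofPred_forall, Set.ofPred_forall]
    refine IsClosed.inter (isClosed_iInter fun i => ?_) (isClosed_iInter fun x => ?_)
    · split_ifs
      · exact isClosed_le continuous_const ((continuous_apply i).comp hv)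
      · exact isClosed_le ((continuous_apply i).comp hv) continuous_const
    · refine isClosed_le ?_ ?_
      · exact (continuous_const.dotProduct (hc.matrix_mulVec continuous_const)).mul
          (hv.dotProduct hv)
      · exact (hv.dotProduct (hc.matrix_mulVec hv)).mul continuous_const
  have heq : {Y : Data p n | ∃ v, IsTopEigenvector (hollow (gram Y)) v ∧ signVec v = l}
      = ⋃ k, Prod.fst '' C k := by
    ext Y
    simp only [Set.mem_ofPred_eq, Set.mem_iUnion, Set.mem_image, Prod.exists, exists_and_right,
      exists_eq_right, isTopEigenvector_iff_rayleigh (isSymm_hollow_gram Y)]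
    constructor
    · rintro ⟨v, ⟨hv0, hv⟩, hl⟩
      have hx0 : 0 < ‖WithLp.toLp 2 v‖ := norm_pos_iff.2 (by simpa using hv0)
      set t := ‖WithLp.toLp 2 v‖ with ht
      have hvv : v ⬝ᵥ v = t ^ 2 := (norm_toLp_sq v).symm
      have h1 : (t⁻¹ • v) ⬝ᵥ (t⁻¹ • v) = 1 := by
        rw [smul_dotProduct, dotProduct_smul, hvv, smul_eq_mul, smul_eq_mul]
        field_simp
      rw [← signVec_smul (inv_pos.2 hx0)] at hl
      set w := t⁻¹ • v with hw
      -- Strict negativity holds with a uniform margin, since there are finitely many coordinates.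
      have hk : ∃ k : ℕ, ∀ i, l i ≠ 1 → w i ≤ -(1 / ((k : ℝ) + 1)) := by
        have : ∀ i, ∃ k : ℕ, l i ≠ 1 → w i ≤ -(1 / ((k : ℝ) + 1)) := by
          intro i
          by_cases hi : l i = 1
          · exact ⟨0, fun h => absurd hi h⟩
          · have hneg : w i < 0 := by
              by_contra hcon
              apply hi
              rw [← hl, signVec, if_pos (not_lt.1 hcon)]
            obtain ⟨k, hk⟩ := exists_nat_one_div_lt (neg_pos.2 hneg)
            exact ⟨k, fun _ => by linarith⟩
        choose k hk using this
        refine ⟨Finset.univ.sup k, fun i hi => (hk i hi).trans (neg_le_neg ?_)⟩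
        have : k i ≤ Finset.univ.sup k := Finset.le_sup (Finset.mem_univ i)
        gcongr
      obtain ⟨k, hk⟩ := hk
      refine ⟨k, ⟨w, h1⟩, fun i => ?_, fun x => ?_⟩
      · split_ifs with hi
        · by_contra hcon
          rw [← hl, signVec, if_neg hcon] at hi
          exact absurd hi (by decide)
        · exact hk i hi
      · simp only [hw, Matrix.mulVec_smul, smul_dotProduct, dotProduct_smul, smul_eq_mul]
        have := mul_le_mul_of_nonneg_left (hv x) (by positivity : 0 ≤ t⁻¹ * t⁻¹)
        linarith
    · rintro ⟨k, ⟨v, hv1⟩, hs, hv⟩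
      refine ⟨v, ⟨?_, hv⟩, ?_⟩
      · rintro rfl
        have : (0 : Fin n → ℝ) ⬝ᵥ 0 = 1 := hv1
        simp at this
      · ext i
        have hi := hs i
        have hk : (0 : ℝ) < 1 / ((k : ℝ) + 1) := by positivity
        rcases Int.units_eq_one_or (l i) with h | h
        · rw [if_pos h] at hi
          rw [h, signVec, if_pos hi]
        · rw [h] at hi
          simp only [if_neg (by decide : (-1 : ℤˣ) ≠ 1)] at hi
          rw [h, signVec, if_neg (by linarith)]
  rw [heq]
  exact MeasurableSet.iUnion fun k =>
    (isClosedMap_fst_of_compactSpace _ (hclosed k)).measurableSet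

lemma exists_isSpectralEstimator (p : ℕ) {n : ℕ} (hn : 1 ≤ n) :
    ∃ f : Data p n → Labels n, IsSpectralEstimator f := by
  classical
  set P : Data p n → ℕ → Prop := fun Y k => ∃ l : Labels n, (Fintype.equivFin (Labels n) l : ℕ) = k ∧
    ∃ v, IsTopEigenvector (hollow (gram Y)) v ∧ signVec v = l with hP
  have hex : ∀ Y, ∃ k, P Y k := by
    intro Y
    obtain ⟨v, hv1, hv⟩ := exists_rayleigh_max hn (hollow (gram Y))
    refine ⟨_, signVec v, rfl, v, isTopEigenvector_of_rayleigh (isSymm_hollow_gram Y) ?_ hv, rfl⟩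
    rintro rfl
    simp at hv1
  have hmeas : Measurable fun Y => Nat.find (hex Y) := by
    refine measurable_find hex fun k => ?_
    simp only [hP, Set.ofPred_exists, Set.ofPred_and]
    refine MeasurableSet.iUnion fun l => MeasurableSet.inter (MeasurableSet.const _) ?_
    simpa only [Set.ofPred_exists, Set.ofPred_and] using measurableSet_exists_topEigenvector p n l
  have : Nonempty (Labels n) := ⟨1⟩
  set dec : ℕ → Labels n := fun k =>
    if h : k < Fintype.card (Labels n) then (Fintype.equivFin (Labels n)).symm ⟨k, h⟩ else 1 with hdec
  refine ⟨fun Y => dec (Nat.find (hex Y)), (measurable_from_top (f := dec)).comp hmeas, fun Y => ?_⟩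
  obtain ⟨l, hl, v, hv, hvl⟩ := Nat.find_spec (hex Y)
  refine ⟨v, hv, ?_⟩
  change dec (Nat.find (hex Y)) = signVec v
  rw [← hl, hvl, hdec]
  dsimp only
  rw [dif_pos (Fin.is_lt _)]
  simp only [Fin.eta, Equiv.symm_apply_apply]

/-! ### Deterministic analysis of the spectral start and of the iteration -/

lemma Labels.toReal_neg {n : ℕ} (η : Labels n) : (-η).toReal = -η.toReal := by
  ext i; simp [Labels.toReal]

lemma signalMatrix_neg {n : ℕ} (η : Labels n) : signalMatrix (-η) = signalMatrix η := by
  simp [signalMatrix, Labels.toReal_neg, Matrix.neg_vecMulVec, Matrix.vecMulVec_neg]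

lemma signalMatrix_mulVec {n : ℕ} (η : Labels n) (x : Fin n → ℝ) :
    signalMatrix η *ᵥ x = (η.toReal ⬝ᵥ x) • η.toReal - x := by
  rw [signalMatrix, Matrix.sub_mulVec, Matrix.one_mulVec, Matrix.vecMulVec_mulVec]
  simp

lemma hammingLoss_eq {n : ℕ} (x y : Labels n) : hammingLoss x y = 2 * hammingDist x y := by
  rw [hammingLoss, hammingDist, Finset.card_filter, Finset.mul_sum]
  refine Finset.sum_congr rfl fun i _ => ?_
  rcases Int.units_eq_one_or (x i) with h | h <;> rcases Int.units_eq_one_or (y i) with h' | h' <;>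
    simp [h, h']

lemma signVec_ne_iff {n : ℕ} {v : Fin n → ℝ} {η : Labels n} {i : Fin n} (h : signVec v i ≠ η i) :
    η.toReal i * v i ≤ 0 := by
  rcases Int.units_eq_one_or (η i) with h' | h'
  · have : ¬ 0 ≤ v i := fun hv => h (by rw [h', signVec, if_pos hv])
    simp [Labels.toReal, h']; linarith
  · have : 0 ≤ v i := by
      by_contra hv
      exact h (by rw [h', signVec, if_neg hv])
    simp [Labels.toReal, h']; linarith

lemma card_mul_le_norm_sq {n : ℕ} (s : Finset (Fin n)) (x : Fin n → ℝ) {c : ℝ} (hc : 0 ≤ c)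
    (h : ∀ i ∈ s, c ≤ |x i|) : s.card * c ^ 2 ≤ ‖WithLp.toLp 2 x‖ ^ 2 := by
  rw [norm_toLp_sq, ← nsmul_eq_mul, ← Finset.sum_const, dotProduct]
  refine (Finset.sum_le_sum fun i hi => ?_).trans
    (Finset.sum_le_univ_sum_of_nonneg fun i => mul_self_nonneg (x i))
  rw [← sq, ← sq_abs (x i)]
  exact pow_le_pow_left₀ hc (h i hi) 2

lemma toReal_dotProduct_self {n : ℕ} (η : Labels n) : η.toReal ⬝ᵥ η.toReal = n := by
  simp [dotProduct, ← sq, Labels.toReal_sq]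

/-- If `M` is within relative error `κ` of a multiple of the signal matrix, then the signs of a top
eigenvector positively correlated with `η` are wrong at no more than `3 κ² n` places: the component
orthogonal to `η` has relative norm at most `κ / (1 - κ)`, and it exceeds the component along `η`
at each wrong place. -/
lemma hammingDist_signVec_top_le {n : ℕ} (hn : 1 ≤ n) {M : Matrix (Fin n) (Fin n) ℝ}
    (hM : M.IsSymm) {S κ : ℝ} (hS : 0 < S) (hκ : κ ≤ 1 / 3) {η : Labels n}
    (hZ : ‖M - S • signalMatrix η‖ ≤ κ * n * S) {v : Fin n → ℝ} (hv : IsTopEigenvector M v)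
    (hηv : 0 ≤ η.toReal ⬝ᵥ v) :
    (hammingDist (signVec v) η : ℝ) ≤ 3 * κ ^ 2 * n := by
  have hn0 : (0 : ℝ) < n := by exact_mod_cast hn
  obtain ⟨hv0, lam, hlam, hmax⟩ := hv.exists_eigenvalue hM
  set Z := M - S • signalMatrix η with hZdef
  set e := η.toReal with he
  have hee : e ⬝ᵥ e = n := toReal_dotProduct_self η
  have hMx : ∀ x, M *ᵥ x = (S * (e ⬝ᵥ x)) • e - S • x + Z *ᵥ x := fun x => by
    rw [hZdef, Matrix.sub_mulVec, Matrix.smul_mulVec, signalMatrix_mulVec, smul_sub, smul_smul]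
    abel
  have hκ0 : 0 ≤ κ := by
    have := (norm_nonneg _).trans hZ
    rw [mul_assoc] at this
    exact nonneg_of_mul_nonneg_left this (by positivity)
  have hnorme : ‖WithLp.toLp 2 e‖ ^ 2 = n := by rw [norm_toLp_sq, hee]
  -- The eigenvalue is at least the Rayleigh quotient of `η`.
  have hlamS : n * S * (1 - κ) ≤ lam + S := by
    have h1 := hmax e
    rw [hMx, hee, dotProduct_add, dotProduct_sub, dotProduct_smul, dotProduct_smul, hee,
      smul_eq_mul, smul_eq_mul] at h1
    have h2 := (neg_le_of_abs_le (abs_dotProduct_le e (Z *ᵥ e)))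
    have h3 : ‖WithLp.toLp 2 e‖ * ‖WithLp.toLp 2 (Z *ᵥ e)‖ ≤ κ * n * S * n := by
      calc _ ≤ ‖WithLp.toLp 2 e‖ * (‖Z‖ * ‖WithLp.toLp 2 e‖) := by
            gcongr; exact l2_norm_mulVec_le Z e
        _ = ‖Z‖ * ‖WithLp.toLp 2 e‖ ^ 2 := by ring
        _ ≤ _ := by rw [hnorme]; gcongr
    have h4 : (n * S * (1 - κ)) * n ≤ (lam + S) * n := by nlinarith
    exact le_of_mul_le_mul_right h4 hn0
  set c := (e ⬝ᵥ v) / n with hc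
  have hc0 : 0 ≤ c := div_nonneg hηv hn0.le
  set w := v - c • e with hw
  have hew : e ⬝ᵥ w = 0 := by
    rw [hw, dotProduct_sub, dotProduct_smul, hee, smul_eq_mul, hc]
    field_simp
    ring
  have hwv : w ⬝ᵥ v = ‖WithLp.toLp 2 w‖ ^ 2 := by
    rw [norm_toLp_sq]
    conv_lhs => rw [show v = w + c • e by rw [hw]; abel]
    rw [dotProduct_add, dotProduct_smul, dotProduct_comm w e, hew]; simp
  have hw2 : (lam + S) * ‖WithLp.toLp 2 w‖ ^ 2 = w ⬝ᵥ (Z *ᵥ v) := by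
    have h1 := hMx v
    rw [hlam] at h1
    have h2 := congrArg (fun x => w ⬝ᵥ x) h1
    simp only [dotProduct_add, dotProduct_sub, dotProduct_smul, dotProduct_comm w e, hew,
      smul_eq_mul, hwv] at h2
    linarith
  have hwle : (1 - κ) * ‖WithLp.toLp 2 w‖ ≤ κ * ‖WithLp.toLp 2 v‖ := by
    rcases (norm_nonneg (WithLp.toLp 2 w)).eq_or_lt with h0 | h0
    · rw [← h0, mul_zero]; positivity
    have h1 : w ⬝ᵥ (Z *ᵥ v) ≤ ‖WithLp.toLp 2 w‖ * (κ * n * S * ‖WithLp.toLp 2 v‖) := by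
      refine (le_abs_self _).trans ((abs_dotProduct_le _ _).trans ?_)
      gcongr
      exact (l2_norm_mulVec_le Z v).trans (by gcongr)
    rw [← hw2] at h1
    have h2 : n * S * (1 - κ) * ‖WithLp.toLp 2 w‖ ^ 2 ≤ (lam + S) * ‖WithLp.toLp 2 w‖ ^ 2 := by
      gcongr
    have h3 : (n * S * ‖WithLp.toLp 2 w‖) * ((1 - κ) * ‖WithLp.toLp 2 w‖)
        ≤ (n * S * ‖WithLp.toLp 2 w‖) * (κ * ‖WithLp.toLp 2 v‖) := by linarith
    exact le_of_mul_le_mul_left h3 (by positivity)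
  have hpyth : ‖WithLp.toLp 2 v‖ ^ 2 = c ^ 2 * n + ‖WithLp.toLp 2 w‖ ^ 2 := by
    rw [norm_toLp_sq, norm_toLp_sq]
    conv_lhs => rw [show v = w + c • e by rw [hw]; abel]
    simp only [dotProduct_add, add_dotProduct, dotProduct_smul, smul_dotProduct,
      dotProduct_comm w e, hew, hee, smul_eq_mul]
    ring
  have hvpos : 0 < ‖WithLp.toLp 2 v‖ ^ 2 := by
    have : WithLp.toLp 2 v ≠ 0 := by simpa using hv0
    positivity
  set V := ‖WithLp.toLp 2 v‖ with hV
  set W := ‖WithLp.toLp 2 w‖ with hW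
  have hW0 : 0 ≤ W := norm_nonneg _
  have hV0 : 0 ≤ V := norm_nonneg _
  have hWV : W ^ 2 ≤ 9 / 4 * κ ^ 2 * V ^ 2 := by
    have h1 : W ≤ 3 / 2 * κ * V := by nlinarith
    calc W ^ 2 ≤ (3 / 2 * κ * V) ^ 2 := pow_le_pow_left₀ hW0 h1 2
      _ = _ := by ring
  have hκ2 : κ ^ 2 ≤ 1 / 9 := by nlinarith
  have hVc : 3 / 4 * V ^ 2 ≤ c ^ 2 * n := by nlinarith
  have hcpos : 0 < c ^ 2 := by
    have : 0 < c ^ 2 * n := by linarith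
    exact pos_of_mul_pos_left this hn0.le
  have hcount : (hammingDist (signVec v) η : ℝ) * c ^ 2 ≤ W ^ 2 := by
    refine card_mul_le_norm_sq _ w hc0 fun i hi => ?_
    have h1 := signVec_ne_iff (Finset.mem_filter.1 hi).2
    have h2 : η.toReal i * w i ≤ -c := by
      rw [hw]
      simp only [Pi.sub_apply, Pi.smul_apply, smul_eq_mul, mul_sub]
      have := Labels.toReal_sq η i
      rw [he]
      nlinarith
    have hη : |η.toReal i| = 1 := by
      rw [← sq_eq_sq₀ (abs_nonneg _) zero_le_one, sq_abs, Labels.toReal_sq]; norm_num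
    calc c ≤ |η.toReal i * w i| := by rw [le_abs]; right; linarith
      _ = |w i| := by rw [abs_mul, hη, one_mul]
  have hfin : (hammingDist (signVec v) η : ℝ) * c ^ 2 ≤ 3 * κ ^ 2 * n * c ^ 2 := by
    nlinarith [sq_nonneg κ]
  exact le_of_mul_le_mul_right hfin hcpos

/-- The places at which the vote of the true labels `η` has margin at most `t`. -/
def weakPlaces {n : ℕ} (M : Matrix (Fin n) (Fin n) ℝ) (η : Labels n) (t : ℝ) : Finset (Fin n) :=
  Finset.univ.filter fun i => η.toReal i * (M *ᵥ η.toReal) i ≤ t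

lemma weakPlaces_neg {n : ℕ} (M : Matrix (Fin n) (Fin n) ℝ) (η : Labels n) (t : ℝ) :
    weakPlaces M (-η) t = weakPlaces M η t := by
  simp [weakPlaces, Labels.toReal_neg, Matrix.mulVec_neg]

/-- One step of the iteration is a contraction of the number of errors, up to the number of weak
places: at a wrong place that is not weak, the operator `M - S • signalMatrix η` moves the error
vector by a large amount, and this cannot happen often. -/
lemma hammingDist_step_le {n : ℕ} (hn : 2 ≤ n) {M : Matrix (Fin n) (Fin n) ℝ}
    {S κ δ : ℝ} (hS : 0 < S) (hδ : 0 < δ) (hκ : κ ≤ δ / 16) {η x : Labels n}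
    (hZ : ‖M - S • signalMatrix η‖ ≤ κ * n * S)
    (hx : (hammingDist x η : ℝ) ≤ δ * n / 8) :
    (hammingDist (signVec (M *ᵥ x.toReal)) η : ℝ)
      ≤ (weakPlaces M η (δ * (n - 1) * S)).card + hammingDist x η / 4 := by
  have hn2 : (2 : ℝ) ≤ n := by exact_mod_cast hn
  set Z := M - S • signalMatrix η with hZdef
  set e := η.toReal with he
  set u := x.toReal - e with hu
  set N : ℝ := ((hammingDist x η : ℕ) : ℝ) with hN
  have hN0 : 0 ≤ N := Nat.cast_nonneg _
  have hMx : M *ᵥ x.toReal = M *ᵥ e + ((S * (e ⬝ᵥ u)) • e - S • u + Z *ᵥ u) := by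
    have h1 : M *ᵥ u = (S * (e ⬝ᵥ u)) • e - S • u + Z *ᵥ u := by
      rw [hZdef, Matrix.sub_mulVec, Matrix.smul_mulVec, signalMatrix_mulVec,
        smul_sub S (_ • _), smul_smul]
      abel
    rw [← h1, hu, Matrix.mulVec_sub]
    abel
  have hprod : ∀ i, e i * u i = if x i ≠ η i then -2 else 0 := by
    intro i
    rcases Int.units_eq_one_or (x i) with h | h <;> rcases Int.units_eq_one_or (η i) with h' | h' <;>
      simp [hu, he, Labels.toReal, h, h'] <;> norm_num
  have hsq : ∀ i, u i * u i = if x i ≠ η i then 4 else 0 := by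
    intro i
    rcases Int.units_eq_one_or (x i) with h | h <;> rcases Int.units_eq_one_or (η i) with h' | h' <;>
      simp [hu, he, Labels.toReal, h, h'] <;> norm_num
  have heu : e ⬝ᵥ u = -2 * N := by
    simp only [dotProduct, hprod]
    rw [← Finset.sum_filter, Finset.sum_const, nsmul_eq_mul, hN, hammingDist]
    ring
  have huu : ‖WithLp.toLp 2 u‖ ^ 2 = 4 * N := by
    rw [norm_toLp_sq]
    simp only [dotProduct, hsq]
    rw [← Finset.sum_filter, Finset.sum_const, nsmul_eq_mul, hN, hammingDist]
    ring
  set B := Finset.univ.filter fun i => δ * n * S / 4 ≤ |(Z *ᵥ u) i| with hB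
  have hBcard : (B.card : ℝ) ≤ N / 4 := by
    have h1 := card_mul_le_norm_sq B (Z *ᵥ u) (c := δ * n * S / 4) (by positivity)
      fun i hi => (Finset.mem_filter.1 hi).2
    have h2 : ‖WithLp.toLp 2 (Z *ᵥ u)‖ ^ 2 ≤ (δ / 16 * n * S) ^ 2 * (4 * N) := by
      rw [← huu, ← mul_pow]
      refine pow_le_pow_left₀ (norm_nonneg _) ((l2_norm_mulVec_le Z u).trans ?_) 2
      gcongr
      exact hZ.trans (by gcongr)
    have h3 : (B.card : ℝ) * (δ * n * S / 4) ^ 2 ≤ N / 4 * (δ * n * S / 4) ^ 2 := by nlinarith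
    exact le_of_mul_le_mul_right h3 (by positivity)
  have hsub : (Finset.univ.filter fun i => signVec (M *ᵥ x.toReal) i ≠ η i)
      ⊆ weakPlaces M η (δ * (n - 1) * S) ∪ B := by
    intro i hi
    have h1 := signVec_ne_iff (Finset.mem_filter.1 hi).2
    by_contra hcon
    simp only [Finset.mem_union, not_or, weakPlaces, hB, Finset.mem_filter, Finset.mem_univ,
      true_and, not_le] at hcon
    obtain ⟨h2, h3⟩ := hcon
    have hη : |e i| = 1 := by
      rw [← sq_eq_sq₀ (abs_nonneg _) zero_le_one, sq_abs, Labels.toReal_sq]; norm_num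
    have he2 : e i * e i = 1 := by rw [← sq]; exact Labels.toReal_sq η i
    have h4 : -(δ * n * S / 4) ≤ e i * (Z *ᵥ u) i := by
      have : |e i * (Z *ᵥ u) i| < δ * n * S / 4 := by rwa [abs_mul, hη, one_mul]
      exact (abs_lt.1 this).1.le
    have h5 : e i * u i ≤ 0 := by
      rw [hprod]; split_ifs <;> norm_num
    rw [hMx] at h1
    simp only [Pi.add_apply, Pi.sub_apply, Pi.smul_apply, smul_eq_mul, heu] at h1
    have h6 : e i * ((M *ᵥ e) i + (S * (-2 * N) * e i - S * u i + (Z *ᵥ u) i))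
        = e i * (M *ᵥ e) i - 2 * S * N * (e i * e i) - S * (e i * u i) + e i * (Z *ᵥ u) i := by
      ring
    rw [h6, he2] at h1
    have h7 : S * (e i * u i) ≤ 0 := mul_nonpos_of_nonneg_of_nonpos hS.le h5
    have h8 : 2 * S * N ≤ δ * n * S / 4 := by nlinarith
    have h9 : δ * n * S / 2 ≤ δ * (n - 1) * S := by
      have : (0 : ℝ) ≤ δ * S * (n - 2) := by
        have : (0 : ℝ) ≤ n - 2 := by linarith
        positivity
      linarith
    linarith
  calc (hammingDist (signVec (M *ᵥ x.toReal)) η : ℝ)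
      ≤ ((weakPlaces M η (δ * (n - 1) * S) ∪ B).card : ℝ) := by
        exact_mod_cast Finset.card_le_card hsub
    _ ≤ (weakPlaces M η (δ * (n - 1) * S)).card + B.card := by
        exact_mod_cast Finset.card_union_le _ _
    _ ≤ _ := by linarith

lemma loss_le_of_hammingDist {n : ℕ} {x η ν : Labels n} (hν : ν = η ∨ ν = -η) :
    loss x η ≤ 2 * hammingDist x ν := by
  rw [loss, ← hammingLoss_eq]
  rcases hν with rfl | rfl
  · exact min_le_left _ _
  · exact min_le_right _ _

lemma loss_le {n : ℕ} (x η : Labels n) : loss x η ≤ 2 * n := by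
  refine (loss_le_of_hammingDist (Or.inl rfl)).trans (Nat.mul_le_mul_left 2 ?_)
  simpa using hammingDist_le_card_fintype (x := x) (y := η)

/-- On the event that the noise is small and weak places are few, the spectral start is good
enough, and the iteration then converges geometrically to the number of weak places. -/
lemma loss_lloyd_le {p n : ℕ} (hn : 2 ≤ n) {f : Data p n → Labels n} (hf : IsSpectralEstimator f)
    {Y : Data p n} {S κ δ : ℝ} (hS : 0 < S) (hδ : 0 < δ) (hδ1 : δ ≤ 1) (hκ : κ ≤ δ / 16)
    {η : Labels n} (hZ : ‖hollow (gram Y) - S • signalMatrix η‖ ≤ κ * n * S)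
    (hW : ((weakPlaces (hollow (gram Y)) η (δ * (n - 1) * S)).card : ℝ) ≤ δ * n / 16) (k : ℕ) :
    (loss (lloyd f k Y) η : ℝ)
      ≤ 4 * (weakPlaces (hollow (gram Y)) η (δ * (n - 1) * S)).card + 2 * n * (1 / 4) ^ k := by
  have hn0 : (0 : ℝ) < n := by exact_mod_cast (by omega : 0 < n)
  obtain ⟨v, hv, hfv⟩ := hf.2 Y
  set M := hollow (gram Y) with hM
  have hsym : M.IsSymm := isSymm_hollow_gram Y
  obtain ⟨ν, hν, hνv⟩ : ∃ ν : Labels n, (ν = η ∨ ν = -η) ∧ 0 ≤ ν.toReal ⬝ᵥ v := by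
    rcases le_total 0 (η.toReal ⬝ᵥ v) with h | h
    · exact ⟨η, Or.inl rfl, h⟩
    · exact ⟨-η, Or.inr rfl, by rw [Labels.toReal_neg, neg_dotProduct]; linarith⟩
  have hsig : signalMatrix ν = signalMatrix η := by
    rcases hν with rfl | rfl
    · rfl
    · exact signalMatrix_neg η
  have hweak : weakPlaces M ν (δ * (n - 1) * S) = weakPlaces M η (δ * (n - 1) * S) := by
    rcases hν with rfl | rfl
    · rfl
    · exact weakPlaces_neg M η _
  rw [← hsig] at hZ
  rw [← hweak] at hW ⊢
  set W : ℝ := ((weakPlaces M ν (δ * (n - 1) * S)).card : ℝ) with hWdef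
  have hW0 : 0 ≤ W := Nat.cast_nonneg _
  have hκ0 : 0 ≤ κ := by
    have := (norm_nonneg _).trans hZ
    rw [mul_assoc] at this
    exact nonneg_of_mul_nonneg_left this (by positivity)
  have key : ∀ k, (hammingDist (lloyd f k Y) ν : ℝ) ≤ 2 * W + n * (1 / 4) ^ k
      ∧ (hammingDist (lloyd f k Y) ν : ℝ) ≤ δ * n / 8 := by
    intro k
    induction k with
    | zero =>
      have h := hammingDist_signVec_top_le (by omega) hsym hS (by linarith) hZ hv hνv
      simp only [lloyd, hfv, pow_zero, mul_one]
      have h2 : 3 * κ ^ 2 * n ≤ δ * n / 8 := by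
        have : 3 * κ ^ 2 ≤ δ / 8 := by nlinarith
        nlinarith
      exact ⟨by nlinarith, by linarith⟩
    | succ k ih =>
      have h := hammingDist_step_le hn hS hδ hκ hZ ih.2
      simp only [lloyd]
      rw [← hM]
      rw [pow_succ]
      exact ⟨by linarith [ih.1], by linarith [ih.2]⟩
  have h1 : (loss (lloyd f k Y) η : ℝ) ≤ 2 * hammingDist (lloyd f k Y) ν := by
    exact_mod_cast loss_le_of_hammingDist hν
  linarith [(key k).1]

/-! ### Weak places are rare -/

lemma vote_eq {p n : ℕ} (θ : Fin p → ℝ) (η : Labels n) (ξ : Data p n) (i : Fin n) :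
    η.toReal i * (hollow (gram fun i a => η.toReal i * θ a + ξ i a) *ᵥ η.toReal) i
      = (θ + η.toReal i • ξ i)
        ⬝ᵥ (((n : ℝ) - 1) • θ + ∑ j ∈ Finset.univ.erase i, η.toReal j • ξ j) := by
  set e := η.toReal with he
  have he2 : ∀ j, e j * e j = 1 := fun j => by rw [← sq]; exact Labels.toReal_sq η j
  have hn : ((n : ℝ) - 1) • θ = ∑ j ∈ Finset.univ.erase i, θ := by
    rw [Finset.sum_const, Finset.card_erase_of_mem (Finset.mem_univ i), ← Nat.cast_smul_eq_nsmul ℝ]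
    have : 1 ≤ n := i.pos
    simp [this]
  rw [hn, ← Finset.sum_add_distrib, dotProduct_sum, Matrix.mulVec, dotProduct,
    ← Finset.add_sum_erase _ _ (Finset.mem_univ i)]
  have h0 : hollow (gram fun i a => e i * θ a + ξ i a) i i = 0 := by simp [hollow]
  rw [h0, zero_mul, zero_add, Finset.mul_sum]
  refine Finset.sum_congr rfl fun j hj => ?_
  have hij : i ≠ j := (Finset.ne_of_mem_erase hj).symm
  simp only [hollow, gram, Matrix.sub_apply, Matrix.of_apply, Matrix.diagonal_apply_ne _ hij,
    sub_zero, dotProduct, Pi.add_apply, Pi.smul_apply, smul_eq_mul, Finset.mul_sum, Finset.sum_mul]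
  refine Finset.sum_congr rfl fun a _ => ?_
  linear_combination (θ a * θ a * (e j * e j) + e j * θ a * ξ j a) * he2 i
    + (θ a * θ a + e i * ξ i a * θ a) * he2 j

lemma integral_exp_vote_le {p : ℕ} (θ : Fin p → ℝ) {m t l : ℝ} (ht : t ^ 2 = m)
    (hlm : l ^ 2 * m ≤ 1 / 2) :
    ∫⁻ z, ENNReal.ofReal (Real.exp (-l * ((θ + z.1) ⬝ᵥ (m • θ + t • z.2))))
        ∂((gaussVec p).prod (gaussVec p))
      ≤ ENNReal.ofReal (Real.exp (-l * m * (θ ⬝ᵥ θ) + l ^ 2 * m / 2 * (θ ⬝ᵥ θ)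
        + (l * m * (1 - l)) ^ 2 * (θ ⬝ᵥ θ) / (2 * (1 - l ^ 2 * m))
        + p * (l ^ 2 * m / 2 + (l ^ 2 * m) ^ 2))) := by
  set s := θ ⬝ᵥ θ with hs
  have hmeas : Measurable fun z : (Fin p → ℝ) × (Fin p → ℝ) =>
      ENNReal.ofReal (Real.exp (-l * ((θ + z.1) ⬝ᵥ (m • θ + t • z.2)))) := by
    refine Measurable.ennreal_ofReal (Continuous.measurable ?_)
    unfold dotProduct; fun_prop
  rw [lintegral_prod _ hmeas.aemeasurable]
  -- The inner integral is that of the exponential of a linear functional.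
  have hinner : ∀ g : Fin p → ℝ,
      ∫⁻ w, ENNReal.ofReal (Real.exp (-l * ((θ + g) ⬝ᵥ (m • θ + t • w)))) ∂gaussVec p
      ≤ ENNReal.ofReal (Real.exp (-l * m * s + l ^ 2 * m / 2 * s))
        * ENNReal.ofReal (Real.exp (((-(l * m * (1 - l))) • θ) ⬝ᵥ g
          + l ^ 2 * m / 2 * ∑ a, g a ^ 2)) := by
    intro g
    have h1 : ∀ w : Fin p → ℝ, ENNReal.ofReal (Real.exp (-l * ((θ + g) ⬝ᵥ (m • θ + t • w))))
        = ENNReal.ofReal (Real.exp (-l * m * ((θ + g) ⬝ᵥ θ)))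
          * ENNReal.ofReal (Real.exp (((-l * t) • (θ + g)) ⬝ᵥ w + 0 / 2 * ∑ a, w a ^ 2)) := by
      intro w
      rw [← ENNReal.ofReal_mul (Real.exp_pos _).le, ← Real.exp_add]
      congr 2
      simp only [dotProduct_add, dotProduct_smul, smul_dotProduct, smul_eq_mul]
      ring
    simp_rw [h1]
    rw [lintegral_const_mul _ (by unfold dotProduct; fun_prop)]
    refine (mul_le_mul_right (lintegral_gaussVec_exp_le _ (by norm_num)) _).trans (le_of_eq ?_)
    rw [← ENNReal.ofReal_mul (Real.exp_pos _).le, ← ENNReal.ofReal_mul (Real.exp_pos _).le,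
      ← Real.exp_add, ← Real.exp_add]
    congr 2
    have h2 : ∑ a, ((-l * t) • (θ + g)) a ^ 2 = l ^ 2 * m * (s + 2 * (θ ⬝ᵥ g) + ∑ a, g a ^ 2) := by
      rw [← ht, hs]
      simp only [dotProduct, Pi.smul_apply, Pi.add_apply, smul_eq_mul, Finset.mul_sum,
        ← Finset.sum_add_distrib]
      exact Finset.sum_congr rfl fun a _ => by ring
    rw [h2, add_dotProduct, smul_dotProduct, smul_eq_mul, dotProduct_comm g θ, ← hs]
    ring
  refine (lintegral_mono hinner).trans ?_
  rw [lintegral_const_mul _ (by unfold dotProduct; fun_prop)]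
  refine (mul_le_mul_right (lintegral_gaussVec_exp_le _ hlm) _).trans (le_of_eq ?_)
  rw [← ENNReal.ofReal_mul (Real.exp_pos _).le, ← Real.exp_add]
  congr 2
  have h3 : ∑ a, ((-(l * m * (1 - l))) • θ) a ^ 2 = (l * m * (1 - l)) ^ 2 * s := by
    rw [hs]
    simp only [dotProduct, Pi.smul_apply, smul_eq_mul, Finset.mul_sum]
    exact Finset.sum_congr rfl fun a _ => by ring
  rw [h3]
  ring

/-- The Chernoff exponent at the optimal parameter `l = (1 - δ) s / (m s + p)`. -/
lemma chernoff_exponent_le {m s p δ l : ℝ} (hm : 3 ≤ m) (hs : 0 < s) (hp : 0 ≤ p) (hδ : 0 ≤ δ)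
    (hδ1 : δ ≤ 1) (hl : l = (1 - δ) * s / (m * s + p)) :
    l ^ 2 * m ≤ 1 / 2 ∧
    l * (δ * m * s) + (-l * m * s + l ^ 2 * m / 2 * s
        + (l * m * (1 - l)) ^ 2 * s / (2 * (1 - l ^ 2 * m))
        + p * (l ^ 2 * m / 2 + (l ^ 2 * m) ^ 2))
      ≤ -((1 - δ) ^ 2 / 2 * ((m - 3) * s ^ 2 / (m * s + p))) := by
  have hD : 0 < m * s + p := by positivity
  have hlD : l * (m * s + p) = (1 - δ) * s := by rw [hl]; field_simp
  have hl0 : 0 ≤ l := by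
    rw [hl]; have : 0 ≤ 1 - δ := by linarith
    positivity
  have hlm : l * m ≤ 1 := by
    have h1 : l * m * s ≤ 1 * s := by nlinarith [mul_nonneg hl0 hp, mul_nonneg hδ hs.le]
    exact le_of_mul_le_mul_right h1 hs
  have hl1 : l ≤ 1 := by nlinarith
  have hqm : l ^ 2 * m * m ≤ 1 := by
    have : l ^ 2 * m * m = (l * m) ^ 2 := by ring
    rw [this]
    exact pow_le_one₀ (by positivity) hlm
  set q := l ^ 2 * m with hq
  have hq0 : 0 ≤ q := by positivity
  have hqhalf : q ≤ 1 / 2 := by nlinarith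
  refine ⟨hqhalf, ?_⟩
  have h1 : (l * m * (1 - l)) ^ 2 * s / (2 * (1 - q)) ≤ q * m * s / 2 * (1 + 2 * q) := by
    rw [div_le_iff₀ (by linarith)]
    have e1 : (l * m * (1 - l)) ^ 2 * s = q * m * s * (1 - l) ^ 2 := by rw [hq]; ring
    have e2 : (1 - l) ^ 2 ≤ 1 := pow_le_one₀ (by linarith) (by linarith)
    have e3 : 1 ≤ (1 + 2 * q) * (1 - q) := by nlinarith
    have e4 : 0 ≤ q * m * s := by positivity
    rw [e1]
    nlinarith [mul_le_mul_of_nonneg_left e2 e4, mul_le_mul_of_nonneg_left e3 e4]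
  have hqs : q * (m * q * s) ≤ q * s := by
    have : m * q * s ≤ s := by nlinarith
    exact mul_le_mul_of_nonneg_left this hq0
  -- The sum of the terms of second order is at most `l² m (m s + p) (1 + 3 / m) / 2`.
  have h2 : l ^ 2 * (m + 3) * (m * s + p) = l * (m + 3) * ((1 - δ) * s) := by
    rw [← hlD]; ring
  have h3 : p * q ^ 2 ≤ p * l ^ 2 := by
    have : q ^ 2 ≤ l ^ 2 := by
      have e : q ^ 2 = l ^ 2 * q * m := by rw [hq]; ring
      rw [e]
      have : q * m ≤ 1 := hqm
      nlinarith [sq_nonneg l]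
    exact mul_le_mul_of_nonneg_left this hp
  have h4 : l * ((1 - δ) * s) * (m - 3) = (1 - δ) ^ 2 * ((m - 3) * s ^ 2 / (m * s + p)) := by
    rw [hl]; field_simp
  have h5 : 0 ≤ p * l ^ 2 := by positivity
  have h6 : q * m * s / 2 * (1 + 2 * q) + q / 2 * s + p * (q / 2 + q ^ 2)
      ≤ l ^ 2 * (m + 3) * (m * s + p) / 2 := by
    have e1 : l ^ 2 * (m + 3) * (m * s + p) / 2
        = q * m * s / 2 + 3 / 2 * q * s + p * q / 2 + 3 / 2 * (p * l ^ 2) := by rw [hq]; ring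
    rw [e1]
    nlinarith
  nlinarith

/-- A place is weak with probability at most about `exp (-r² / 2)`, where `r` is the
signal-to-noise ratio. -/
lemma noise_vote_le {p n : ℕ} (hn : 4 ≤ n) (θ : Fin p → ℝ) (hθ : 0 < θ ⬝ᵥ θ) (η : Labels n)
    (i : Fin n) {δ : ℝ} (hδ : 0 ≤ δ) (hδ1 : δ ≤ 1) :
    noise p n {ξ | η.toReal i * (hollow (gram fun i a => η.toReal i * θ a + ξ i a) *ᵥ η.toReal) i
        ≤ δ * (n - 1) * (θ ⬝ᵥ θ)}
      ≤ ENNReal.ofReal (Real.exp (-((1 - δ) ^ 2 / 2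
        * ((n - 4) / n * ((θ ⬝ᵥ θ) ^ 2 / (θ ⬝ᵥ θ + p / n)))))) := by
  have hn4 : (4 : ℝ) ≤ n := by exact_mod_cast hn
  set s := θ ⬝ᵥ θ with hs
  set m : ℝ := n - 1 with hm
  have ht : √m ^ 2 = m := Real.sq_sqrt (by linarith)
  set t := √m with htdef
  have hmap := noise_map_pair p η.toReal (Labels.toReal_sq η) i ht
  have hcont : Continuous fun z : (Fin p → ℝ) × (Fin p → ℝ) => (θ + z.1) ⬝ᵥ (m • θ + z.2) := by
    unfold dotProduct; fun_prop
  have hB : MeasurableSet {z : (Fin p → ℝ) × (Fin p → ℝ) | (θ + z.1) ⬝ᵥ (m • θ + z.2) ≤ δ * m * s} :=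
    measurableSet_le hcont.measurable measurable_const
  obtain ⟨hq, hexp⟩ := chernoff_exponent_le (m := m) (s := s) (p := p) (δ := δ) (by linarith) hθ
    (Nat.cast_nonneg p) hδ hδ1 rfl
  have hl0 : 0 ≤ (1 - δ) * s / (m * s + p) := by
    have : 0 ≤ 1 - δ := by linarith
    have : 0 ≤ m := by linarith
    positivity
  set l := (1 - δ) * s / (m * s + p) with hl
  calc _ = (noise p n).map
        (fun ξ => (η.toReal i • ξ i, ∑ j ∈ Finset.univ.erase i, η.toReal j • ξ j))
        {z | (θ + z.1) ⬝ᵥ (m • θ + z.2) ≤ δ * m * s} := by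
        rw [Measure.map_apply (by fun_prop) hB]
        congr 1
        ext ξ
        simp only [Set.mem_ofPred_eq, Set.mem_preimage, vote_eq, ← hm]
    _ = ((gaussVec p).prod (gaussVec p))
        {z | (θ + z.1) ⬝ᵥ (m • θ + t • z.2) ≤ δ * m * s} := by
        rw [hmap, Measure.map_apply (by fun_prop) hB]
        rfl
    _ ≤ ((gaussVec p).prod (gaussVec p))
        {z | -(l * (δ * m * s)) ≤ -l * ((θ + z.1) ⬝ᵥ (m • θ + t • z.2))} := by
        refine measure_mono fun z hz => ?_
        simp only [Set.mem_ofPred_eq] at hz ⊢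
        nlinarith [mul_le_mul_of_nonneg_left hz hl0]
    _ ≤ _ := measure_le_exp_mul_lintegral_exp _ (by
        refine Continuous.measurable ?_
        unfold dotProduct; fun_prop) _
    _ ≤ _ := mul_le_mul_right (integral_exp_vote_le θ ht hq) _
    _ ≤ _ := by
        rw [← ENNReal.ofReal_mul (Real.exp_pos _).le, ← Real.exp_add, neg_neg, ← hs]
        refine ENNReal.ofReal_le_ofReal (Real.exp_le_exp.2 (hexp.trans (neg_le_neg ?_)))
        gcongr
        have hp0 : (0 : ℝ) ≤ p := Nat.cast_nonneg p
        have e1 : ((n : ℝ) - 4) / n * (s ^ 2 / (s + p / n)) = (n - 4) * s ^ 2 / (n * s + p) := by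
          have : (0 : ℝ) < n := by linarith
          field_simp
        rw [e1, show m - 3 = (n : ℝ) - 4 by rw [hm]; ring]
        have : (0 : ℝ) ≤ n - 4 := by linarith
        have : 0 < m * s + p := by
          have : 0 < m := by linarith
          positivity
        gcongr
        rw [hm]; linarith

lemma lintegral_card_weakPlaces_le {p n : ℕ} (hn : 4 ≤ n) (θ : Fin p → ℝ) (hθ : 0 < θ ⬝ᵥ θ)
    (η : Labels n) {δ : ℝ} (hδ : 0 ≤ δ) (hδ1 : δ ≤ 1) :
    ∫⁻ ξ, ((weakPlaces (hollow (gram fun i a => η.toReal i * θ a + ξ i a)) η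
        (δ * (n - 1) * (θ ⬝ᵥ θ))).card : ℝ≥0∞) ∂noise p n
      ≤ n * ENNReal.ofReal (Real.exp (-((1 - δ) ^ 2 / 2
        * ((n - 4) / n * ((θ ⬝ᵥ θ) ^ 2 / (θ ⬝ᵥ θ + p / n)))))) := by
  have hpt : ∀ ξ : Data p n, ((weakPlaces (hollow (gram fun i a => η.toReal i * θ a + ξ i a)) η
        (δ * (n - 1) * (θ ⬝ᵥ θ))).card : ℝ≥0∞) = ∑ i, Set.indicator {ξ : Data p n |
        η.toReal i * (hollow (gram fun i a => η.toReal i * θ a + ξ i a) *ᵥ η.toReal) i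
        ≤ δ * (n - 1) * (θ ⬝ᵥ θ)} 1 ξ := by
    intro ξ
    rw [weakPlaces, Finset.card_filter]
    push_cast
    refine Finset.sum_congr rfl fun i _ => ?_
    simp [Set.indicator_apply]
  have hmeas : ∀ i, MeasurableSet {ξ : Data p n |
        η.toReal i * (hollow (gram fun i a => η.toReal i * θ a + ξ i a) *ᵥ η.toReal) i
        ≤ δ * (n - 1) * (θ ⬝ᵥ θ)} := by
    intro i
    refine measurableSet_le (Continuous.measurable ?_) measurable_const
    simp only [vote_eq]
    unfold dotProduct; fun_prop
  simp_rw [hpt]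
  rw [lintegral_finsetSum _ fun i _ => measurable_one.indicator (hmeas i)]
  refine (Finset.sum_le_sum fun i _ => ?_).trans (le_of_eq (by
    rw [Finset.sum_const, Finset.card_univ, Fintype.card_fin, nsmul_eq_mul]))
  rw [lintegral_indicator_one (hmeas i)]
  exact noise_vote_le hn θ hθ η i hδ hδ1

/-! ### Risks, and reduction to unit noise level -/

lemma measurable_obs {p n : ℕ} (σ : ℝ) (θ : Fin p → ℝ) (η : Labels n) :
    Measurable fun (ξ : Data p n) i a => η.toReal i * θ a + σ * ξ i a := by fun_prop

instance : MeasurableSingletonClass ℤˣ where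
  measurableSet_singleton u := by
    have h : ({u} : Set ℤˣ) = (fun v : ℤˣ => (v : ℤ)) ⁻¹' {(u : ℤ)} := by
      ext v
      simp [Units.ext_iff]
    rw [h]
    exact (comap_measurable _) (measurableSet_singleton _)

lemma measurable_labels_fun {n : ℕ} {β : Type*} [MeasurableSpace β] (g : Labels n → β) :
    Measurable g := measurable_of_finite g

lemma lintegral_loss_law {p n : ℕ} (σ : ℝ) (θ : EuclideanSpace ℝ (Fin p)) (η : Labels n)
    {f : Data p n → Labels n} (hf : Measurable f) :
    ∫⁻ Y, (loss (f Y) η : ℝ≥0∞) ∂law σ θ η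
      = ∫⁻ ξ, (loss (f fun i a => η.toReal i * θ a + σ * ξ i a) η : ℝ≥0∞) ∂noise p n :=
  lintegral_map ((measurable_labels_fun fun l => (loss l η : ℝ≥0∞)).comp hf)
    (measurable_obs σ θ.ofLp η)

/-- Rescaling the data reduces everything to unit noise level. -/
lemma maxRisk_eq_maxRisk_one {p n : ℕ} {σ : ℝ} (hσ : 0 < σ) (Δ : ℝ) {f : Data p n → Labels n}
    (hf : Measurable f) : maxRisk σ Δ f = maxRisk 1 (Δ / σ) fun Y => f (σ • Y) := by
  have hf' : Measurable fun Y : Data p n => f (σ • Y) := hf.comp (measurable_const_smul σ)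
  have key : ∀ (θ : EuclideanSpace ℝ (Fin p)) (η : Labels n),
      ∫⁻ Y, (loss (f Y) η : ℝ≥0∞) ∂law σ (σ • θ) η
        = ∫⁻ Y, (loss (f (σ • Y)) η : ℝ≥0∞) ∂law 1 θ η := by
    intro θ η
    rw [lintegral_loss_law σ _ η hf, lintegral_loss_law 1 θ η hf']
    refine lintegral_congr fun ξ => ?_
    congr 4
    ext i a
    simp
    ring
  apply le_antisymm
  · refine iSup₂_le fun ω hω => ?_
    have h1 : ω.1 = σ • (σ⁻¹ • ω.1) := by rw [smul_smul, mul_inv_cancel₀ hσ.ne', one_smul]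
    rw [h1, key]
    refine le_iSup₂_of_le (σ⁻¹ • ω.1, ω.2) ?_ le_rfl
    change Δ / σ ≤ ‖σ⁻¹ • ω.1‖
    rw [norm_smul, norm_inv, Real.norm_of_nonneg hσ.le, div_eq_inv_mul]
    exact mul_le_mul_of_nonneg_left hω (by positivity)
  · refine iSup₂_le fun ω hω => ?_
    rw [← key]
    refine le_iSup₂_of_le (σ • ω.1, ω.2) ?_ le_rfl
    change Δ ≤ ‖σ • ω.1‖
    rw [norm_smul, Real.norm_of_nonneg hσ.le, mul_comm, ← div_le_iff₀ hσ]
    exact hω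

lemma snr_eq_snr_one (p n : ℕ) (σ Δ : ℝ) : snr p n σ Δ = snr p n 1 (Δ / σ) := by
  simp [snr, div_pow]

lemma hollow_gram_smul {p n : ℕ} (c : ℝ) (Y : Data p n) :
    hollow (gram (c • Y)) = c ^ 2 • hollow (gram Y) := by
  have h : gram (c • Y) = c ^ 2 • gram Y := by
    ext i j
    simp [gram, smul_dotProduct, dotProduct_smul, sq, mul_assoc]
  rw [hollow, hollow, h, smul_sub, Matrix.diag_smul, Matrix.diagonal_smul]

lemma IsTopEigenvector.of_smul {n : ℕ} {M : Matrix (Fin n) (Fin n) ℝ} (hM : M.IsSymm) {c : ℝ}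
    (hc : 0 < c) {v : Fin n → ℝ} (h : IsTopEigenvector (c • M) v) : IsTopEigenvector M v := by
  rw [isTopEigenvector_iff_rayleigh hM]
  obtain ⟨h1, h2⟩ := (isTopEigenvector_iff_rayleigh (hM.smul c)).1 h
  refine ⟨h1, fun x => ?_⟩
  have := h2 x
  simp only [Matrix.smul_mulVec, dotProduct_smul, smul_eq_mul, mul_assoc] at this
  exact le_of_mul_le_mul_left this hc

lemma IsSpectralEstimator.comp_smul {p n : ℕ} {f : Data p n → Labels n}
    (hf : IsSpectralEstimator f) {σ : ℝ} (hσ : 0 < σ) :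
    IsSpectralEstimator fun Y => f (σ • Y) := by
  refine ⟨hf.1.comp (measurable_const_smul σ), fun Y => ?_⟩
  obtain ⟨v, hv, hfv⟩ := hf.2 (σ • Y)
  rw [hollow_gram_smul] at hv
  exact ⟨v, hv.of_smul (isSymm_hollow_gram Y) (by positivity), hfv⟩

lemma lloyd_smul {p n : ℕ} (f : Data p n → Labels n) {σ : ℝ} (hσ : 0 < σ) (k : ℕ) (Y : Data p n) :
    lloyd f k (σ • Y) = lloyd (fun Y => f (σ • Y)) k Y := by
  induction k with
  | zero => rfl
  | succ k ih =>
    simp only [lloyd]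
    rw [ih, hollow_gram_smul, Matrix.smul_mulVec, signVec_smul (by positivity)]

lemma measurable_lloyd {p n : ℕ} {f : Data p n → Labels n} (hf : Measurable f) (k : ℕ) :
    Measurable (lloyd f k) := by
  induction k with
  | zero => exact hf
  | succ k ih =>
    simp only [lloyd]
    refine measurable_pi_iff.2 fun i => ?_
    simp only [signVec]
    refine Measurable.ite (measurableSet_le measurable_const ?_) measurable_const measurable_const
    unfold Matrix.mulVec dotProduct
    refine Finset.measurable_sum _ fun j _ => Measurable.mul ?_ ?_
    · exact ((continuous_hollow_gram p n).matrix_elem i j).measurable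
    · exact (measurable_labels_fun fun l : Labels n => l.toReal j).comp ih

/-! ### Upper bound on the risk of the iteration -/

lemma snr_mono {p n : ℕ} {x y : ℝ} (hx : 0 < x) (hxy : x ≤ y) : snr p n 1 x ≤ snr p n 1 y := by
  have hc : (0 : ℝ) ≤ p / n := by positivity
  have hxy2 : x ^ 2 ≤ y ^ 2 := pow_le_pow_left₀ hx.le hxy 2
  have hx2 : 0 < x ^ 2 := by positivity
  simp only [snr, one_pow, div_one]
  set c : ℝ := p / n
  set a := x ^ 2
  set b := y ^ 2
  have hb : 0 < b := hx2.trans_le hxy2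
  rw [div_le_div_iff₀ (Real.sqrt_pos.2 (by linarith)) (Real.sqrt_pos.2 (by linarith))]
  rw [← Real.sqrt_sq hx2.le, ← Real.sqrt_sq hb.le, ← Real.sqrt_mul (by positivity),
    ← Real.sqrt_mul (by positivity), Real.sqrt_sq hx2.le, Real.sqrt_sq hb.le]
  refine Real.sqrt_le_sqrt ?_
  nlinarith [mul_nonneg (mul_nonneg hx2.le hb.le) (sub_nonneg.2 hxy2),
    mul_nonneg hc (mul_nonneg (sub_nonneg.2 hxy2) (add_pos hx2 hb).le)]

lemma snr_pos {p n : ℕ} {x : ℝ} (hx : 0 < x) : 0 < snr p n 1 x := by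
  simp only [snr, one_pow, div_one]
  positivity

lemma snr_sq {p n : ℕ} (x : ℝ) : snr p n 1 x ^ 2 = (x ^ 2) ^ 2 / (x ^ 2 + p / n) := by
  simp only [snr, one_pow, div_one]
  rw [div_pow, Real.sq_sqrt (by positivity)]

/-- Non-asymptotic bound on the risk of `k` iterations started from a spectral estimator. The three
terms come from the weak places, from the geometric convergence, and from the exceptional event for
the operator norm of the noise. -/
lemma maxRisk_lloyd_le {p n : ℕ} (hn : 4 ≤ n) {Δ δ : ℝ} (hΔ : 0 < Δ) (hδ : 0 < δ) (hδ1 : δ ≤ 1)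
    (hr : 5568 / δ ≤ snr p n 1 Δ) {f : Data p n → Labels n} (hf : IsSpectralEstimator f) (k : ℕ) :
    maxRisk 1 Δ (lloyd f k)
      ≤ ENNReal.ofReal (36 / δ * (n * Real.exp (-((1 - δ) ^ 2 / 2
          * ((n - 4) / n * snr p n 1 Δ ^ 2))))
        + 2 * n * (1 / 4) ^ k + 10 * n * Real.exp (-n)) := by
  have hn4 : (4 : ℝ) ≤ n := by exact_mod_cast hn
  have hn0 : (0 : ℝ) < n := by linarith
  refine iSup₂_le fun ω hω => ?_
  obtain ⟨θ', η⟩ := ω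
  have hθΔ : Δ ≤ ‖θ'‖ := hω
  set θ : Fin p → ℝ := θ'.ofLp with hθdef
  have hs : θ ⬝ᵥ θ = ‖θ'‖ ^ 2 := (norm_toLp_sq θ).symm
  have hrr := hr.trans (snr_mono (p := p) (n := n) hΔ hθΔ)
  have hθ0 : 0 < ‖θ'‖ := hΔ.trans_le hθΔ
  have hr2 : snr p n 1 ‖θ'‖ ^ 2 = (θ ⬝ᵥ θ) ^ 2 / (θ ⬝ᵥ θ + p / n) := by rw [snr_sq, hs]
  have hs0 : 0 < θ ⬝ᵥ θ := by rw [hs]; positivity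
  have hr1 : snr p n 1 ‖θ'‖ = (θ ⬝ᵥ θ) / √(θ ⬝ᵥ θ + p / n) := by simp [snr, hs]
  have hmono : snr p n 1 Δ ^ 2 ≤ snr p n 1 ‖θ'‖ ^ 2 :=
    pow_le_pow_left₀ (snr_pos hΔ).le (snr_mono hΔ hθΔ) 2
  set s := θ ⬝ᵥ θ with hsdef
  set r := snr p n 1 ‖θ'‖ with hrdef
  have hpn : (0 : ℝ) ≤ p / n := by positivity
  have h5568 : (5568 : ℝ) ≤ 5568 / δ := by rw [le_div_iff₀ hδ]; nlinarith
  have hs1 : 1 ≤ s := by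
    have h1 : r ^ 2 ≤ s := by
      rw [hr2, div_le_iff₀ (by linarith)]
      nlinarith [mul_nonneg hs0.le hpn]
    nlinarith
  set M : Data p n → Matrix (Fin n) (Fin n) ℝ := fun ξ =>
    hollow (gram fun i a => η.toReal i * θ a + ξ i a) with hM
  set W : Data p n → ℕ := fun ξ => (weakPlaces (M ξ) η (δ * (n - 1) * s)).card with hW
  set B : Set (Data p n) := {ξ | 348 * n * √(s + p / n) < ‖M ξ - s • signalMatrix η‖} with hB
  have hpt : ∀ ξ : Data p n, (loss (lloyd f k fun i a => η.toReal i * θ' a + 1 * ξ i a) η : ℝ≥0∞)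
      ≤ ENNReal.ofReal (36 / δ) * (W ξ : ℝ≥0∞) + ENNReal.ofReal (2 * n * (1 / 4) ^ k)
        + ENNReal.ofReal (2 * n) * B.indicator 1 ξ := by
    intro ξ
    have hY : (fun i a => η.toReal i * θ' a + 1 * ξ i a) = fun i a => η.toReal i * θ a + ξ i a := by
      ext i a; rw [one_mul]
    rw [hY]
    set L := loss (lloyd f k fun i a => η.toReal i * θ a + ξ i a) η with hL
    have hL2 : (L : ℝ) ≤ 2 * n := by exact_mod_cast loss_le _ _
    by_cases hξ : ξ ∈ B
    · rw [Set.indicator_of_mem hξ, Pi.one_apply, mul_one]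
      refine le_add_left ?_
      rw [← ENNReal.ofReal_natCast]
      exact ENNReal.ofReal_le_ofReal hL2
    · rw [Set.indicator_of_notMem hξ, mul_zero, add_zero, ← ENNReal.ofReal_natCast,
        ← ENNReal.ofReal_natCast, ← ENNReal.ofReal_mul (by positivity),
        ← ENNReal.ofReal_add (by positivity) (by positivity)]
      refine ENNReal.ofReal_le_ofReal ?_
      have hW0 : (0 : ℝ) ≤ W ξ := Nat.cast_nonneg _
      by_cases hWξ : (W ξ : ℝ) ≤ δ * n / 16
      · have hZ : ‖M ξ - s • signalMatrix η‖ ≤ 348 / r * n * s := by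
          have h1 : 348 / r * n * s = 348 * n * √(s + p / n) := by
            rw [hr1]
            have : 0 < √(s + p / n) := Real.sqrt_pos.2 (by linarith)
            field_simp
          rw [h1]
          exact not_lt.1 hξ
        have hκ : 348 / r ≤ δ / 16 := by
          have : 0 < r := lt_of_lt_of_le (by positivity) hrr
          rw [div_le_div_iff₀ this (by norm_num)]
          rw [div_le_iff₀ hδ] at hrr
          linarith
        have h1 := loss_lloyd_le (by omega) hf hs0 hδ hδ1 hκ hZ hWξ k
        have h2 : 4 * (W ξ : ℝ) ≤ 36 / δ * W ξ := by
          gcongr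
          rw [le_div_iff₀ hδ]; linarith
        linarith
      · have h1 : 2 * (n : ℝ) ≤ 36 / δ * W ξ := by
          rw [div_mul_eq_mul_div, le_div_iff₀ hδ]
          linarith [not_le.1 hWξ]
        have h2 : (0 : ℝ) ≤ 2 * n * (1 / 4) ^ k := by positivity
        linarith
  rw [lintegral_loss_law 1 θ' η (measurable_lloyd hf.1 k)]
  have hWm : Measurable fun ξ => (W ξ : ℝ≥0∞) := by
    have hmeas : ∀ i, Measurable fun ξ : Data p n => η.toReal i * (M ξ *ᵥ η.toReal) i := by
      intro i
      simp only [hM, vote_eq]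
      refine Continuous.measurable ?_
      unfold dotProduct; fun_prop
    simp only [hW, weakPlaces, Finset.card_filter]
    push_cast
    exact Finset.measurable_sum _ fun i _ => Measurable.ite
      (measurableSet_le (hmeas i) measurable_const) measurable_const measurable_const
  refine (lintegral_mono hpt).trans ?_
  rw [lintegral_add_left ((hWm.const_mul _).add_const _), lintegral_add_left (hWm.const_mul _),
    lintegral_const_mul _ hWm, lintegral_const, measure_univ, mul_one,
    lintegral_const_mul' _ _ ENNReal.ofReal_ne_top]
  have h1 := lintegral_card_weakPlaces_le hn θ hs0 η hδ.le hδ1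
  rw [← hr2] at h1
  have h2 : ∫⁻ ξ, B.indicator 1 ξ ∂noise p n ≤ ENNReal.ofReal (5 * Real.exp (-n)) :=
    (lintegral_indicator_one_le B).trans (noise_hollow_gram_norm (by omega) θ hs1 η)
  have h3 : ENNReal.ofReal (Real.exp (-((1 - δ) ^ 2 / 2 * ((n - 4) / n * r ^ 2))))
      ≤ ENNReal.ofReal (Real.exp (-((1 - δ) ^ 2 / 2 * ((n - 4) / n * snr p n 1 Δ ^ 2)))) := by
    have : (0 : ℝ) ≤ n - 4 := by linarith
    refine ENNReal.ofReal_le_ofReal (Real.exp_le_exp.2 (neg_le_neg ?_))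
    gcongr
  calc _ ≤ ENNReal.ofReal (36 / δ) * (n * ENNReal.ofReal
          (Real.exp (-((1 - δ) ^ 2 / 2 * ((n - 4) / n * snr p n 1 Δ ^ 2)))))
        + ENNReal.ofReal (2 * n * (1 / 4) ^ k)
        + ENNReal.ofReal (2 * n) * ENNReal.ofReal (5 * Real.exp (-n)) := by
        gcongr
        exact h1.trans (by gcongr)
    _ = _ := by
        rw [← ENNReal.ofReal_natCast, ← ENNReal.ofReal_mul (by positivity),
          ← ENNReal.ofReal_mul (by positivity), ← ENNReal.ofReal_mul (by positivity),
          ← ENNReal.ofReal_add (by positivity) (by positivity),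
          ← ENNReal.ofReal_add (by positivity) (by positivity)]
        congr 1
        ring

end

/-! ### From testing one label to the risk -/

/-- The label vector with the label at place `i` reversed. -/
def flip {n : ℕ} (i : Fin n) (η : Labels n) : Labels n := Function.update η i (-η i)

lemma flip_flip {n : ℕ} (i : Fin n) (η : Labels n) : flip i (flip i η) = η := by
  simp [flip]

/-- The loss dominates, up to the factor `n`, the number of pairs of places at which the products of
labels disagree; unlike single labels, these products are not affected by a global sign. -/
lemma sum_pairs_le_loss {n : ℕ} (x y : Labels n) :
    ∑ i, ∑ j, (if x i * x j ≠ y i * y j then 1 else 0) ≤ n * loss x y := by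
  have key : ∀ ν : Labels n, (∀ i j, ν i * ν j = y i * y j) →
      ∑ i, ∑ j, (if x i * x j ≠ y i * y j then 1 else 0) ≤ n * hammingLoss x ν := by
    intro ν hν
    have h1 : ∀ i j, (if x i * x j ≠ y i * y j then 1 else 0)
        ≤ (if x i ≠ ν i then 1 else 0) + (if x j ≠ ν j then 1 else 0) := by
      intro i j
      rw [← hν]
      by_cases hi : x i = ν i <;> by_cases hj : x j = ν j <;> simp [hi, hj]
      split_ifs <;> omega
    refine (Finset.sum_le_sum fun i _ => Finset.sum_le_sum fun j _ => h1 i j).trans (le_of_eq ?_)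
    simp only [Finset.sum_add_distrib, Finset.sum_const, Finset.card_univ, Fintype.card_fin,
      smul_eq_mul, ← Finset.mul_sum]
    rw [hammingLoss_eq, hammingDist, Finset.card_filter]
    ring
  rcases min_choice (hammingLoss x y) (hammingLoss x (-y)) with h | h <;> rw [loss, h]
  · exact key y fun _ _ => rfl
  · exact key (-y) fun i j => by simp

/-- If no test can tell `Q η` from `Q (flip i η)` with total error below `τ`, then the average over
`η` of the expected loss is at least `(n - 1) τ / 2`. -/
lemma mul_testError_le_of_risk_le {p n : ℕ} {Q : Labels n → Measure (Data p n)} {τ R : ℝ≥0∞}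
    (hQ : ∀ η i (A : Set (Data p n)), MeasurableSet A → τ ≤ Q η A + Q (flip i η) Aᶜ)
    {f : Data p n → Labels n} (hf : Measurable f)
    (hR : ∀ η, ∫⁻ Y, (loss (f Y) η : ℝ≥0∞) ∂Q η ≤ R) : ((n - 1 : ℕ) : ℝ≥0∞) * τ ≤ 2 * R := by
  rcases Nat.eq_zero_or_pos n with rfl | hn
  · simp
  set B : Labels n → Fin n → Fin n → Set (Data p n) := fun η i j =>
    {Y | f Y i * f Y j ≠ η i * η j} with hB
  have hBm : ∀ η i j, MeasurableSet (B η i j) := fun η i j =>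
    (measurable_labels_fun fun l : Labels n => l i * l j).comp hf
      (measurableSet_singleton (η i * η j)).compl
  have hloss : ∀ η, ∑ i, ∑ j, Q η (B η i j) ≤ n * R := by
    intro η
    calc ∑ i, ∑ j, Q η (B η i j)
        = ∫⁻ Y, ∑ i, ∑ j, (B η i j).indicator 1 Y ∂Q η := by
          rw [lintegral_finsetSum _ fun i _ => Finset.measurable_sum _ fun j _ =>
            measurable_one.indicator (hBm η i j)]
          refine Finset.sum_congr rfl fun i _ => ?_
          rw [lintegral_finsetSum _ fun j _ => measurable_one.indicator (hBm η i j)]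
          refine Finset.sum_congr rfl fun j _ => ?_
          rw [lintegral_indicator_one (hBm η i j)]
      _ ≤ ∫⁻ Y, n * (loss (f Y) η : ℝ≥0∞) ∂Q η := by
          refine lintegral_mono fun Y => ?_
          have h := sum_pairs_le_loss (f Y) η
          have h' : ((∑ i, ∑ j, (if f Y i * f Y j ≠ η i * η j then 1 else 0) : ℕ) : ℝ≥0∞)
              ≤ ((n * loss (f Y) η : ℕ) : ℝ≥0∞) := Nat.cast_le.2 h
          push_cast at h'
          refine le_trans (le_of_eq ?_) h'
          simp [hB, Set.indicator_apply]
      _ = n * ∫⁻ Y, (loss (f Y) η : ℝ≥0∞) ∂Q η :=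
          lintegral_const_mul' _ _ (ENNReal.natCast_ne_top n)
      _ ≤ _ := by gcongr; exact hR η
  have hpair : ∀ i j, j ≠ i → (Fintype.card (Labels n) : ℝ≥0∞) * τ ≤ 2 * ∑ η, Q η (B η i j) := by
    intro i j hji
    have h1 : ∑ η, Q (flip i η) (B (flip i η) i j) = ∑ η, Q η (B η i j) :=
      Equiv.sum_comp (Function.Involutive.toPerm (flip i) (flip_flip i)) fun η => Q η (B η i j)
    have h2 : ∀ η, B (flip i η) i j = (B η i j)ᶜ := by
      intro η
      ext Y
      simp only [hB, flip, Set.mem_ofPred_eq, Set.mem_compl_iff, Function.update_self,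
        Function.update_of_ne hji, not_not, neg_mul]
      rcases Int.units_eq_one_or (f Y i * f Y j) with h | h <;>
        rcases Int.units_eq_one_or (η i * η j) with h' | h' <;> rw [h, h'] <;> decide
    rw [two_mul]
    nth_rewrite 2 [← h1]
    rw [← Finset.sum_add_distrib, ← nsmul_eq_mul, ← Finset.card_univ, ← Finset.sum_const]
    refine Finset.sum_le_sum fun η _ => ?_
    rw [h2]
    exact hQ η i _ (hBm η i j)
  set C : ℝ≥0∞ := (Fintype.card (Labels n) : ℝ≥0∞) with hC
  have hC0 : C ≠ 0 := by rw [hC]; exact_mod_cast Fintype.card_ne_zero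
  have hCt : C ≠ ∞ := ENNReal.natCast_ne_top _
  have hn0 : (n : ℝ≥0∞) ≠ 0 := by exact_mod_cast hn.ne'
  have htotal : (C * n) * (((n - 1 : ℕ) : ℝ≥0∞) * τ) ≤ (C * n) * (2 * R) := by
    calc (C * n) * (((n - 1 : ℕ) : ℝ≥0∞) * τ)
        = ∑ i : Fin n, ∑ j ∈ Finset.univ.erase i, C * τ := by
          simp only [Finset.sum_const, Finset.card_erase_of_mem (Finset.mem_univ _),
            Finset.card_univ, Fintype.card_fin, nsmul_eq_mul]
          ring
      _ ≤ ∑ i : Fin n, ∑ j ∈ Finset.univ.erase i, 2 * ∑ η, Q η (B η i j) :=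
          Finset.sum_le_sum fun i _ => Finset.sum_le_sum fun j hj =>
            hpair i j (Finset.ne_of_mem_erase hj)
      _ ≤ ∑ i : Fin n, ∑ j, 2 * ∑ η, Q η (B η i j) :=
          Finset.sum_le_sum fun i _ => Finset.sum_le_sum_of_subset (Finset.erase_subset _ _)
      _ = 2 * ∑ η, ∑ i, ∑ j, Q η (B η i j) := by
          simp only [← Finset.mul_sum]
          congr 1
          rw [Finset.sum_comm]
          simp_rw [Finset.sum_comm (s := (Finset.univ : Finset (Labels n)))]
          rw [Finset.sum_comm]
      _ ≤ 2 * ∑ _η : Labels n, n * R := by gcongr with η; exact hloss η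
      _ = _ := by
          rw [Finset.sum_const, Finset.card_univ, nsmul_eq_mul, ← hC]
          ring
  exact (ENNReal.mul_le_mul_iff_right (mul_ne_zero hC0 hn0)
    (ENNReal.mul_ne_top hCt (ENNReal.natCast_ne_top n))).1 htotal

/-! ### Testing the label of one observation given the others -/

/-- Conditionally on `ω`, the observation at place `i` is Gaussian with mean `±x` and covariance
`c²`; on the event `‖x‖ ≤ c t` no test has total error below `Φᶜ(t)`. -/
lemma testError_update_ge {p n : ℕ} {Ω : Type*} [MeasurableSpace Ω] (P : Measure Ω)
    [IsProbabilityMeasure P] {U : Ω → Data p n} (hU : Measurable U) {x : Ω → Fin p → ℝ}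
    (hx : Measurable x) (i : Fin n) {c : ℝ} (hc : 0 < c) {t : ℝ} (ht : 0 ≤ t) {A : Set (Data p n)}
    (hA : MeasurableSet A) :
    P {ω | x ω ⬝ᵥ x ω ≤ (c * t) ^ 2} * gaussianTail t
      ≤ (P.prod (gaussVec p)) {z | Function.update (U z.1) i (x z.1 + c • z.2) ∈ A}
        + (P.prod (gaussVec p)) {z | Function.update (U z.1) i (-x z.1 + c • z.2) ∈ Aᶜ} := by
  have hupd : ∀ y : Ω × (Fin p → ℝ) → (Fin p → ℝ), Measurable y →
      Measurable fun z : Ω × (Fin p → ℝ) => Function.update (U z.1) i (y z) := by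
    intro y hy
    refine measurable_pi_iff.2 fun j => ?_
    by_cases hj : j = i
    · subst hj; simpa using hy
    · simp only [Function.update_of_ne hj]
      exact (measurable_pi_apply j).comp (hU.comp measurable_fst)
  have hxf : Measurable fun z : Ω × (Fin p → ℝ) => x z.1 := hx.comp measurable_fst
  have hcs : Measurable fun z : Ω × (Fin p → ℝ) => c • z.2 := measurable_snd.const_smul c
  have hm1 : MeasurableSet {z : Ω × (Fin p → ℝ) |
      Function.update (U z.1) i (x z.1 + c • z.2) ∈ A} := hupd _ (hxf.add hcs) hA
  have hm2 : MeasurableSet {z : Ω × (Fin p → ℝ) |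
      Function.update (U z.1) i (-x z.1 + c • z.2) ∈ Aᶜ} := hupd _ (hxf.neg.add hcs) hA.compl
  have hdot : Measurable fun ω => x ω ⬝ᵥ x ω :=
    (show Continuous fun y : Fin p → ℝ => y ⬝ᵥ y by unfold dotProduct; fun_prop).measurable.comp hx
  have hE : MeasurableSet {ω | x ω ⬝ᵥ x ω ≤ (c * t) ^ 2} := measurableSet_le hdot measurable_const
  rw [Measure.prod_apply hm1, Measure.prod_apply hm2, ← lintegral_add_left
    (measurable_measure_prodMk_left hm1), mul_comm, ← lintegral_indicator_const hE]
  refine lintegral_mono fun ω => ?_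
  by_cases hω : ω ∈ {ω | x ω ⬝ᵥ x ω ≤ (c * t) ^ 2}
  swap
  · rw [Set.indicator_of_notMem hω]
    exact zero_le
  rw [Set.indicator_of_mem hω]
  have hω' : x ω ⬝ᵥ x ω ≤ (c * t) ^ 2 := hω
  set y := c⁻¹ • x ω with hy
  have hcy : c • y = x ω := by rw [hy, smul_smul, mul_inv_cancel₀ hc.ne', one_smul]
  have hyy : y ⬝ᵥ y = c⁻¹ ^ 2 * (x ω ⬝ᵥ x ω) := by
    rw [hy, smul_dotProduct, dotProduct_smul, smul_eq_mul, smul_eq_mul]; ring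
  have hyt : y ⬝ᵥ y ≤ t ^ 2 := by
    rw [hyy, inv_pow, inv_mul_le_iff₀ (by positivity), ← mul_pow]
    exact hω'
  have hsq : √(y ⬝ᵥ y) ^ 2 = y ⬝ᵥ y := Real.sq_sqrt (by rw [← norm_toLp_sq]; positivity)
  have hst : √(y ⬝ᵥ y) ≤ t := Real.sqrt_le_iff.2 ⟨ht, hyt⟩
  have hA' : MeasurableSet {g : Fin p → ℝ | Function.update (U ω) i (c • g) ∈ A} := by
    have : Measurable fun g : Fin p → ℝ => Function.update (U ω) i (c • g) :=
      (measurable_update (U ω)).comp (measurable_const_smul c)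
    exact this hA
  calc gaussianTail t ≤ gaussianTail √(y ⬝ᵥ y) := measure_mono (Set.Ioi_subset_Ioi hst)
    _ ≤ _ := gaussianTail_le_testError y (Real.sqrt_nonneg _) hsq hA'
    _ = _ := by
      congr 2
      · ext g
        simp only [Set.mem_ofPred_eq, Set.mem_preimage, smul_add, hcy]
      · ext g
        simp only [Set.mem_ofPred_eq, Set.mem_preimage, smul_add, smul_neg, hcy, Set.mem_compl_iff]

lemma toReal_flip {n : ℕ} (i : Fin n) (η : Labels n) :
    (flip i η).toReal = Function.update η.toReal i (-η.toReal i) := by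
  ext j
  by_cases hj : j = i
  · subst hj; simp [flip, Labels.toReal]
  · simp [flip, Labels.toReal, hj]

/-- The quadratic form of `Function.update ξ i g`, in the coordinates used for Gaussian laws. -/
lemma update_single {p n : ℕ} (k i : Fin n) (a : Fin p) :
    Function.update (Pi.single k (Pi.single a 1) : Data p n) i 0
      = if k = i then 0 else Pi.single k (Pi.single a 1) := by
  split_ifs with h
  · subst h
    ext j b
    by_cases hj : j = k
    · subst hj; simp
    · simp [hj]
  · ext j b
    by_cases hj : j = i
    · subst hj; simp [Ne.symm h]
    · simp [hj]

/-- Replacing one noise vector by an independent copy does not change the law of the noise. -/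
lemma noise_prod_map_update (p : ℕ) {n : ℕ} (i : Fin n) :
    ((noise p n).prod (gaussVec p)).map (fun z => Function.update z.1 i z.2) = noise p n := by
  conv_rhs => rw [← Measure.map_id (μ := noise p n)]
  refine ((isCentredGaussian_noise p n).prod (isCentredGaussian_gaussVec p)).map_eq_map
    (isCentredGaussian_noise p n) ?_ ⟨fun _ _ => rfl, fun _ _ => rfl⟩ ?_
  · constructor
    · intro z w
      simp only [Prod.fst_add, Prod.snd_add]
      ext j b
      by_cases hj : j = i
      · subst hj; simp
      · simp [hj]
    · intro c z
      simp only [Prod.smul_fst, Prod.smul_snd]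
      ext j b
      by_cases hj : j = i
      · subst hj; simp
      · simp [hj]
  · intro L
    have h0 : ∀ a : Fin p, Function.update (0 : Data p n) i (Pi.single a 1)
        = Pi.single i (Pi.single a 1) := fun a => rfl
    simp only [ContinuousLinearMap.comp_apply, LinearMap.coe_toContinuousLinearMap',
      IsLinearMap.mk'_apply, ContinuousLinearMap.inl_apply, ContinuousLinearMap.inr_apply,
      update_single, h0, id]
    rw [← Finset.add_sum_erase _ _ (Finset.mem_univ i), ← Finset.add_sum_erase _ (fun k =>
      ∑ a, L (Pi.single k (Pi.single a 1)) ^ 2) (Finset.mem_univ i)]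
    have hne : ∀ k ∈ Finset.univ.erase i, (∑ a : Fin p,
        L (if k = i then 0 else Pi.single k (Pi.single a 1)) ^ 2)
        = ∑ a : Fin p, L (Pi.single k (Pi.single a 1)) ^ 2 := fun k hk => by
      simp only [if_neg (Finset.ne_of_mem_erase hk)]
    rw [Finset.sum_congr rfl hne]
    simp only [if_true, map_zero, zero_pow two_ne_zero, Finset.sum_const_zero, zero_add]
    rw [add_comm]

/-- Testing one label when the centre `θ` is known. -/
lemma testError_law_ge {p n : ℕ} (θ : EuclideanSpace ℝ (Fin p)) (η : Labels n) (i : Fin n)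
    {A : Set (Data p n)} (hA : MeasurableSet A) :
    gaussianTail ‖θ‖ ≤ law 1 θ η A + law 1 θ (flip i η) Aᶜ := by
  set U : Data p n → Data p n := fun ξ j a => η.toReal j * θ a + ξ j a with hU
  have hlaw : ∀ (η' : Labels n), (∀ j, j ≠ i → η'.toReal j = η.toReal j) →
      ∀ {B : Set (Data p n)}, MeasurableSet B → law 1 θ η' B
        = ((noise p n).prod (gaussVec p))
          {z | Function.update (U z.1) i (η'.toReal i • θ.ofLp + (1 : ℝ) • z.2) ∈ B} := by
    intro η' hη' B hB
    rw [law, Measure.map_apply (measurable_obs 1 θ.ofLp η') hB]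
    conv_lhs => rw [← noise_prod_map_update p i]
    rw [Measure.map_apply ?_ (measurable_obs 1 θ.ofLp η' hB)]
    · congr 1
      ext z
      simp only [Set.mem_preimage, Set.mem_ofPred_eq]
      have : (fun j a => η'.toReal j * θ a + 1 * Function.update z.1 i z.2 j a)
          = Function.update (U z.1) i (η'.toReal i • θ.ofLp + (1 : ℝ) • z.2) := by
        ext j a
        by_cases hj : j = i
        · subst hj; simp
        · simp [hj, hU, hη' j hj]
      rw [this]
    · refine measurable_pi_iff.2 fun j => ?_
      by_cases hj : j = i
      · subst hj; simpa using measurable_snd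
      · simp only [Function.update_of_ne hj]
        exact (measurable_pi_apply j).comp measurable_fst
  have hflip : (flip i η).toReal i = -η.toReal i := by rw [toReal_flip]; simp
  have h := testError_update_ge (noise p n) (U := U) (by fun_prop)
    (x := fun _ => η.toReal i • θ.ofLp) measurable_const i one_pos (norm_nonneg θ) hA
  rw [hlaw η (fun _ _ => rfl) hA,
    hlaw (flip i η) (fun j hj => by rw [toReal_flip, Function.update_of_ne hj]) hA.compl, hflip]
  simp only [neg_smul]
  refine le_trans (le_of_eq ?_) h
  have h1 : (η.toReal i • θ.ofLp) ⬝ᵥ (η.toReal i • θ.ofLp) ≤ (1 * ‖θ‖) ^ 2 := by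
    rw [smul_dotProduct, dotProduct_smul, smul_eq_mul, smul_eq_mul, ← mul_assoc, ← sq,
      Labels.toReal_sq, ← norm_toLp_sq, one_mul, one_mul]
  rw [show {ω : Data p n | (η.toReal i • θ.ofLp) ⬝ᵥ (η.toReal i • θ.ofLp) ≤ (1 * ‖θ‖) ^ 2}
    = Set.univ from Set.eq_univ_of_forall fun _ => h1, measure_univ, one_mul]

/-! ### A Gaussian centre -/

/-- The observations with labels `η`, noise `z.1` and centre `a • z.2`. -/
def randomCentreObs {p n : ℕ} (a : ℝ) (η : Labels n) (z : Data p n × (Fin p → ℝ)) : Data p n :=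
  fun j => (η.toReal j * a) • z.2 + z.1 j

/-- The regression of the centre on the observations at the places other than `i`, when `k` is the
regression coefficient. -/
def centreRegression {p n : ℕ} (a k : ℝ) (η : Labels n) (i : Fin n)
    (z : Data p n × (Fin p → ℝ)) : Fin p → ℝ :=
  k • ∑ j ∈ Finset.univ.erase i, (a • z.2 + η.toReal j • z.1 j)

lemma isLinearMap_randomCentreObs {p n : ℕ} (a : ℝ) (η : Labels n) :
    IsLinearMap ℝ (randomCentreObs (p := p) a η) := by
  constructor
  · intro z w; ext j b; simp [randomCentreObs]; ring
  · intro c z; ext j b; simp [randomCentreObs]; ring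

lemma isLinearMap_centreRegression {p n : ℕ} (a k : ℝ) (η : Labels n) (i : Fin n) :
    IsLinearMap ℝ (centreRegression (p := p) a k η i) := by
  constructor
  · intro z w
    simp only [centreRegression, Prod.fst_add, Prod.snd_add, Pi.add_apply, smul_add,
      Finset.sum_add_distrib]
    abel
  · intro c z
    simp only [centreRegression, Prod.smul_fst, Prod.smul_snd, Pi.smul_apply, smul_comm _ c,
      ← smul_add, ← Finset.smul_sum]

lemma centreRegression_single_noise {p n : ℕ} (a k : ℝ) (η : Labels n) (i l : Fin n)
    (v : Fin p → ℝ) : centreRegression a k η i (Pi.single l v, 0)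
      = if l = i then 0 else (k * η.toReal l) • v := by
  simp only [centreRegression, smul_zero, zero_add]
  split_ifs with h
  · subst h
    rw [Finset.sum_eq_zero, smul_zero]
    intro j hj
    simp [Finset.ne_of_mem_erase hj]
  · rw [Finset.sum_eq_single l]
    · simp [smul_smul]
    · intro j _ hj; simp [hj]
    · simp [h]

lemma centreRegression_centre {p n : ℕ} (a k : ℝ) (η : Labels n) (i : Fin n)
    (v : Fin p → ℝ) : centreRegression a k η i ((0 : Data p n), v)
      = (k * ((n - 1) * a)) • v := by
  have : 1 ≤ n := i.pos
  simp only [centreRegression, Pi.zero_apply, smul_zero, add_zero, Finset.sum_const,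
    Finset.card_erase_of_mem (Finset.mem_univ i), Finset.card_univ, Fintype.card_fin]
  rw [← Nat.cast_smul_eq_nsmul ℝ, smul_smul, smul_smul]
  push_cast [this]
  rw [mul_assoc]

lemma continuousLinearMap_update {p n : ℕ} (L : StrongDual ℝ (Data p n)) (U : Data p n) (i : Fin n)
    (y : Fin p → ℝ) : L (Function.update U i y)
      = ∑ j ∈ Finset.univ.erase i, L (Pi.single j (U j)) + L (Pi.single i y) := by
  conv_lhs => rw [← Finset.univ_sum_single (Function.update U i y), map_sum]
  rw [← Finset.sum_erase_add _ _ (Finset.mem_univ i), Function.update_self]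
  congr 1
  refine Finset.sum_congr rfl fun j hj => ?_
  rw [Function.update_of_ne (Finset.ne_of_mem_erase hj)]

lemma continuousLinearMap_single_smul {p n : ℕ} (L : StrongDual ℝ (Data p n)) (i : Fin n)
    (r : ℝ) (y : Fin p → ℝ) : L (Pi.single i (r • y)) = r * L (Pi.single i y) := by
  rw [Pi.single_smul, map_smul, smul_eq_mul]

/-- Conditional law of the observation at place `i` given the others: it is Gaussian, its mean is
the regression of the centre multiplied by the label, and its covariance is `1 + k`. -/
lemma randomCentreObs_map_eq {p n : ℕ} {a k c : ℝ} (hk : k * (1 + (n - 1) * a ^ 2) = a ^ 2)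
    (hc : c ^ 2 = 1 + k) (η : Labels n) (i : Fin n) :
    ((noise p n).prod (gaussVec p)).map (randomCentreObs a η)
      = (((noise p n).prod (gaussVec p)).prod (gaussVec p)).map (fun w =>
        Function.update (randomCentreObs a η w.1) i
          (η.toReal i • centreRegression a k η i w.1 + c • w.2)) := by
  have hG := (isCentredGaussian_noise p n).prod (isCentredGaussian_gaussVec p)
  have hO := isLinearMap_randomCentreObs (p := p) a η
  have hC := isLinearMap_centreRegression (p := p) a k η i
  refine hG.map_eq_map (hG.prod (isCentredGaussian_gaussVec p)) hO ?_ ?_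
  · constructor
    · intro z w
      rw [Prod.fst_add, Prod.snd_add, hO.map_add, hC.map_add]
      ext j b
      by_cases hj : j = i
      · subst hj; simp; ring
      · simp [hj]
    · intro r z
      rw [Prod.smul_fst, Prod.smul_snd, hO.map_smul, hC.map_smul]
      ext j b
      by_cases hj : j = i
      · subst hj; simp; ring
      · simp [hj]
  · intro L
    simp only [ContinuousLinearMap.comp_apply, LinearMap.coe_toContinuousLinearMap',
      IsLinearMap.mk'_apply, ContinuousLinearMap.inl_apply, ContinuousLinearMap.inr_apply,
      continuousLinearMap_update, centreRegression_single_noise, centreRegression_centre,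
      hC.map_zero, smul_zero, add_zero, zero_add]
    set e := η.toReal with he
    have he2 : ∀ j, e j ^ 2 = 1 := Labels.toReal_sq η
    set l : Fin n → Fin p → ℝ := fun j b => L (Pi.single j (Pi.single b 1)) with hl
    have h1 : ∀ (m : Fin n) (b : Fin p),
        L (randomCentreObs a η (Pi.single m (Pi.single b 1), 0)) = l m b := by
      intro m b
      have h : randomCentreObs a η ((Pi.single m (Pi.single b 1) : Data p n), 0)
          = Pi.single m (Pi.single b 1) := by
        ext j b'
        simp [randomCentreObs]
      rw [h]
    have h2 : ∀ b : Fin p, L (randomCentreObs a η ((0 : Data p n), Pi.single b 1))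
        = a * (∑ j ∈ Finset.univ.erase i, e j * l j b + e i * l i b) := by
      intro b
      rw [← Finset.univ_sum_single (randomCentreObs a η ((0 : Data p n), Pi.single b 1)), map_sum,
        ← Finset.sum_erase_add _ _ (Finset.mem_univ i), mul_add, Finset.mul_sum]
      simp only [randomCentreObs, Pi.zero_apply, add_zero, continuousLinearMap_single_smul]
      congr 1
      · exact Finset.sum_congr rfl fun j _ => by ring
      · ring
    have h3 : ∀ (m : Fin n) (b : Fin p), ∑ j ∈ Finset.univ.erase i,
        L (Pi.single j (randomCentreObs a η (Pi.single m (Pi.single b 1), 0) j))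
        = if m = i then 0 else l m b := by
      intro m b
      simp only [randomCentreObs, smul_zero, zero_add]
      split_ifs with h
      · subst h
        refine Finset.sum_eq_zero fun j hj => ?_
        simp [Finset.ne_of_mem_erase hj]
      · rw [Finset.sum_eq_single m]
        · simp [hl]
        · intro j _ hj; simp [hj]
        · simp [h]
    have h4 : ∀ b : Fin p, ∑ j ∈ Finset.univ.erase i,
        L (Pi.single j (randomCentreObs a η ((0 : Data p n), Pi.single b 1) j))
        = a * ∑ j ∈ Finset.univ.erase i, e j * l j b := by
      intro b
      rw [Finset.mul_sum]
      refine Finset.sum_congr rfl fun j _ => ?_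
      simp only [randomCentreObs, Pi.zero_apply, add_zero, continuousLinearMap_single_smul]
      ring
    have h5 : ∀ (m : Fin n) (b : Fin p),
        L (Pi.single i (e i • if m = i then (0 : Fin p → ℝ) else (k * e m) • Pi.single b 1))
        = if m = i then 0 else e i * k * e m * l i b := by
      intro m b
      split_ifs
      · simp
      · rw [continuousLinearMap_single_smul, continuousLinearMap_single_smul]; ring
    have h0 : randomCentreObs a η (0 : Data p n × (Fin p → ℝ)) = 0 := hO.map_zero
    simp only [h1, h2, h3, h4, h5, h0, Pi.zero_apply, Pi.single_zero, map_zero,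
      zero_add, Finset.sum_const_zero, continuousLinearMap_single_smul]
    rw [Finset.sum_comm]
    conv_rhs => rw [Finset.sum_comm]
    simp only [← Finset.sum_add_distrib]
    refine Finset.sum_congr rfl fun b _ => ?_
    change ∑ m, l m b ^ 2 + _ = _
    rw [← Finset.sum_erase_add _ _ (Finset.mem_univ i),
      ← Finset.sum_erase_add _ (fun m => ((if m = i then 0 else l m b)
        + if m = i then 0 else e i * k * e m * l i b) ^ 2) (Finset.mem_univ i)]
    have h6 : ∑ m ∈ Finset.univ.erase i, ((if m = i then 0 else l m b)
        + if m = i then 0 else e i * k * e m * l i b) ^ 2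
        = ∑ m ∈ Finset.univ.erase i, l m b ^ 2
          + 2 * e i * k * l i b * ∑ m ∈ Finset.univ.erase i, e m * l m b
          + (n - 1) * (k * l i b) ^ 2 := by
      have hcard : ((n : ℝ) - 1) * (k * l i b) ^ 2
          = ∑ m ∈ Finset.univ.erase i, (k * l i b) ^ 2 := by
        have : 1 ≤ n := i.pos
        rw [Finset.sum_const, Finset.card_erase_of_mem (Finset.mem_univ i), nsmul_eq_mul]
        simp [this]
      rw [hcard, Finset.mul_sum, ← Finset.sum_add_distrib, ← Finset.sum_add_distrib]
      refine Finset.sum_congr rfl fun m hm => ?_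
      rw [if_neg (Finset.ne_of_mem_erase hm), if_neg (Finset.ne_of_mem_erase hm)]
      linear_combination (k * l i b) ^ 2 * (e m ^ 2 * he2 i + he2 m)
    rw [h6]
    change _ + (a * (_ + e i * l i b)) ^ 2 = _ + (_ + e i * (_ * l i b)) ^ 2 + (c * l i b) ^ 2
    rw [mul_pow c, hc]
    simp only [if_true]
    set S := ∑ m ∈ Finset.univ.erase i, e m * l m b
    linear_combination (-2 * e i * l i b * S - l i b ^ 2 * (1 + k * (n - 1))) * hk
      + (a ^ 2 * l i b ^ 2 - (k * (n - 1) * a * l i b) ^ 2) * he2 i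

lemma centreRegression_map_eq {p n : ℕ} (a k : ℝ) (η : Labels n) (i : Fin n) {v : ℝ}
    (hv : v ^ 2 = k ^ 2 * ((n - 1) * (1 + (n - 1) * a ^ 2))) :
    ((noise p n).prod (gaussVec p)).map (centreRegression a k η i)
      = (gaussVec p).map (fun g => v • g) := by
  refine ((isCentredGaussian_noise p n).prod (isCentredGaussian_gaussVec p)).map_eq_map
    (isCentredGaussian_gaussVec p) (isLinearMap_centreRegression a k η i) ?_ ?_
  · constructor
    · intro ξ ζ; simp
    · intro c ξ; simp [smul_comm c]
  · intro L
    simp only [ContinuousLinearMap.comp_apply, LinearMap.coe_toContinuousLinearMap',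
      IsLinearMap.mk'_apply, ContinuousLinearMap.inl_apply, ContinuousLinearMap.inr_apply,
      centreRegression_single_noise, centreRegression_centre, map_smul, smul_eq_mul, mul_pow,
      ← Finset.mul_sum, hv]
    rw [← Finset.sum_erase_add _ _ (Finset.mem_univ i)]
    have h1 : ∀ m ∈ Finset.univ.erase i, ∑ b : Fin p, L (if m = i then 0 else
        (k * η.toReal m) • Pi.single b 1) ^ 2 = k ^ 2 * ∑ b : Fin p, L (Pi.single b 1) ^ 2 := by
      intro m hm
      simp only [if_neg (Finset.ne_of_mem_erase hm), map_smul, smul_eq_mul, mul_pow,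
        Labels.toReal_sq, mul_one, ← Finset.mul_sum]
    rw [Finset.sum_congr rfl h1]
    have : 1 ≤ n := i.pos
    simp [Finset.card_erase_of_mem (Finset.mem_univ i), this]
    ring

lemma measurable_randomCentreObs {p n : ℕ} (a : ℝ) (η : Labels n) :
    Measurable (randomCentreObs (p := p) a η) := by unfold randomCentreObs; fun_prop

lemma measurable_centreRegression {p n : ℕ} (a k : ℝ) (η : Labels n) (i : Fin n) :
    Measurable (centreRegression (p := p) a k η i) := by unfold centreRegression; fun_prop

/-- Testing one label when the centre is Gaussian with covariance `a²`. The constant in front is a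
lower bound for the probability that a chi-square variable does not exceed its mean by a factor
`1 + δ`. -/
lemma testError_randomCentre_ge {p n : ℕ} (hn : 2 ≤ n) (hp : 1 ≤ p) {a δ t : ℝ} (ha : 0 < a)
    (hδ : 0 < δ) (hδ1 : δ ≤ 1) (ht : 0 ≤ t)
    (hat : (1 + δ) * p * ((n - 1) * a ^ 4) ≤ t ^ 2 * (1 + n * a ^ 2)) (η : Labels n) (i : Fin n)
    {A : Set (Data p n)} (hA : MeasurableSet A) :
    ENNReal.ofReal (1 - Real.exp (-(δ ^ 2 / 16))) * gaussianTail t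
      ≤ ((noise p n).prod (gaussVec p)).map (randomCentreObs a η) A
        + ((noise p n).prod (gaussVec p)).map (randomCentreObs a (flip i η)) Aᶜ := by
  have hn2 : (2 : ℝ) ≤ n := by exact_mod_cast hn
  have hp1 : (1 : ℝ) ≤ p := by exact_mod_cast hp
  set m : ℝ := n - 1 with hm
  have hm1 : 1 ≤ m := by linarith
  have hD : 0 < 1 + m * a ^ 2 := by positivity
  set k := a ^ 2 / (1 + m * a ^ 2) with hk
  have hkD : k * (1 + m * a ^ 2) = a ^ 2 := by rw [hk]; field_simp
  have hk0 : 0 < k := by positivity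
  set c := √(1 + k) with hcdef
  have hc2 : c ^ 2 = 1 + k := Real.sq_sqrt (by positivity)
  have hc0 : 0 < c := Real.sqrt_pos.2 (by positivity)
  set v := √(k ^ 2 * (m * (1 + m * a ^ 2))) with hvdef
  have hv2 : v ^ 2 = k ^ 2 * (m * (1 + m * a ^ 2)) := Real.sq_sqrt (by positivity)
  have hv0 : 0 < v ^ 2 := by rw [hv2]; positivity
  set P := (noise p n).prod (gaussVec p) with hP
  have hreg : ∀ ζ : Labels n, Measurable fun z : Data p n × (Fin p → ℝ) =>
      ζ.toReal i • centreRegression a k ζ i z := by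
    intro ζ
    unfold centreRegression
    fun_prop
  have hreg' : ∀ ζ : Labels n, Measurable fun w : (Data p n × (Fin p → ℝ)) × (Fin p → ℝ) =>
      ζ.toReal i • centreRegression a k ζ i w.1 + c • w.2 := by
    intro ζ
    unfold centreRegression
    fun_prop
  have hupd : Measurable fun w : (Data p n × (Fin p → ℝ)) × (Fin p → ℝ) =>
      Function.update (randomCentreObs a η w.1) i
        (η.toReal i • centreRegression a k η i w.1 + c • w.2) := by
    refine measurable_pi_iff.2 fun j => ?_
    by_cases hj : j = i
    · subst hj
      simp only [Function.update_self]
      exact hreg' η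
    · simp only [Function.update_of_ne hj]
      exact (measurable_pi_apply j).comp ((measurable_randomCentreObs a η).comp measurable_fst)
  have hupd' : Measurable fun w : (Data p n × (Fin p → ℝ)) × (Fin p → ℝ) =>
      Function.update (randomCentreObs a (flip i η) w.1) i
        ((flip i η).toReal i • centreRegression a k (flip i η) i w.1 + c • w.2) := by
    refine measurable_pi_iff.2 fun j => ?_
    by_cases hj : j = i
    · subst hj
      simp only [Function.update_self]
      exact hreg' _
    · simp only [Function.update_of_ne hj]
      exact (measurable_pi_apply j).comp ((measurable_randomCentreObs a _).comp measurable_fst)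
  have htest := testError_update_ge P (measurable_randomCentreObs a η)
    (hreg η) i hc0 ht hA
  rw [randomCentreObs_map_eq hkD hc2 η i, randomCentreObs_map_eq hkD hc2 (flip i η) i,
    Measure.map_apply hupd hA, Measure.map_apply hupd' hA.compl]
  have hflip : ∀ w : (Data p n × (Fin p → ℝ)) × (Fin p → ℝ),
      Function.update (randomCentreObs a (flip i η) w.1) i
        ((flip i η).toReal i • centreRegression a k (flip i η) i w.1 + c • w.2)
      = Function.update (randomCentreObs a η w.1) i
        (-(η.toReal i • centreRegression a k η i w.1) + c • w.2) := by
    intro w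
    have h1 : centreRegression a k (flip i η) i w.1 = centreRegression a k η i w.1 := by
      simp only [centreRegression]
      congr 1
      refine Finset.sum_congr rfl fun j hj => ?_
      rw [toReal_flip, Function.update_of_ne (Finset.ne_of_mem_erase hj)]
    ext j b
    by_cases hj : j = i
    · subst hj; simp [h1, toReal_flip]
    · simp [hj, randomCentreObs, toReal_flip]
  simp only [hflip]
  refine le_trans ?_ htest
  gcongr
  -- The mean is short with positive probability.
  have hxx : ∀ z : Data p n × (Fin p → ℝ),
      (η.toReal i • centreRegression a k η i z) ⬝ᵥ (η.toReal i • centreRegression a k η i z)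
        = centreRegression a k η i z ⬝ᵥ centreRegression a k η i z := by
    intro z
    rw [smul_dotProduct, dotProduct_smul, smul_eq_mul, smul_eq_mul, ← mul_assoc, ← sq,
      Labels.toReal_sq, one_mul]
  have hcont : Continuous fun y : Fin p → ℝ => y ⬝ᵥ y := by unfold dotProduct; fun_prop
  have hSm : MeasurableSet {y : Fin p → ℝ | (c * t) ^ 2 < y ⬝ᵥ y} :=
    measurableSet_lt measurable_const hcont.measurable
  have hEm : MeasurableSet {z : Data p n × (Fin p → ℝ) | (η.toReal i • centreRegression a k η i z)
      ⬝ᵥ (η.toReal i • centreRegression a k η i z) ≤ (c * t) ^ 2} := by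
    simp only [hxx]
    exact measurableSet_le (hcont.measurable.comp (measurable_centreRegression a k η i))
      measurable_const
  have hcompl : P {z : Data p n × (Fin p → ℝ) | (η.toReal i • centreRegression a k η i z)
      ⬝ᵥ (η.toReal i • centreRegression a k η i z) ≤ (c * t) ^ 2}ᶜ
      ≤ ENNReal.ofReal (Real.exp (-(δ ^ 2 / 16))) := by
    calc _ = P.map (centreRegression a k η i) {y | (c * t) ^ 2 < y ⬝ᵥ y} := by
          rw [Measure.map_apply (measurable_centreRegression a k η i) hSm]
          congr 1
          ext z
          simp only [hxx, Set.mem_compl_iff, Set.mem_ofPred_eq, not_le, Set.mem_preimage]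
      _ = gaussVec p {g | (c * t) ^ 2 < (v • g) ⬝ᵥ (v • g)} := by
          rw [centreRegression_map_eq a k η i hv2, Measure.map_apply (by fun_prop) hSm]
          rfl
      _ ≤ gaussVec p {g | δ / 8 * (δ * p) ≤ δ / 8 * (∑ b, g b ^ 2 - p)} := by
          refine measure_mono fun g hg => ?_
          simp only [Set.mem_ofPred_eq] at hg ⊢
          have h1 : (v • g) ⬝ᵥ (v • g) = v ^ 2 * ∑ b, g b ^ 2 := by
            rw [smul_dotProduct, dotProduct_smul, smul_eq_mul, smul_eq_mul]
            simp only [dotProduct, ← sq]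
            ring
          have h2 : v ^ 2 * ((1 + δ) * p) ≤ (c * t) ^ 2 := by
            rw [hv2, mul_pow, hc2]
            have e1 : k ^ 2 * (m * (1 + m * a ^ 2)) = m * a ^ 4 / (1 + m * a ^ 2) := by
              rw [hk]; field_simp
            have e2 : 1 + k = (1 + n * a ^ 2) / (1 + m * a ^ 2) := by
              rw [hk, hm] at *; field_simp; ring
            rw [e1, e2, div_mul_eq_mul_div, div_mul_eq_mul_div]
            exact (div_le_div_iff_of_pos_right hD).2 (by linarith)
          rw [h1] at hg
          have h3 : (1 + δ) * p < ∑ b, g b ^ 2 := lt_of_mul_lt_mul_left (h2.trans_lt hg) hv0.le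
          gcongr
          linarith
      _ ≤ _ := gaussVec_chiSq_tail p (by linarith) _
      _ ≤ _ := by
          refine ENNReal.ofReal_le_ofReal (Real.exp_le_exp.2 ?_)
          nlinarith [sq_nonneg δ]
  rw [ENNReal.ofReal_sub _ (Real.exp_pos _).le, ENNReal.ofReal_one]
  refine tsub_le_iff_right.2 ?_
  rw [← prob_add_prob_compl (μ := P) hEm]
  gcongr

/-! ### Lower bounds for the maximal risk -/

lemma gaussianTail_antitone : Antitone gaussianTail := fun _ _ h =>
  measure_mono (Set.Ioi_subset_Ioi h)

lemma maxRisk_antitone {p n : ℕ} {σ Δ Δ' : ℝ} (h : Δ ≤ Δ') (f : Data p n → Labels n) :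
    maxRisk σ Δ' f ≤ maxRisk σ Δ f :=
  biSup_mono fun _ hω => le_trans h hω

lemma lintegral_loss_le_maxRisk {p n : ℕ} {σ Δ : ℝ} {θ : EuclideanSpace ℝ (Fin p)} (hθ : Δ ≤ ‖θ‖)
    (η : Labels n) (f : Data p n → Labels n) :
    ∫⁻ Y, (loss (f Y) η : ℝ≥0∞) ∂law σ θ η ≤ maxRisk σ Δ f :=
  le_iSup₂_of_le (f := fun (ω : EuclideanSpace ℝ (Fin p) × Labels n) (_ : ω ∈ paramSet p n Δ) =>
    ∫⁻ Y, (loss (f Y) ω.2 : ℝ≥0∞) ∂law σ ω.1 ω.2) (θ, η) hθ le_rfl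

/-- The bound obtained from a known centre of norm `Δ`. -/
lemma mul_gaussianTail_le_maxRisk {p n : ℕ} (hp : 1 ≤ p) {Δ : ℝ} (hΔ : 0 ≤ Δ)
    {f : Data p n → Labels n} (hf : Measurable f) :
    ((n - 1 : ℕ) : ℝ≥0∞) * gaussianTail Δ ≤ 2 * maxRisk 1 Δ f := by
  set θ : EuclideanSpace ℝ (Fin p) := EuclideanSpace.single ⟨0, hp⟩ Δ with hθ
  have hnorm : ‖θ‖ = Δ := by rw [hθ, PiLp.norm_single, Real.norm_of_nonneg hΔ]
  refine mul_testError_le_of_risk_le (Q := fun η => law 1 θ η) ?_ hf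
    fun η => lintegral_loss_le_maxRisk hnorm.ge η f
  intro η i A hA
  simpa only [hnorm] using testError_law_ge θ η i hA

/-- A Gaussian centre may fall outside of the parameter set; this costs at most the trivial bound
`2 n` on the loss. -/
lemma lintegral_loss_randomCentre_le {p n : ℕ} (a Δ : ℝ) (η : Labels n)
    {f : Data p n → Labels n} (hf : Measurable f) :
    ∫⁻ Y, (loss (f Y) η : ℝ≥0∞) ∂((noise p n).prod (gaussVec p)).map (randomCentreObs a η)
      ≤ maxRisk 1 Δ f + 2 * n * gaussVec p {g | ‖WithLp.toLp 2 (a • g)‖ < Δ} := by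
  have hm : Measurable fun Y : Data p n => (loss (f Y) η : ℝ≥0∞) :=
    (measurable_labels_fun fun l => (loss l η : ℝ≥0∞)).comp hf
  have hS : MeasurableSet {g : Fin p → ℝ | ‖WithLp.toLp 2 (a • g)‖ < Δ} := by
    have : Continuous fun g : Fin p → ℝ => ‖WithLp.toLp 2 (a • g)‖ := by fun_prop
    exact measurableSet_lt this.measurable measurable_const
  rw [lintegral_map hm (measurable_randomCentreObs a η),
    lintegral_prod_symm' (fun z => (loss (f (randomCentreObs a η z)) η : ℝ≥0∞))
      (hm.comp (measurable_randomCentreObs a η))]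
  have hpt : ∀ g : Fin p → ℝ, ∫⁻ ξ, (loss (f (randomCentreObs a η (ξ, g))) η : ℝ≥0∞) ∂noise p n
      ≤ maxRisk 1 Δ f
        + Set.indicator {g : Fin p → ℝ | ‖WithLp.toLp 2 (a • g)‖ < Δ} (fun _ => 2 * (n : ℝ≥0∞)) g := by
    intro g
    by_cases hg : ‖WithLp.toLp 2 (a • g)‖ < Δ
    · rw [Set.indicator_of_mem (by exact hg)]
      refine le_add_left ?_
      calc _ ≤ ∫⁻ _, (2 * n : ℝ≥0∞) ∂noise p n := by
            refine lintegral_mono fun ξ => ?_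
            have h : ((loss (f (randomCentreObs a η (ξ, g))) η : ℕ) : ℝ≥0∞) ≤ ((2 * n : ℕ) : ℝ≥0∞) :=
              Nat.cast_le.2 (loss_le _ η)
            simpa using h
        _ = _ := by simp
    · rw [Set.indicator_of_notMem (by exact hg), add_zero]
      refine le_trans (le_of_eq ?_) (lintegral_loss_le_maxRisk (not_lt.1 hg) η f)
      rw [lintegral_loss_law _ _ _ hf]
      refine lintegral_congr fun ξ => ?_
      have : randomCentreObs a η (ξ, g)
          = fun i b => η.toReal i * (WithLp.toLp 2 (a • g) : EuclideanSpace ℝ (Fin p)) b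
            + 1 * ξ i b := by
        ext i b
        simp [randomCentreObs, mul_assoc]
      rw [this]
  refine (lintegral_mono hpt).trans (le_of_eq ?_)
  rw [lintegral_add_left measurable_const, lintegral_const, measure_univ, mul_one,
    lintegral_indicator_const hS]

/-- A Gaussian centre whose mean squared norm exceeds `Δ²` by the factor `1 + δ` is rarely shorter
than `Δ`. -/
lemma gaussVec_short_le {p : ℕ} (hp : 1 ≤ p) {a Δ δ : ℝ} (hδ : 0 < δ) (hδ1 : δ ≤ 1) (hΔ : 0 < Δ)
    (ha : p * a ^ 2 = (1 + δ) * Δ ^ 2) :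
    gaussVec p {g | ‖WithLp.toLp 2 (a • g)‖ < Δ} ≤ ENNReal.ofReal (Real.exp (-(δ ^ 2 * p / 64))) := by
  have hp1 : (1 : ℝ) ≤ p := by exact_mod_cast hp
  calc _ ≤ gaussVec p {g | δ ^ 2 * p / 32 ≤ -(δ / 16) * (∑ b, g b ^ 2 - p)} := by
        refine measure_mono fun g hg => ?_
        simp only [Set.mem_ofPred_eq] at hg ⊢
        have h1 : ‖WithLp.toLp 2 (a • g)‖ ^ 2 < Δ ^ 2 := pow_lt_pow_left₀ hg (norm_nonneg _) two_ne_zero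
        rw [norm_toLp_sq] at h1
        have h2 : (a • g) ⬝ᵥ (a • g) = a ^ 2 * ∑ b, g b ^ 2 := by
          rw [smul_dotProduct, dotProduct_smul, smul_eq_mul, smul_eq_mul]
          simp only [dotProduct, ← sq]
          ring
        have h3 : a ^ 2 * ∑ b, g b ^ 2 < Δ ^ 2 := by
          rwa [h2] at h1
        set S := ∑ b, g b ^ 2
        have hS0 : 0 ≤ S := Finset.sum_nonneg fun _ _ => sq_nonneg _
        have h4 : (1 + δ) * S < p := by
          have h5 : (p * a ^ 2) * S < p * Δ ^ 2 := by
            rw [mul_assoc]; exact mul_lt_mul_of_pos_left h3 (by linarith)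
          rw [ha] at h5
          have hΔ2 : 0 < Δ ^ 2 := by positivity
          nlinarith
        -- `p - S ≥ δ p / (1 + δ) ≥ δ p / 2`
        have h6 : δ * p / 2 ≤ p - S := by
          refine le_of_mul_le_mul_left ?_ (by linarith : 0 < 1 + δ)
          nlinarith [mul_nonneg (by linarith : (0 : ℝ) ≤ p) (mul_nonneg hδ.le (sub_nonneg.2 hδ1))]
        nlinarith
    _ ≤ _ := gaussVec_chiSq_tail p (by linarith) _
    _ ≤ _ := by
        refine ENNReal.ofReal_le_ofReal (Real.exp_le_exp.2 (le_of_eq ?_))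
        ring

/-- The bound obtained from a Gaussian centre. -/
lemma mul_gaussianTail_le_maxRisk_random {p n : ℕ} (hn : 2 ≤ n) (hp : 1 ≤ p) {Δ δ : ℝ} (hΔ : 0 < Δ)
    (hδ : 0 < δ) (hδ1 : δ ≤ 1) {f : Data p n → Labels n} (hf : Measurable f) :
    ((n - 1 : ℕ) : ℝ≥0∞) * (ENNReal.ofReal (1 - Real.exp (-(δ ^ 2 / 16)))
        * gaussianTail ((1 + δ) ^ 2 * snr p n 1 Δ))
      ≤ 2 * (maxRisk 1 Δ f + 2 * n * ENNReal.ofReal (Real.exp (-(δ ^ 2 * p / 64)))) := by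
  have hn2 : (2 : ℝ) ≤ n := by exact_mod_cast hn
  have hp1 : (1 : ℝ) ≤ p := by exact_mod_cast hp
  set a := √((1 + δ) * Δ ^ 2 / p) with hadef
  have ha2 : a ^ 2 = (1 + δ) * Δ ^ 2 / p := Real.sq_sqrt (by positivity)
  have ha0 : 0 < a := Real.sqrt_pos.2 (by positivity)
  have hr := snr_pos (p := p) (n := n) hΔ
  refine mul_testError_le_of_risk_le
    (Q := fun η => ((noise p n).prod (gaussVec p)).map (randomCentreObs a η)) ?_ hf
    fun η => (lintegral_loss_randomCentre_le a Δ η hf).trans ?_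
  · intro η i A hA
    refine testError_randomCentre_ge hn hp ha0 hδ hδ1 (by positivity) ?_ η i hA
    rw [mul_pow, snr_sq, show a ^ 4 = (a ^ 2) ^ 2 by ring, ha2]
    have hs : 0 < Δ ^ 2 := by positivity
    generalize Δ ^ 2 = s at hs
    have e1 : s ^ 2 / (s + p / n) = n * s ^ 2 / (n * s + p) := by field_simp
    rw [e1]
    have e2 : (1 + δ) * p * ((n - 1) * ((1 + δ) * s / p) ^ 2)
        = (1 + δ) ^ 3 * ((n - 1) * s ^ 2) / p := by field_simp
    have e3 : ((1 + δ) ^ 2) ^ 2 * (n * s ^ 2 / (n * s + p)) * (1 + n * ((1 + δ) * s / p))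
        = (1 + δ) ^ 3 * (n * s ^ 2) / p * ((1 + δ) * (p + n * ((1 + δ) * s)) / (n * s + p)) := by
      field_simp
    rw [e2, e3]
    have h1 : 1 ≤ (1 + δ) * (p + n * ((1 + δ) * s)) / (n * s + p) := by
      rw [le_div_iff₀ (by positivity)]
      have : 0 ≤ n * s := by positivity
      nlinarith [mul_nonneg hδ.le this, mul_nonneg (mul_nonneg hδ.le hδ.le) this]
    calc _ ≤ (1 + δ) ^ 3 * (n * s ^ 2) / p := by gcongr; linarith
      _ ≤ _ := le_mul_of_one_le_right (by positivity) h1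
  · gcongr
    refine gaussVec_short_le hp hδ hδ1 hΔ ?_
    rw [ha2]; field_simp

/-- Non-asymptotic lower bound for the maximal risk: a known centre is the harder case when `p` is
small compared with `n Δ²`, a Gaussian one otherwise. -/
lemma mul_gaussianTail_snr_le_maxRisk {p n : ℕ} (hn : 2 ≤ n) (hp : 1 ≤ p) {Δ δ : ℝ} (hΔ : 1 ≤ Δ)
    (hδ : 0 < δ) (hδ1 : δ ≤ 1) {f : Data p n → Labels n} (hf : Measurable f) :
    ((n - 1 : ℕ) : ℝ≥0∞) * (ENNReal.ofReal (1 - Real.exp (-(δ ^ 2 / 16)))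
        * gaussianTail ((1 + δ) ^ 2 * snr p n 1 Δ))
      ≤ 2 * (maxRisk 1 Δ f + 2 * n * ENNReal.ofReal (Real.exp (-(δ ^ 3 * n / 64)))) := by
  have hn2 : (2 : ℝ) ≤ n := by exact_mod_cast hn
  have hs : 1 ≤ Δ ^ 2 := one_le_pow₀ hΔ
  rcases le_total (p : ℝ) (δ * (n * Δ ^ 2)) with h | h
  · have hr : Δ ≤ (1 + δ) ^ 2 * snr p n 1 Δ := by
      have h0 := snr_pos (p := p) (n := n) (x := Δ) (by linarith)
      refine (pow_le_pow_iff_left₀ (by linarith) (by positivity) two_ne_zero).1 ?_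
      rw [mul_pow, snr_sq]
      generalize Δ ^ 2 = s at *
      have e1 : s ^ 2 / (s + p / n) = n * s ^ 2 / (n * s + p) := by field_simp
      rw [e1, ← mul_div_assoc, le_div_iff₀ (by positivity)]
      have h1 : n * s + p ≤ (1 + δ) * (n * s) := by linarith
      have h2 : (1 + δ) * (n * s) ≤ ((1 + δ) ^ 2) ^ 2 * (n * s) := by
        gcongr
        rw [← pow_mul]
        exact le_self_pow₀ (by linarith) (by norm_num)
      nlinarith
    calc _ ≤ ((n - 1 : ℕ) : ℝ≥0∞) * (1 * gaussianTail Δ) := by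
          gcongr
          · rw [← ENNReal.ofReal_one]
            exact ENNReal.ofReal_le_ofReal (by linarith [Real.exp_pos (-(δ ^ 2 / 16))])
          · exact gaussianTail_antitone hr
      _ ≤ 2 * maxRisk 1 Δ f := by
          rw [one_mul]; exact mul_gaussianTail_le_maxRisk hp (by linarith) hf
      _ ≤ _ := by gcongr; exact le_self_add
  · refine (mul_gaussianTail_le_maxRisk_random hn hp (by linarith) hδ hδ1 hf).trans ?_
    gcongr 2 * (_ + 2 * _ * ENNReal.ofReal (Real.exp (-(?_ / _))))
    have : δ * n ≤ p := le_trans (by nlinarith [mul_nonneg hδ.le (by linarith : (0:ℝ) ≤ n)]) h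
    nlinarith [mul_le_mul_of_nonneg_left this (sq_nonneg δ)]

lemma snr_one_le_one (p n : ℕ) : snr p n 1 1 ≤ 1 := by
  refine abs_le_of_sq_le_sq' ?_ zero_le_one |>.2
  rw [snr_sq]
  simp only [one_pow]
  have : (0 : ℝ) ≤ p / n := by positivity
  exact div_le_one_of_le₀ (by linarith) (by linarith)

/-- The lower bound for all separations and noise levels. Replacing `snr` by `max snr 1` allows for
separations below the noise level. -/
lemma mul_gaussianTail_max_le_maxRisk {p n : ℕ} (hn : 2 ≤ n) (hp : 1 ≤ p) {σ Δ δ : ℝ} (hσ : 0 < σ)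
    (hΔ : 0 < Δ) (hδ : 0 < δ) (hδ1 : δ ≤ 1) {f : Data p n → Labels n} (hf : Measurable f) :
    ((n - 1 : ℕ) : ℝ≥0∞) * (ENNReal.ofReal (1 - Real.exp (-(δ ^ 2 / 16)))
        * gaussianTail ((1 + δ) ^ 2 * max (snr p n σ Δ) 1))
      ≤ 2 * (maxRisk σ Δ f + 2 * n * ENNReal.ofReal (Real.exp (-(δ ^ 3 * n / 64)))) := by
  rw [maxRisk_eq_maxRisk_one hσ Δ hf, snr_eq_snr_one]
  have hx : 0 < Δ / σ := by positivity
  set x := Δ / σ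
  have hf' : Measurable fun Y : Data p n => f (σ • Y) := hf.comp (measurable_const_smul σ)
  refine le_trans ?_ ((mul_gaussianTail_snr_le_maxRisk hn hp (le_max_right x 1) hδ hδ1 hf').trans ?_)
  · gcongr
    refine gaussianTail_antitone ?_
    gcongr
    rcases le_total x 1 with h | h
    · rw [max_eq_right h]
      exact (snr_one_le_one p n).trans (le_max_right _ _)
    · rw [max_eq_left h]
      exact le_max_left _ _
  · gcongr
    exact maxRisk_antitone (le_max_left x 1) _

/-! ### Asymptotics -/

/-- A lower bound for the Gaussian tail with the sharp exponent. -/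
lemma ofReal_exp_le_gaussianTail {t : ℝ} (ht : 0 ≤ t) :
    ENNReal.ofReal ((√(2 * Real.pi))⁻¹ * Real.exp (-((t + 1) ^ 2 / 2))) ≤ gaussianTail t := by
  set c := (√(2 * Real.pi))⁻¹ * Real.exp (-((t + 1) ^ 2 / 2)) with hc
  calc ENNReal.ofReal c = ∫⁻ _ in Set.Ioc t (t + 1), ENNReal.ofReal c := by simp
    _ ≤ ∫⁻ x in Set.Ioc t (t + 1), gaussianPDF 0 1 x := by
        refine setLIntegral_mono (measurable_gaussianPDF 0 1) fun x hx => ?_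
        rw [gaussianPDF, gaussianPDFReal, hc]
        refine ENNReal.ofReal_le_ofReal ?_
        simp only [NNReal.coe_one, mul_one, sub_zero, neg_div]
        have : x ^ 2 ≤ (t + 1) ^ 2 := pow_le_pow_left₀ (ht.trans hx.1.le) hx.2 2
        gcongr
    _ = gaussianReal 0 1 (Set.Ioc t (t + 1)) := (gaussianReal_apply 0 one_ne_zero _).symm
    _ ≤ gaussianTail t := measure_mono Set.Ioc_subset_Ioi_self

lemma gaussianTail_pos (t : ℝ) : 0 < gaussianTail t := by
  refine lt_of_lt_of_le ?_ ((ofReal_exp_le_gaussianTail (le_max_right t 0)).trans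
    (gaussianTail_antitone (le_max_left t 0)))
  rw [ENNReal.ofReal_pos]
  positivity

lemma tendsto_atTop_of_gaussianTail {t : ℕ → ℝ}
    (h : Tendsto (fun n => gaussianTail (t n)) atTop (𝓝 0)) : Tendsto t atTop atTop := by
  refine tendsto_atTop.2 fun b => ?_
  filter_upwards [h.eventually_lt_const (gaussianTail_pos b)] with n hn
  by_contra! hlt
  exact absurd (gaussianTail_antitone hlt.le) (not_le.2 hn)

lemma tendsto_gaussianTail {t : ℕ → ℝ} (h : Tendsto t atTop atTop) :
    Tendsto (fun n => gaussianTail (t n)) atTop (𝓝 0) := by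
  have h1 : Tendsto (fun x : ℝ => gaussianTail x) atTop (𝓝 0) := by
    have := tendsto_measure_iInter_atTop (μ := gaussianReal 0 1) (s := fun x : ℝ => Set.Ioi x)
      (fun x => measurableSet_Ioi.nullMeasurableSet) (fun _ _ h => Set.Ioi_subset_Ioi h)
      ⟨0, measure_ne_top _ _⟩
    have h0 : ⋂ x : ℝ, Set.Ioi x = ∅ := by
      refine Set.eq_empty_of_forall_notMem fun y hy => ?_
      exact lt_irrefl y (Set.mem_iInter.1 hy y)
    rwa [h0, measure_empty] at this
  exact h1.comp h

/-- The number of iterations makes the geometric term negligible. -/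
lemma tendsto_geometric_floor_log :
    Tendsto (fun n : ℕ => (n : ℝ) * (1 / 4) ^ ⌊3 * Real.log (n : ℝ)⌋₊) atTop (𝓝 0) := by
  have hlim : Tendsto (fun n : ℕ => Real.exp (1 - 2 * Real.log n)) atTop (𝓝 0) := by
    refine Real.tendsto_exp_atBot.comp ?_
    have : Tendsto (fun n : ℕ => 2 * Real.log n) atTop atTop :=
      (Real.tendsto_log_atTop.comp tendsto_natCast_atTop_atTop).const_mul_atTop (by norm_num)
    exact tendsto_atBot_add_const_left _ 1 (tendsto_neg_atTop_atBot.comp this)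
  refine squeeze_zero' (Eventually.of_forall fun n => by positivity) ?_ hlim
  filter_upwards [eventually_ge_atTop 1] with n hn
  have hn0 : (0 : ℝ) < n := by exact_mod_cast hn
  set k := ⌊3 * Real.log (n : ℝ)⌋₊
  have hk : 3 * Real.log n < k + 1 := Nat.lt_floor_add_one _
  have h1 : (1 / 4 : ℝ) ≤ Real.exp (-1) := by
    rw [Real.exp_neg, ← one_div]
    exact one_div_le_one_div_of_le (Real.exp_pos 1) (by linarith [Real.exp_one_lt_d9])
  calc (n : ℝ) * (1 / 4) ^ k ≤ n * Real.exp (-1) ^ k := by gcongr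
    _ = Real.exp (Real.log n + k * (-1)) := by
        rw [Real.exp_add, Real.exp_log hn0, Real.exp_nat_mul]
    _ ≤ _ := Real.exp_le_exp.2 (by linarith)

lemma tendsto_mul_exp_neg {c : ℝ} (hc : 0 < c) :
    Tendsto (fun n : ℕ => (n : ℝ) * Real.exp (-(c * n))) atTop (𝓝 0) := by
  have h := (Real.tendsto_pow_mul_exp_neg_atTop_nhds_zero 1).comp
    ((tendsto_natCast_atTop_atTop (R := ℝ)).const_mul_atTop hc)
  have h2 := h.const_mul c⁻¹
  rw [mul_zero] at h2
  refine h2.congr fun n => ?_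
  simp only [Function.comp_apply, pow_one]
  field_simp

lemma tendsto_remainder :
    Tendsto (fun n : ℕ => ENNReal.ofReal (2 * n * (1 / 4) ^ ⌊3 * Real.log (n : ℝ)⌋₊
      + 10 * n * Real.exp (-n))) atTop (𝓝 0) := by
  have h := (tendsto_geometric_floor_log.const_mul 2).add
    ((tendsto_mul_exp_neg one_pos).const_mul 10)
  rw [mul_zero, mul_zero, add_zero] at h
  rw [← ENNReal.ofReal_zero]
  refine (ENNReal.tendsto_ofReal h).congr fun n => ?_
  rw [one_mul, ← mul_assoc, ← mul_assoc]

/-- `maxRisk_lloyd_le` for all noise levels. -/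
lemma maxRisk_lloyd_le_of_snr {p n : ℕ} (hn : 4 ≤ n) {σ Δ δ : ℝ} (hσ : 0 < σ) (hΔ : 0 < Δ)
    (hδ : 0 < δ) (hδ1 : δ ≤ 1) (hr : 5568 / δ ≤ snr p n σ Δ) {f : Data p n → Labels n}
    (hf : IsSpectralEstimator f) (k : ℕ) :
    maxRisk σ Δ (lloyd f k)
      ≤ ENNReal.ofReal (36 / δ * (n * Real.exp (-((1 - δ) ^ 2 / 2
          * ((n - 4) / n * snr p n σ Δ ^ 2)))))
        + ENNReal.ofReal (2 * n * (1 / 4) ^ k + 10 * n * Real.exp (-n)) := by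
  rw [maxRisk_eq_maxRisk_one hσ Δ (measurable_lloyd hf.1 k), snr_eq_snr_one,
    ← ENNReal.ofReal_add (by positivity) (by positivity), ← add_assoc]
  rw [snr_eq_snr_one] at hr
  simp only [lloyd_smul f hσ k]
  exact maxRisk_lloyd_le hn (by positivity) hδ hδ1 hr (hf.comp_smul hσ) k

/-- The sequence of signal-to-noise ratios. -/
abbrev snrSeq (p : ℕ → ℕ) (σ Δ : ℕ → ℝ) (n : ℕ) : ℝ := snr (p n) n (σ n) (Δ n)

lemma snrSeq_pos {p : ℕ → ℕ} {σ Δ : ℕ → ℝ} (hσ : ∀ n ≥ 2, 0 < σ n) (hΔ : ∀ n ≥ 2, 0 < Δ n) {n : ℕ}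
    (hn : 2 ≤ n) : 0 < snrSeq p σ Δ n := by
  rw [snrSeq, snr_eq_snr_one]
  exact snr_pos (div_pos (hΔ n hn) (hσ n hn))

lemma achievesAlmostFull_lloyd {p : ℕ → ℕ} {σ Δ : ℕ → ℝ} (hσ : ∀ n ≥ 2, 0 < σ n)
    (hΔ : ∀ n ≥ 2, 0 < Δ n) (h : Tendsto (snrSeq p σ Δ) atTop atTop)
    {f : ∀ n, Data (p n) n → Labels n} (hf : ∀ n ≥ 2, IsSpectralEstimator (f n)) :
    AchievesAlmostFull p σ Δ fun n => lloyd (f n) ⌊3 * Real.log (n : ℝ)⌋₊ := by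
  refine ⟨fun n hn => measurable_lloyd (hf n hn).1 _, ?_⟩
  have hlim : Tendsto (fun n : ℕ => ENNReal.ofReal (72 * Real.exp (-(snrSeq p σ Δ n / 16)))
      + ENNReal.ofReal (2 * n * (1 / 4) ^ ⌊3 * Real.log (n : ℝ)⌋₊ + 10 * n * Real.exp (-n)))
      atTop (𝓝 0) := by
    rw [← add_zero (0 : ℝ≥0∞)]
    refine Tendsto.add ?_ tendsto_remainder
    rw [← ENNReal.ofReal_zero, ← mul_zero (72 : ℝ)]
    refine ENNReal.tendsto_ofReal (Tendsto.const_mul _ (Real.tendsto_exp_neg_atTop_nhds_zero.comp ?_))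
    exact h.atTop_div_const (by norm_num)
  refine tendsto_of_tendsto_of_tendsto_of_le_of_le' tendsto_const_nhds hlim
    (Eventually.of_forall fun _ => zero_le) ?_
  filter_upwards [eventually_ge_atTop 8, h.eventually_ge_atTop (5568 / (1 / 2))] with n hn hr
  have hn8 : (8 : ℝ) ≤ n := by exact_mod_cast hn
  have hn2 : 2 ≤ n := by omega
  have hb := maxRisk_lloyd_le_of_snr (by omega) (hσ n hn2) (hΔ n hn2) one_half_pos (by norm_num) hr
    (hf n hn2) ⌊3 * Real.log (n : ℝ)⌋₊
  set r := snr (p n) n (σ n) (Δ n)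
  have hn0 : (n : ℝ≥0∞) ≠ 0 := by simp; omega
  have hn1 : (n : ℝ≥0∞)⁻¹ ≤ 1 := ENNReal.inv_le_one.2 (by exact_mod_cast (by omega : 1 ≤ n))
  calc _ ≤ (n : ℝ≥0∞)⁻¹ * _ := by gcongr
    _ = _ := mul_add _ _ _
    _ ≤ _ := by
        refine add_le_add ?_ (mul_le_of_le_one_left zero_le hn1)
        rw [← ENNReal.ofReal_natCast n, ← ENNReal.ofReal_inv_of_pos (by linarith),
          ← ENNReal.ofReal_mul (by positivity)]
        refine ENNReal.ofReal_le_ofReal ?_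
        have e : (n : ℝ)⁻¹ * (36 / (1 / 2) * (n * Real.exp (-((1 - 1 / 2) ^ 2 / 2
            * ((n - 4) / n * r ^ 2))))) = 72 * Real.exp (-((1 - 1 / 2) ^ 2 / 2
            * ((n - 4) / n * r ^ 2))) := by field_simp; norm_num
        rw [e]
        gcongr 72 * Real.exp (-?_)
        have h1 : (1 / 2 : ℝ) ≤ (n - 4) / n := by rw [le_div_iff₀ (by linarith)]; linarith
        have h2 : r ≤ r ^ 2 := le_self_pow₀ (by linarith) two_ne_zero
        calc r / 16 = (1 - 1 / 2) ^ 2 / 2 * (1 / 2 * r) := by ring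
          _ ≤ _ := by gcongr

lemma achievesExact_lloyd {p : ℕ → ℕ} {σ Δ : ℕ → ℝ} (hσ : ∀ n ≥ 2, 0 < σ n)
    (hΔ : ∀ n ≥ 2, 0 < Δ n) {ε : ℝ} (hε : 0 < ε)
    (h : Tendsto (fun n : ℕ => (n : ℝ≥0∞) * gaussianTail (snrSeq p σ Δ n * (1 - ε))) atTop (𝓝 0))
    {f : ∀ n, Data (p n) n → Labels n} (hf : ∀ n ≥ 2, IsSpectralEstimator (f n)) :
    AchievesExact p σ Δ fun n => lloyd (f n) ⌊3 * Real.log (n : ℝ)⌋₊ := by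
  -- The hypothesis becomes weaker as `ε` decreases, which allows for `ε < 1`.
  wlog hε1 : ε < 1 generalizing ε
  · refine this (ε := 1 / 2) (by norm_num) ?_ (by norm_num)
    refine tendsto_of_tendsto_of_tendsto_of_le_of_le' tendsto_const_nhds h
      (Eventually.of_forall fun _ => zero_le) ?_
    filter_upwards [eventually_ge_atTop 2] with n hn
    have := snrSeq_pos (p := p) hσ hΔ hn
    gcongr
    refine gaussianTail_antitone ?_
    gcongr
    linarith
  refine ⟨fun n hn => measurable_lloyd (hf n hn).1 _, ?_⟩
  have hr : Tendsto (snrSeq p σ Δ) atTop atTop := by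
    have h1 : Tendsto (fun n => gaussianTail (snrSeq p σ Δ n * (1 - ε))) atTop (𝓝 0) := by
      refine tendsto_of_tendsto_of_tendsto_of_le_of_le' tendsto_const_nhds h
        (Eventually.of_forall fun _ => zero_le) ?_
      filter_upwards [eventually_ge_atTop 1] with n hn
      exact le_mul_of_one_le_left zero_le (by exact_mod_cast hn)
    exact (tendsto_mul_const_atTop_of_pos (by linarith)).1 (tendsto_atTop_of_gaussianTail h1)
  set δ := ε / 4 with hδ
  have hδ0 : 0 < δ := by positivity
  set c := (√(2 * Real.pi))⁻¹ with hc
  have hc0 : 0 < c := by positivity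
  have hlim : Tendsto (fun n : ℕ => ENNReal.ofReal (36 / δ * c⁻¹)
      * ((n : ℝ≥0∞) * gaussianTail (snrSeq p σ Δ n * (1 - ε)))
      + ENNReal.ofReal (2 * n * (1 / 4) ^ ⌊3 * Real.log (n : ℝ)⌋₊ + 10 * n * Real.exp (-n)))
      atTop (𝓝 0) := by
    have h1 := (ENNReal.Tendsto.const_mul (a := ENNReal.ofReal (36 / δ * c⁻¹)) h
      (Or.inr ENNReal.ofReal_ne_top)).add tendsto_remainder
    rwa [mul_zero, add_zero] at h1
  refine tendsto_of_tendsto_of_tendsto_of_le_of_le' tendsto_const_nhds hlim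
    (Eventually.of_forall fun _ => zero_le) ?_
  filter_upwards [eventually_ge_atTop 8, hr.eventually_ge_atTop (5568 / δ),
    (tendsto_natCast_atTop_atTop (R := ℝ)).eventually_ge_atTop (4 / δ)] with n hn hrn hnδ
  have hn8 : (8 : ℝ) ≤ n := by exact_mod_cast hn
  have hn2 : 2 ≤ n := by omega
  refine (maxRisk_lloyd_le_of_snr (by omega) (hσ n hn2) (hΔ n hn2) hδ0 (by linarith) hrn
    (hf n hn2) ⌊3 * Real.log (n : ℝ)⌋₊).trans ?_
  rw [div_le_iff₀ hδ0] at hrn hnδ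
  change 5568 ≤ snr (p n) n (σ n) (Δ n) * δ at hrn
  have hr0 : 0 < snr (p n) n (σ n) (Δ n) := snrSeq_pos hσ hΔ hn2
  simp only [snrSeq]
  set r := snr (p n) n (σ n) (Δ n)
  refine add_le_add_left ?_ _
  calc _ ≤ ENNReal.ofReal (36 / δ * c⁻¹ * (n * (c * Real.exp (-((r * (1 - ε) + 1) ^ 2 / 2))))) := by
        refine ENNReal.ofReal_le_ofReal ?_
        have e : 36 / δ * c⁻¹ * (n * (c * Real.exp (-((r * (1 - ε) + 1) ^ 2 / 2))))
            = 36 / δ * (n * Real.exp (-((r * (1 - ε) + 1) ^ 2 / 2))) := by field_simp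
        rw [e]
        gcongr 36 / δ * (n * Real.exp (-?_))
        have h1 : 1 - δ ≤ (n - 4) / n := by rw [le_div_iff₀ (by linarith)]; linarith
        have hδ1 : 0 ≤ 1 - δ := by linarith
        -- `(1 - δ) ^ 3 ≥ (1 - 2 δ) ^ 2` because `δ ≤ 1 / 4`
        have h2 : (r * (1 - ε) + 1) ^ 2 ≤ (1 - δ) ^ 2 * ((1 - δ) * r ^ 2) := by
          have h3 : r * (1 - ε) + 1 ≤ (1 - 2 * δ) * r := by nlinarith
          calc _ ≤ ((1 - 2 * δ) * r) ^ 2 := by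
                refine pow_le_pow_left₀ ?_ h3 2
                have : 0 ≤ r * (1 - ε) := mul_nonneg hr0.le (by linarith)
                linarith
            _ = (1 - 2 * δ) ^ 2 * r ^ 2 := by ring
            _ ≤ (1 - δ) ^ 3 * r ^ 2 := by
                gcongr
                nlinarith [mul_pos hδ0 hδ0]
            _ = _ := by ring
        calc _ ≤ (1 - δ) ^ 2 * ((1 - δ) * r ^ 2) / 2 := by gcongr
          _ = (1 - δ) ^ 2 / 2 * ((1 - δ) * r ^ 2) := by ring
          _ ≤ _ := by gcongr
    _ = ENNReal.ofReal (36 / δ * c⁻¹)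
        * (n * ENNReal.ofReal (c * Real.exp (-((r * (1 - ε) + 1) ^ 2 / 2)))) := by
        rw [ENNReal.ofReal_mul (by positivity), ENNReal.ofReal_mul (Nat.cast_nonneg n),
          ENNReal.ofReal_natCast]
    _ ≤ _ := by
        gcongr
        exact ofReal_exp_le_gaussianTail (mul_nonneg hr0.le (by linarith))

/-- The lower bound of `mul_gaussianTail_max_le_maxRisk` in a form ready for limits. -/
lemma gaussianTail_le_maxRisk_add {p n : ℕ} (hn : 2 ≤ n) (hp : 1 ≤ p) {σ Δ δ : ℝ} (hσ : 0 < σ)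
    (hΔ : 0 < Δ) (hδ : 0 < δ) (hδ1 : δ ≤ 1) {f : Data p n → Labels n} (hf : Measurable f) :
    ENNReal.ofReal (1 - Real.exp (-(δ ^ 2 / 16)))
        * (n * gaussianTail ((1 + δ) ^ 2 * max (snr p n σ Δ) 1))
      ≤ 4 * maxRisk σ Δ f + ENNReal.ofReal (8 * (n * Real.exp (-(δ ^ 3 / 64 * n)))) := by
  have h := mul_gaussianTail_max_le_maxRisk hn hp hσ hΔ hδ hδ1 hf
  have h2 : (n : ℝ≥0∞) ≤ 2 * ((n - 1 : ℕ) : ℝ≥0∞) := by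
    exact_mod_cast (by omega : n ≤ 2 * (n - 1))
  set T := gaussianTail ((1 + δ) ^ 2 * max (snr p n σ Δ) 1)
  set C := ENNReal.ofReal (1 - Real.exp (-(δ ^ 2 / 16)))
  calc C * (n * T) ≤ C * (2 * ((n - 1 : ℕ) : ℝ≥0∞) * T) := by gcongr
    _ = 2 * (((n - 1 : ℕ) : ℝ≥0∞) * (C * T)) := by ring
    _ ≤ 2 * (2 * (maxRisk σ Δ f + 2 * n * ENNReal.ofReal (Real.exp (-(δ ^ 3 * n / 64))))) := by
        gcongr
    _ = 4 * maxRisk σ Δ f + 8 * (n * ENNReal.ofReal (Real.exp (-(δ ^ 3 * n / 64)))) := by ring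
    _ = _ := by
        rw [ENNReal.ofReal_mul (by norm_num), ENNReal.ofReal_mul (Nat.cast_nonneg n),
          ENNReal.ofReal_natCast, ENNReal.ofReal_ofNat, mul_div_right_comm]

lemma ofReal_one_sub_exp_pos {x : ℝ} (hx : 0 < x) :
    0 < ENNReal.ofReal (1 - Real.exp (-x)) := by
  rw [ENNReal.ofReal_pos, sub_pos, Real.exp_lt_one_iff]
  linarith

lemma tendsto_ofReal_mul_exp_neg {c : ℝ} (hc : 0 < c) :
    Tendsto (fun n : ℕ => ENNReal.ofReal (8 * (n * Real.exp (-(c * n))))) atTop (𝓝 0) := by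
  have h := (tendsto_mul_exp_neg hc).const_mul 8
  rw [mul_zero] at h
  rw [← ENNReal.ofReal_zero]
  exact ENNReal.tendsto_ofReal h

lemma tendsto_snrSeq_of_almostFullPossible {p : ℕ → ℕ} {σ Δ : ℕ → ℝ} (hp : ∀ n ≥ 2, 1 ≤ p n)
    (hσ : ∀ n ≥ 2, 0 < σ n) (hΔ : ∀ n ≥ 2, 0 < Δ n) (h : AlmostFullPossible p σ Δ) :
    Tendsto (snrSeq p σ Δ) atTop atTop := by
  obtain ⟨f, hf, hlim⟩ := h
  set C := ENNReal.ofReal (1 - Real.exp (-((1 : ℝ) ^ 2 / 16))) with hC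
  have hC0 : C ≠ 0 := (ofReal_one_sub_exp_pos (by norm_num)).ne'
  have hCt : C ≠ ⊤ := ENNReal.ofReal_ne_top
  have h1 : Tendsto (fun n : ℕ => C⁻¹ * (4 * ((n : ℝ≥0∞)⁻¹ * maxRisk (σ n) (Δ n) (f n))
      + ENNReal.ofReal (8 * (n * Real.exp (-((1 : ℝ) ^ 3 / 64 * n)))))) atTop (𝓝 0) := by
    have h2 := (ENNReal.Tendsto.const_mul (a := 4) hlim (Or.inr (by norm_num))).add
      (tendsto_ofReal_mul_exp_neg (c := (1 : ℝ) ^ 3 / 64) (by norm_num))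
    have h3 := ENNReal.Tendsto.const_mul (a := C⁻¹) h2 (Or.inr (ENNReal.inv_ne_top.2 hC0))
    simpa only [mul_zero, add_zero] using h3
  have h4 : Tendsto (fun n => gaussianTail ((1 + 1) ^ 2 * max (snrSeq p σ Δ n) 1)) atTop (𝓝 0) := by
    refine tendsto_of_tendsto_of_tendsto_of_le_of_le' tendsto_const_nhds h1
      (Eventually.of_forall fun _ => zero_le) ?_
    filter_upwards [eventually_ge_atTop 2] with n hn
    have hb := gaussianTail_le_maxRisk_add hn (hp n hn) (hσ n hn) (hΔ n hn) one_pos le_rfl (hf n hn)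
    have hn0 : (n : ℝ≥0∞) ≠ 0 := by simp; omega
    have hnt : (n : ℝ≥0∞) ≠ ⊤ := ENNReal.natCast_ne_top n
    have hn1 : (n : ℝ≥0∞)⁻¹ ≤ 1 := ENNReal.inv_le_one.2 (by exact_mod_cast (by omega : 1 ≤ n))
    set T := gaussianTail ((1 + 1) ^ 2 * max (snrSeq p σ Δ n) 1)
    calc T = C⁻¹ * ((n : ℝ≥0∞)⁻¹ * (C * (n * T))) := by
          rw [mul_left_comm _ C, ← mul_assoc, ENNReal.inv_mul_cancel hC0 hCt, one_mul, ← mul_assoc,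
            ENNReal.inv_mul_cancel hn0 hnt, one_mul]
      _ ≤ C⁻¹ * ((n : ℝ≥0∞)⁻¹ * (4 * maxRisk (σ n) (Δ n) (f n)
            + ENNReal.ofReal (8 * (n * Real.exp (-((1 : ℝ) ^ 3 / 64 * n)))))) := by gcongr
      _ ≤ _ := by
          rw [mul_add, mul_left_comm _ 4]
          gcongr
          exact mul_le_of_le_one_left zero_le hn1
  have h5 := tendsto_atTop_of_gaussianTail h4
  refine tendsto_atTop.2 fun b => ?_
  filter_upwards [h5.eventually_ge_atTop (4 * max b 2)] with n hn
  have h6 : max b 2 ≤ max (snrSeq p σ Δ n) 1 := by linarith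
  rcases le_max_iff.1 ((le_max_left b 2).trans h6) with h7 | h7
  · exact h7
  · have := (le_max_right b 2).trans h6
    rcases le_max_iff.1 this with h8 | h8 <;> linarith

lemma exactImpossible_of_liminf {p : ℕ → ℕ} {σ Δ : ℕ → ℝ} (hp : ∀ n ≥ 2, 1 ≤ p n)
    (hσ : ∀ n ≥ 2, 0 < σ n) (hΔ : ∀ n ≥ 2, 0 < Δ n) {ε : ℝ} (hε : 0 < ε)
    (h : 0 < liminf (fun n : ℕ => (n : ℝ≥0∞) * gaussianTail (snrSeq p σ Δ n * (1 + ε))) atTop) :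
    ExactImpossible p σ Δ := by
  obtain ⟨b, hb0, hb⟩ := exists_between h
  set δ := min (ε / 3) 1 with hδdef
  have hδ0 : 0 < δ := lt_min (by positivity) one_pos
  have hδ1 : δ ≤ 1 := min_le_right _ _
  have hδε : (1 + δ) ^ 2 ≤ 1 + ε := by
    have : δ ≤ ε / 3 := min_le_left _ _
    nlinarith
  set C := ENNReal.ofReal (1 - Real.exp (-(δ ^ 2 / 16))) with hC
  have hC0 : 0 < C := ofReal_one_sub_exp_pos (by positivity)
  set x := C * min b 1 with hx
  have hx0 : 0 < x := ENNReal.mul_pos hC0.ne' (lt_min hb0 one_pos).ne'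
  have hxt : x ≠ ⊤ :=
    ENNReal.mul_ne_top ENNReal.ofReal_ne_top (ne_top_of_le_ne_top ENNReal.one_ne_top (min_le_right _ _))
  have hx2 : 0 < x / 2 := ENNReal.half_pos hx0.ne'
  refine lt_of_lt_of_le (ENNReal.div_pos hx2.ne' (by norm_num : (4 : ℝ≥0∞) ≠ ⊤)) ?_
  refine le_liminf_of_le (by isBoundedDefault) ?_
  have hlarge : ∀ᶠ n : ℕ in atTop, 1 ≤ (n : ℝ≥0∞) * gaussianTail (1 + ε) := by
    have hT := gaussianTail_pos (1 + ε)
    have h1 : Tendsto (fun n : ℕ => (n : ℝ≥0∞) * gaussianTail (1 + ε)) atTop (𝓝 ⊤) := by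
      have := ENNReal.Tendsto.mul_const (b := gaussianTail (1 + ε)) ENNReal.tendsto_nat_nhds_top
        (Or.inl ENNReal.top_ne_zero)
      rwa [ENNReal.top_mul hT.ne'] at this
    exact h1.eventually_const_le ENNReal.one_lt_top
  filter_upwards [eventually_ge_atTop 2, eventually_lt_of_lt_liminf hb, hlarge,
    (tendsto_ofReal_mul_exp_neg (c := δ ^ 3 / 64) (by positivity)).eventually_le_const hx2]
    with n hn hbn hln hrem
  refine le_iInf₂ fun f hf => ?_
  have hlow := gaussianTail_le_maxRisk_add hn (hp n hn) (hσ n hn) (hΔ n hn) hδ0 hδ1 hf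
  rw [← hC] at hlow
  have hmin : min b 1 ≤ n * gaussianTail ((1 + δ) ^ 2 * max (snr (p n) n (σ n) (Δ n)) 1) := by
    rcases le_total (snr (p n) n (σ n) (Δ n)) 1 with hs | hs
    · rw [max_eq_right hs, mul_one]
      refine (min_le_right _ _).trans (hln.trans ?_)
      gcongr
      exact gaussianTail_antitone hδε
    · rw [max_eq_left hs]
      refine (min_le_left _ _).trans (hbn.le.trans ?_)
      gcongr
      refine gaussianTail_antitone ?_
      rw [mul_comm]
      simp only [snrSeq]
      gcongr
  have hkey : x / 2 + x / 2 ≤ 4 * maxRisk (σ n) (Δ n) f + x / 2 := by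
    rw [ENNReal.add_halves]
    calc x ≤ _ := by rw [hx]; gcongr
      _ ≤ _ := hlow
      _ ≤ _ := by gcongr
  have hkey2 := (ENNReal.add_le_add_iff_right (ENNReal.div_ne_top hxt two_ne_zero)).1 hkey
  rw [mul_comm] at hkey2
  exact ENNReal.div_le_of_le_mul hkey2

end GaussMix
end

theorem theorem5p1 (p : ℕ → ℕ) (σ Δ : ℕ → ℝ)
    (hp : ∀ n ≥ 2, 1 ≤ p n) (hσ : ∀ n ≥ 2, 0 < σ n) (hΔ : ∀ n ≥ 2, 0 < Δ n) :
    -- spectral estimators exist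
    (∃ η₀ : ∀ n, GaussMix.Data (p n) n → GaussMix.Labels n,
      ∀ n ≥ 2, GaussMix.IsSpectralEstimator (η₀ n)) ∧
    -- almost full recovery
    (GaussMix.AlmostFullPossible p σ Δ ↔
      Tendsto (fun n : ℕ => GaussMix.gaussianTail (GaussMix.snr (p n) n (σ n) (Δ n)))
        atTop (𝓝 0)) ∧
    (Tendsto (fun n : ℕ => GaussMix.gaussianTail (GaussMix.snr (p n) n (σ n) (Δ n)))
        atTop (𝓝 0) →
      ∀ η₀ : ∀ n, GaussMix.Data (p n) n → GaussMix.Labels n,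
        (∀ n ≥ 2, GaussMix.IsSpectralEstimator (η₀ n)) →
        GaussMix.AchievesAlmostFull p σ Δ
          (fun n => GaussMix.lloyd (η₀ n) ⌊3 * Real.log (n : ℝ)⌋₊)) ∧
    -- exact recovery
    (∀ ε : ℝ, 0 < ε →
      0 < liminf (fun n : ℕ =>
        (n : ℝ≥0∞) * GaussMix.gaussianTail (GaussMix.snr (p n) n (σ n) (Δ n) * (1 + ε))) atTop →
      GaussMix.ExactImpossible p σ Δ) ∧
    (∀ ε : ℝ, 0 < ε →
      Tendsto (fun n : ℕ =>
        (n : ℝ≥0∞) * GaussMix.gaussianTail (GaussMix.snr (p n) n (σ n) (Δ n) * (1 - ε)))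
        atTop (𝓝 0) →
      GaussMix.ExactPossible p σ Δ ∧
      ∀ η₀ : ∀ n, GaussMix.Data (p n) n → GaussMix.Labels n,
        (∀ n ≥ 2, GaussMix.IsSpectralEstimator (η₀ n)) →
        GaussMix.AchievesExact p σ Δ
          (fun n => GaussMix.lloyd (η₀ n) ⌊3 * Real.log (n : ℝ)⌋₊)) := by
  have hex : ∃ η₀ : ∀ n, GaussMix.Data (p n) n → GaussMix.Labels n,
      ∀ n ≥ 2, GaussMix.IsSpectralEstimator (η₀ n) := by
    have h : ∀ n, ∃ f : GaussMix.Data (p n) n → GaussMix.Labels n,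
        n ≥ 2 → GaussMix.IsSpectralEstimator f := by
      intro n
      by_cases hn : 2 ≤ n
      · obtain ⟨f, hf⟩ := GaussMix.exists_isSpectralEstimator (p n) (by omega : 1 ≤ n)
        exact ⟨f, fun _ => hf⟩
      · exact ⟨fun _ => 1, fun h => absurd h hn⟩
    choose f hf using h
    exact ⟨f, hf⟩
  have hfull : Tendsto (fun n : ℕ => GaussMix.gaussianTail (GaussMix.snr (p n) n (σ n) (Δ n)))
      atTop (𝓝 0) → ∀ η₀ : ∀ n, GaussMix.Data (p n) n → GaussMix.Labels n,
        (∀ n ≥ 2, GaussMix.IsSpectralEstimator (η₀ n)) →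
        GaussMix.AchievesAlmostFull p σ Δ
          (fun n => GaussMix.lloyd (η₀ n) ⌊3 * Real.log (n : ℝ)⌋₊) := fun h η₀ hη₀ =>
    GaussMix.achievesAlmostFull_lloyd hσ hΔ (GaussMix.tendsto_atTop_of_gaussianTail h) hη₀
  obtain ⟨η₁, hη₁⟩ := hex
  refine ⟨⟨η₁, hη₁⟩, ⟨fun h => ?_, fun h => ⟨_, hfull h η₁ hη₁⟩⟩, hfull, ?_, ?_⟩
  · exact GaussMix.tendsto_gaussianTail
      (GaussMix.tendsto_snrSeq_of_almostFullPossible hp hσ hΔ h)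
  · intro ε hε h
    exact GaussMix.exactImpossible_of_liminf hp hσ hΔ hε h
  · intro ε hε h
    exact ⟨⟨_, GaussMix.achievesExact_lloyd hσ hΔ hε h hη₁⟩,
      fun η₀ hη₀ => GaussMix.achievesExact_lloyd hσ hΔ hε h hη₀⟩
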